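/- **Setting.** Let $W:\mathbb{R}\setminus\{0\}\to\mathbb{R}$ be $C^\infty$ with $W(x)=W(-x)$, and suppose there are $\alpha>3$, $R>0$ and constants $C_i>0$ ($i=0,1,2,\dots$) such that $|W^{(i)}(x)|\le C_i|x|^{-\alpha-i}$ for all $|x|\ge R$ and all $i$. Let $n\ge 0$, $t_0<t_1<\dots<t_{n+1}$ (fixed, independent of $\varepsilon$), $a:=t_0$, $b:=t_{n+1}$, $c\in\mathbb{R}$, $\ell:=c+\mathbb{Z}$. Let $u:[a,b]\to\mathbb{R}$ be continuous and increasing, such that each $u|_{[t_p,t_{p+1}]}$, $0\le p\le n$, is a $C^\infty$ diffeomorphism onto its image. For $\varepsilon>0$ let $$E_\varepsilon(u):=\frac{1}{2N}\sum_{i\ne j\in\ell\cap\frac1\varepsilon[a,b]}W\Big(\frac{u(\varepsilon j)-u(\varepsilon i)}{\varepsilon}\Big),\qquad N:=\operatorname{Card}(\varepsilon\ell\cap[a,b]).$$ For an interval $[r,s]$ let $k_1=\lceil r/\varepsilon-c\rceil$, $k_2=\lfloor s/\varepsilon-c\rfloor$ and $N_{[r,s]}=k_2-k_1+1=\operatorname{Card}(\varepsilon\ell\cap[r,s])$.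 We say that a sequence $\varepsilon\to0^+$ has coefficients $(a_1,a_2,b_1,b_2,c_1,c_2)\in\mathbb{R}^6$ on $[r,s]$ if along it $$\varepsilon(c+k_1)-r=a_1\varepsilon+a_2\varepsilon^2+o(\varepsilon^2),\qquad s-\varepsilon(c+k_2)=b_1\varepsilon+b_2\varepsilon^2+o(\varepsilon^2),\qquad \frac{1}{N_{[r,s]}\,\varepsilon}=\frac1{s-r}+c_1\varepsilon+c_2\varepsilon^2+o(\varepsilon^2).$$ Let $\varepsilon\to0^+$ be a sequence with coefficients $(a_1,a_2,b_1,b_2,c_1,c_2)$ on $[a,b]$ and $(a_1^p,a_2^p,b_1^p,b_2^p,c_1^p,c_2^p)$ on $[t_p,t_{p+1}]$ for each $p\in\{0,\dots,n\}$. **Proposition.** Along this sequence $$E_\varepsilon(u)=E^0+\varepsilon E^1+\varepsilon^2E^2+o(\varepsilon^2),$$ where $$E^0=\frac1{b-a}\int_a^b\sum_{j=1}^\infty W(u'(x)j)\,dx,$$ $$E^1=\sum_{p=0}^n d_p\int_{t_p}^{t_{p+1}}\sum_{j=1}^\infty W(u'(x)j)\,dx+F_1\big(u'(a),u'(t_1^-),u'(t_1^+),\dots,u'(t_n^-),u'(t_n^+),u'(b)\big),$$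 $$E^2=-\frac1{24(b-a)}\int_a^b\sum_{j=1}^\infty W''(u'(x)j)\,u''(x)^2j^4\,dx+\sum_{p=0}^n e_p\int_{t_p}^{t_{p+1}}\sum_{j=1}^\infty W(u'(x)j)\,dx+F_2\big(u'(a),u'(t_1^-),\dots,u'(b),\,u''(a),u''(t_1^-),\dots,u''(b)\big),$$ all these series (at every $x\in(t_p,t_{p+1})$) and integrals being convergent. Here $d_p\in\mathbb{R}$ is a function of $c_1,c_1^p,t_{p+1}-t_p,b-a$ only; $e_p\in\mathbb{R}$ is a function of $c_1,c_1^p,c_2,c_2^p,t_{p+1}-t_p,b-a$ only; and $F_1\in C^\infty((0,\infty)^{2n+2})$, $F_2\in C^\infty((0,\infty)^{2n+2}\times\mathbb{R}^{2n+2})$ depend only on $W$ and on $a_1^p,a_2^p,b_1^p,b_2^p,c_1^p,c_2^p,t_{p+1}-t_p$ ($0\le p\le n$); in particular not on $u$. Moreover no interface–interface interaction term appears: each of $F_1,F_2$ is a sum of one function of the values at $a$, one function of the values at $b$, and, for each $i\in\{1,\dots,n\}$, one function of the one-sided values at $t_i$ only; and pairs of non-adjacent pieces contribute $$\frac1N\sum_{p=0}^{n-2}\sum_{q=p+2}^{n}\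 \sum_{i\in\ell\cap\frac1\varepsilon[t_p,t_{p+1}]}\ \sum_{j\in\ell\cap\frac1\varepsilon[t_q,t_{q+1}]}W\Big(\frac{u(\varepsilon j)-u(\varepsilon i)}{\varepsilon}\Big)=O(\varepsilon^{\alpha-1}),\qquad \varepsilon^{\alpha-1}=o(\varepsilon^2).$$ -/

import Mathlib

open Filter Topology Asymptotics
open scoped ContDiff

noncomputable section

namespace SharpInterfaces

/-- `k₁`: the integer with `a/ε - c ≤ k₁ < a/ε - c + 1`. -/
def firstIdx (a c ε : ℝ) : ℤ := ⌈a / ε - c⌉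

/-- `k₂`: the integer with `b/ε - c - 1 < k₂ ≤ b/ε - c`. -/
def lastIdx (b c ε : ℝ) : ℤ := ⌊b / ε - c⌋

/-- The integers `k` such that the atom `ε (c + k)` of the lattice `ε (c + ℤ)` lies in `[a, b]`. -/
def atoms (a b c ε : ℝ) : Finset ℤ := Finset.Icc (firstIdx a c ε) (lastIdx b c ε)

theorem mem_atoms {a b c ε : ℝ} (hε : 0 < ε) (k : ℤ) :
    k ∈ atoms a b c ε ↔ ε * (c + k) ∈ Set.Icc a b := by
  unfold atoms firstIdx lastIdx
  rw [Finset.mem_Icc, Int.ceil_le, Int.le_floor, Set.mem_Icc, sub_le_iff_le_add,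
    le_sub_iff_add_le, div_le_iff₀ hε, le_div_iff₀ hε]
  constructor <;> rintro ⟨h1, h2⟩ <;> constructor <;> nlinarith

/-- The atomistic energy, for the two-body potential `W`, of the restriction of `u` to the atoms
`ε (c + ℤ) ∩ [a, b]`: the sum over ordered pairs of distinct atoms of
`W ((u (x_j) - u (x_i)) / ε)`, divided by twice the number of atoms. -/
def energy (W u : ℝ → ℝ) (a b c ε : ℝ) : ℝ :=
  1 / (2 * ((atoms a b c ε).card : ℝ)) *
    ∑ i ∈ atoms a b c ε, ∑ j ∈ (atoms a b c ε).erase i,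
      W ((u (ε * (c + j)) - u (ε * (c + i))) / ε)

/-- Along the sequence `ε`, the distances of the extreme atoms to the ends of `[a, b]` and
`1 / (N ε)`, with `N = k₂ - k₁ + 1` the number of atoms, have second order expansions in `ε` with
coefficients `a₁, a₂`, `b₁, b₂` and `c₁, c₂`. -/
structure LatticeExpansion (a b c : ℝ) (ε : ℕ → ℝ) (a₁ a₂ b₁ b₂ c₁ c₂ : ℝ) : Prop where
  left : (fun m => (ε m * (c + firstIdx a c (ε m)) - a) - (a₁ * ε m + a₂ * ε m ^ 2))
    =o[atTop] fun m => ε m ^ 2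
  right : (fun m => (b - ε m * (c + lastIdx b c (ε m))) - (b₁ * ε m + b₂ * ε m ^ 2))
    =o[atTop] fun m => ε m ^ 2
  count : (fun m => 1 / (((lastIdx b c (ε m) - firstIdx a c (ε m) + 1 : ℤ) : ℝ) * ε m)
      - (1 / (b - a) + c₁ * ε m + c₂ * ε m ^ 2))
    =o[atTop] fun m => ε m ^ 2

/-- Every derivative satisfies `W⁽ⁱ⁾(x) = O(|x|^(-α - i))` for `|x| ≥ R`, with one radius `R`. -/
def Decays (W : ℝ → ℝ) (α : ℝ) : Prop :=
  ∃ R > 0, ∀ i : ℕ, ∃ C > 0, ∀ x : ℝ, R ≤ |x| → |iteratedDeriv i W x| ≤ C * |x| ^ (-α - i)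

/-- `u` restricted to `s` is a `C^∞` diffeomorphism onto its image. -/
def IsSmoothDiffeoOn (u : ℝ → ℝ) (s : Set ℝ) : Prop :=
  ContDiffOn ℝ ∞ u s ∧ ∃ g : ℝ → ℝ, ContDiffOn ℝ ∞ g (u '' s) ∧ Set.LeftInvOn g u s

/-- `∑_{j ≥ 1} W(u'(x) j)`. -/
def cauchyBorn (W u : ℝ → ℝ) (x : ℝ) : ℝ := ∑' j : ℕ, W (deriv u x * (j + 1))

/-- `∑_{j ≥ 1} W''(u'(x) j) u''(x)² j⁴`. -/
def gradientDensity (W u : ℝ → ℝ) (x : ℝ) : ℝ :=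
  ∑' j : ℕ, iteratedDeriv 2 W (deriv u x * (j + 1)) * iteratedDeriv 2 u x ^ 2 * ((j : ℝ) + 1) ^ 4

variable {n : ℕ}

/-- The `p`-th piece `[t_p, t_{p+1}]`. -/
def piece (t : Fin (n + 2) → ℝ) (p : Fin (n + 1)) : Set ℝ :=
  Set.Icc (t p.castSucc) (t p.succ)

/-- The values `(u'(t_p⁺), u'(t_{p+1}⁻))`, one pair for each piece. -/
def slopes (t : Fin (n + 2) → ℝ) (u : ℝ → ℝ) (p : Fin (n + 1)) : ℝ × ℝ :=
  (derivWithin u (piece t p) (t p.castSucc), derivWithin u (piece t p) (t p.succ))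

/-- The pairs `(u', u'')` at `t_p⁺` and at `t_{p+1}⁻`, for each piece. -/
def jets (t : Fin (n + 2) → ℝ) (u : ℝ → ℝ) (p : Fin (n + 1)) : (ℝ × ℝ) × (ℝ × ℝ) :=
  ((derivWithin u (piece t p) (t p.castSucc), iteratedDerivWithin 2 u (piece t p) (t p.castSucc)),
    (derivWithin u (piece t p) (t p.succ), iteratedDerivWithin 2 u (piece t p) (t p.succ)))

/-- `(0, ∞)^(2n+2)`. -/
def slopeDomain (n : ℕ) : Set (Fin (n + 1) → ℝ × ℝ) :=
  {v | ∀ p, 0 < (v p).1 ∧ 0 < (v p).2}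

/-- `(0, ∞)^(2n+2) × ℝ^(2n+2)`, grouped by endpoint: the first derivatives are positive. -/
def jetDomain (n : ℕ) : Set (Fin (n + 1) → (ℝ × ℝ) × (ℝ × ℝ)) :=
  {v | ∀ p, 0 < (v p).1.1 ∧ 0 < (v p).2.1}

/-- On `D`, the function `F` of the one-sided data is a sum of one term for each of the two
endpoints and one term for each interface, a function of the data on the two sides of that point
only: no term couples the data of two different interfaces. -/
def NoInteraction {X : Type} (D : Set (Fin (n + 1) → X × X)) (F : (Fin (n + 1) → X × X) → ℝ) :
    Prop :=
  ∃ (φ ψ : X → ℝ) (g : Fin n → X → X → ℝ), ∀ v ∈ D,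
    F v = φ (v 0).1 + ∑ i : Fin n, g i (v i.castSucc).2 (v i.succ).1 + ψ (v (Fin.last n)).2

/-- The contribution to the energy of the pairs of atoms in non-adjacent pieces. -/
def nonadjacentEnergy (W u : ℝ → ℝ) (t : Fin (n + 2) → ℝ) (c ε : ℝ) : ℝ :=
  1 / ((atoms (t 0) (t (Fin.last (n + 1))) c ε).card : ℝ) *
    ∑ p : Fin (n + 1), ∑ q : Fin (n + 1) with p.val + 2 ≤ q.val,
      ∑ i ∈ atoms (t p.castSucc) (t p.succ) c ε, ∑ j ∈ atoms (t q.castSucc) (t q.succ) c ε,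
        W ((u (ε * (c + j)) - u (ε * (c + i))) / ε)

end SharpInterfaces

end

/-! Since `W` is even, the energy is `1 / N` times the sum of `W` over forward bonds `i < j`. The
factor `1 / (N ε)` is expanded by assumption, so it is enough to expand the pair sum as `I / ε + B₀
+ ε B₁ + o(ε)`; `isLittleO_mul_expansion` multiplies the two expansions. The bonds fall into three
classes (`abs_pairSum_sub_le`): inside a piece, across one interface between adjacent pieces, and
longer than a whole piece. A smooth diffeomorphism that increases has slope at least some `δ > 0`,
so a bond of length `l` has strain at least `δ l / ε`. The third class then contributes `O(N² ε^α)`,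
which is `o(ε)` because `α > 3`.

Inside a piece, fix the lattice length `j` of the bonds. The bond centred at `y` is compared with
the mean of `W(j u')` over the cell of width `ε` around `y`. Both are central differences with the
same leading term `W(j u'(y))`, so they differ by `ε²` times a density, and the sum over bonds is a
Riemann sum. The cells leave uncovered a strip at each end, of width about `(a₁ + (j - 1) / 2) ε` on
the left and similarly on the right; its Taylor expansion gives the edge terms. Integration by parts
(`integral_errorDensity`) removes `u'''` and leaves the bulk term `-(1/24) W''(j u') u''² j⁴` and
more boundary terms. All this is dominated by a constant times `j^(2 - α)`, so dominated convergence
sums over `j`: `tendsto_pieceEnergy`.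

Across an interface `t`, the bond from the `i`-th atom on the left to the `k`-th on the right has
limiting strain `(b + i) u'(t⁻) + (a + k) u'(t⁺)`, with an explicit correction of order `ε`. The
errors are dominated by `(1 + i + k)^(1 - α)`, summable over pairs because `α > 3`:
`tendsto_crossSum`.

Every boundary term is a `latticeSum` in the slopes, with second derivatives entering linearly. It
is smooth because each derivative of `W` decays by one more power, which pays for the linear form it
brings out (`contDiffOn_latticeSum`). Each such term involves the data at one end or at one
interface only.

To avoid the singularity of `W` and one-sided derivatives, `W` on `[δ, ∞)` and `u` on each piece are
first extended to differentiable functions on the line. -/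

namespace SharpInterfaces

/-! ### Calculus on the line -/

/-- A function with continuous derivative on a convex set extends to the line, if its derivative
does. -/
theorem exists_extension_of_hasDerivWithinAt {s : Set ℝ} (hs : Convex ℝ s) {x₀ : ℝ} (hx₀ : x₀ ∈ s)
    {f G : ℝ → ℝ} (hG : Continuous G) (h : ∀ x ∈ s, HasDerivWithinAt f (G x) s x) :
    ∃ F : ℝ → ℝ, (∀ x, HasDerivAt F (G x) x) ∧ ∀ x ∈ s, F x = f x := by
  refine ⟨fun x => f x₀ + ∫ y in x₀..x, G y, fun x => ?_, fun x hx => ?_⟩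
  · exact (intervalIntegral.integral_hasDerivAt_right (hG.intervalIntegrable _ _)
      (hG.stronglyMeasurableAtFilter _ _) hG.continuousAt).const_add _
  · have hsub : Set.uIcc x₀ x ⊆ s := hs.ordConnected.uIcc_subset hx₀ hx
    have key := intervalIntegral.integral_eq_sub_of_hasDeriv_right (f := f) (f' := G) (a := x₀)
      (b := x) (fun y hy => ((h y (hsub hy)).mono hsub).continuousWithinAt) (fun y hy => ?_)
      (hG.intervalIntegrable _ _)
    · simp only [key]; ring
    · have hy' : y ∈ Set.uIcc x₀ x := Set.Ioo_subset_Icc_self hy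
      refine ((h y (hsub hy')).mono hsub).mono_of_mem_nhdsWithin ?_
      exact mem_nhdsWithin_of_mem_nhds (Icc_mem_nhds hy.1 hy.2)

/-- Third order Taylor formula for the central difference. -/
theorem exists_central_difference {f₀ f₁ f₂ f₃ : ℝ → ℝ} (h₀ : ∀ x, HasDerivAt f₀ (f₁ x) x)
    (h₁ : ∀ x, HasDerivAt f₁ (f₂ x) x) (h₂ : ∀ x, HasDerivAt f₂ (f₃ x) x) (y : ℝ) {h : ℝ}
    (hh : 0 < h) :
    ∃ τ ∈ Set.Ioo 0 h,
      f₀ (y + h) - f₀ (y - h) = 2 * h * f₁ y + h ^ 3 / 6 * (f₃ (y + τ) + f₃ (y - τ)) := by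
  have plus : ∀ {f g : ℝ → ℝ}, (∀ x, HasDerivAt f (g x) x) → ∀ t,
      HasDerivAt (fun t => f (y + t)) (g (y + t)) t := fun hf t => by
    simpa using (hf (y + t)).comp_const_add y t
  have minus : ∀ {f g : ℝ → ℝ}, (∀ x, HasDerivAt f (g x) x) → ∀ t,
      HasDerivAt (fun t => f (y - t)) (-g (y - t)) t := fun hf t => by
    simpa using (hf (y - t)).comp_const_sub y t
  have d₀ : ∀ t, HasDerivAt (fun t => f₀ (y + t) - f₀ (y - t) - 2 * t * f₁ y)
      (f₁ (y + t) + f₁ (y - t) - 2 * f₁ y) t := fun t => by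
    have := ((plus h₀ t).sub (minus h₀ t)).sub (((hasDerivAt_id t).const_mul 2).mul_const (f₁ y))
    refine this.congr_deriv ?_
    ring
  have d₁ : ∀ t, HasDerivAt (fun t => f₁ (y + t) + f₁ (y - t) - 2 * f₁ y)
      (f₂ (y + t) - f₂ (y - t)) t := fun t => by
    refine (((plus h₁ t).add (minus h₁ t)).sub_const (2 * f₁ y)).congr_deriv ?_
    ring
  have d₂ : ∀ t, HasDerivAt (fun t => f₂ (y + t) - f₂ (y - t)) (f₃ (y + t) + f₃ (y - t)) t :=
    fun t => by
      refine ((plus h₂ t).sub (minus h₂ t)).congr_deriv ?_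
      ring
  have p₃ : ∀ t : ℝ, HasDerivAt (fun t => t ^ 3) (3 * t ^ 2) t := fun t => by
    simpa using hasDerivAt_pow 3 t
  have p₂ : ∀ t : ℝ, HasDerivAt (fun t => t ^ 2) (2 * t) t := fun t => by
    simpa using hasDerivAt_pow 2 t
  have cont : ∀ {f g : ℝ → ℝ}, (∀ t, HasDerivAt f (g t) t) → ∀ s, ContinuousOn f s :=
    fun hf s t _ => (hf t).continuousAt.continuousWithinAt
  -- Cauchy's mean value theorem three times, against `t³`, `t²` and `t`: the central difference
  -- minus its linear term vanishes at `0` with its first two derivatives.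
  obtain ⟨τ₁, m₁, e₁⟩ := exists_ratio_hasDerivAt_eq_ratio_slope _ _ hh (cont d₀ _)
    (fun t _ => d₀ t) _ _ (cont p₃ _) (fun t _ => p₃ t)
  obtain ⟨τ₂, m₂, e₂⟩ := exists_ratio_hasDerivAt_eq_ratio_slope _ _ m₁.1 (cont d₁ _)
    (fun t _ => d₁ t) _ _ (cont p₂ _) (fun t _ => p₂ t)
  obtain ⟨τ₃, m₃, e₃⟩ := exists_ratio_hasDerivAt_eq_ratio_slope _ _ m₂.1 (cont d₂ _)
    (fun t _ => d₂ t) _ _ (cont hasDerivAt_id _) (fun t _ => hasDerivAt_id t)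
  refine ⟨τ₃, ⟨m₃.1, m₃.2.trans (m₂.2.trans m₁.2)⟩, ?_⟩
  simp only [add_zero, sub_zero, sub_self, id] at e₁ e₂ e₃
  have n₁ : τ₁ ≠ 0 := m₁.1.ne'
  have n₂ : τ₂ ≠ 0 := m₂.1.ne'
  have e₂' : 2 * (f₁ (y + τ₁) + f₁ (y - τ₁) - 2 * f₁ y) =
      τ₁ ^ 2 * (f₃ (y + τ₃) + f₃ (y - τ₃)) := by
    apply mul_right_cancel₀ n₂
    linear_combination -e₂ - τ₁ ^ 2 * e₃
  have : 6 * (f₀ (y + h) - f₀ (y - h) - 2 * h * f₁ y) =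
      h ^ 3 * (f₃ (y + τ₃) + f₃ (y - τ₃)) := by
    apply mul_right_cancel₀ (pow_ne_zero 2 n₁)
    linear_combination -2 * e₁ + h ^ 3 * e₂'
  linarith

/-- Second order Taylor formula with mean value remainder, on either side of the base point. -/
theorem exists_second_order {f₀ f₁ f₂ : ℝ → ℝ} (h₀ : ∀ x, HasDerivAt f₀ (f₁ x) x)
    (h₁ : ∀ x, HasDerivAt f₁ (f₂ x) x) (t x : ℝ) :
    ∃ ξ ∈ Set.uIcc t (t + x), f₀ (t + x) = f₀ t + x * f₁ t + x ^ 2 / 2 * f₂ ξ := by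
  rcases eq_or_ne x 0 with rfl | hx
  · exact ⟨t, by simp, by simp⟩
  -- The parameter `τ ∈ [0, 1]` along the segment treats both signs of `x` at once.
  have d₀ : ∀ τ, HasDerivAt (fun τ => f₀ (t + τ * x) - f₀ t - τ * x * f₁ t)
      (x * (f₁ (t + τ * x) - f₁ t)) τ := fun τ => by
    have hl : HasDerivAt (fun τ => t + τ * x) x τ := by
      simpa using ((hasDerivAt_id τ).mul_const x).const_add t
    have := (((h₀ (t + τ * x)).comp τ hl).sub_const (f₀ t)).sub
      (((hasDerivAt_id τ).mul_const x).mul_const (f₁ t))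
    refine this.congr_deriv ?_
    ring
  have d₁ : ∀ τ, HasDerivAt (fun τ => x * (f₁ (t + τ * x) - f₁ t))
      (x ^ 2 * f₂ (t + τ * x)) τ := fun τ => by
    have hl : HasDerivAt (fun τ => t + τ * x) x τ := by
      simpa using ((hasDerivAt_id τ).mul_const x).const_add t
    have := (((h₁ (t + τ * x)).comp τ hl).sub_const (f₁ t)).const_mul x
    refine this.congr_deriv ?_
    ring
  have p₂ : ∀ t : ℝ, HasDerivAt (fun t => t ^ 2) (2 * t) t := fun t => by
    simpa using hasDerivAt_pow 2 t
  have cont : ∀ {f g : ℝ → ℝ}, (∀ t, HasDerivAt f (g t) t) → ∀ s, ContinuousOn f s :=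
    fun hf s t _ => (hf t).continuousAt.continuousWithinAt
  obtain ⟨τ₁, m₁, e₁⟩ := exists_ratio_hasDerivAt_eq_ratio_slope _ _ zero_lt_one (cont d₀ _)
    (fun t _ => d₀ t) _ _ (cont p₂ _) (fun t _ => p₂ t)
  obtain ⟨τ₂, m₂, e₂⟩ := exists_ratio_hasDerivAt_eq_ratio_slope _ _ m₁.1 (cont d₁ _)
    (fun t _ => d₁ t) _ _ (cont hasDerivAt_id _) (fun t _ => hasDerivAt_id t)
  have m : τ₂ ∈ Set.Icc (0 : ℝ) 1 := ⟨m₂.1.le, (m₂.2.trans m₁.2).le⟩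
  refine ⟨t + τ₂ * x, ?_, ?_⟩
  · rcases le_total 0 x with h | h
    · rw [Set.uIcc_of_le (by linarith)]
      constructor <;> nlinarith [m.1, m.2]
    · rw [Set.uIcc_of_ge (by linarith)]
      constructor <;> nlinarith [m.1, m.2]
  · simp only [zero_mul, add_zero, sub_self, id, one_mul, mul_zero, sub_zero] at e₁ e₂
    have n₁ : τ₁ ≠ 0 := m₁.1.ne'
    have : 2 * (f₀ (t + x) - f₀ t - x * f₁ t) = x ^ 2 * f₂ (t + τ₂ * x) := by
      apply mul_right_cancel₀ n₁
      linear_combination -e₁ - e₂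
    linarith

/-- Bound for the second order remainder at scale `ε`. -/
theorem abs_scaled_sub_le {f₀ f₁ f₂ : ℝ → ℝ} (h₀ : ∀ x, HasDerivAt f₀ (f₁ x) x)
    (h₁ : ∀ x, HasDerivAt f₁ (f₂ x) x) {t θ θ' ε M : ℝ} (hε : 0 < ε)
    (hM : ∀ x ∈ Set.uIcc t (t + θ * ε), |f₂ x| ≤ M) :
    |((f₀ (t + θ * ε) - f₀ t) / ε - θ' * f₁ t) / ε| ≤
      |(θ - θ') / ε| * |f₁ t| + θ ^ 2 / 2 * M := by
  -- In the applications `θ` is an actual displacement in units of `ε` and `θ'` its limit; their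
  -- difference is itself of order `ε`.
  obtain ⟨ξ, hξ, e⟩ := exists_second_order h₀ h₁ t (θ * ε)
  have : ((f₀ (t + θ * ε) - f₀ t) / ε - θ' * f₁ t) / ε =
      (θ - θ') / ε * f₁ t + θ ^ 2 / 2 * f₂ ξ := by
    rw [e]; field_simp; ring
  rw [this]
  refine (abs_add_le _ _).trans ?_
  rw [abs_mul, abs_mul, abs_of_nonneg (by positivity : 0 ≤ θ ^ 2 / 2)]
  gcongr
  exact hM ξ hξ

/-- Second order expansion at scale `ε`. -/
theorem tendsto_scaled_sub {f₀ f₁ f₂ : ℝ → ℝ} (h₀ : ∀ x, HasDerivAt f₀ (f₁ x) x)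
    (h₁ : ∀ x, HasDerivAt f₁ (f₂ x) x) (h₂ : Continuous f₂) {t θ κ : ℝ} {ε θs : ℕ → ℝ}
    (hε : ∀ m, 0 < ε m) (hε0 : Tendsto ε atTop (𝓝 0)) (hθ : Tendsto θs atTop (𝓝 θ))
    (hκ : Tendsto (fun m => (θs m - θ) / ε m) atTop (𝓝 κ)) :
    Tendsto (fun m => ((f₀ (t + θs m * ε m) - f₀ t) / ε m - θ * f₁ t) / ε m) atTop
      (𝓝 (κ * f₁ t + θ ^ 2 / 2 * f₂ t)) := by
  choose ξ hξ e using fun m => exists_second_order h₀ h₁ t (θs m * ε m)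
  have hlim : Tendsto (fun m => t + θs m * ε m) atTop (𝓝 t) := by
    simpa using (hθ.mul hε0).const_add t
  have hξt : Tendsto ξ atTop (𝓝 t) := by
    rw [tendsto_iff_dist_tendsto_zero] at hlim ⊢
    refine squeeze_zero (fun _ => dist_nonneg) (fun m => ?_) hlim
    have := Set.abs_sub_left_of_mem_uIcc (hξ m)
    rwa [Real.dist_eq, Real.dist_eq]
  have key : ∀ m, ((f₀ (t + θs m * ε m) - f₀ t) / ε m - θ * f₁ t) / ε m =
      (θs m - θ) / ε m * f₁ t + θs m ^ 2 / 2 * f₂ (ξ m) := fun m => by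
    have := (hε m).ne'
    rw [e]; field_simp; ring
  simp_rw [key]
  exact (hκ.mul_const _).add (((hθ.pow 2).div_const 2).mul ((h₂.tendsto t).comp hξt))

/-- Chain rule for difference quotients along a sequence. -/
theorem tendsto_div_of_hasDerivAt {f : ℝ → ℝ} {f' x l : ℝ} (hf : HasDerivAt f f' x)
    {y ε : ℕ → ℝ} (hε : ∀ m, 0 < ε m) (hε0 : Tendsto ε atTop (𝓝 0))
    (hl : Tendsto (fun m => (y m - x) / ε m) atTop (𝓝 l)) :
    Tendsto (fun m => (f (y m) - f x) / ε m) atTop (𝓝 (f' * l)) := by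
  have hy : Tendsto y atTop (𝓝 x) := by
    have : Tendsto (fun m => (y m - x) / ε m * ε m + x) atTop (𝓝 (l * 0 + x)) :=
      (hl.mul hε0).add_const x
    simpa [div_mul_cancel₀ _ (hε _).ne'] using this
  have h1 := hf.tendsto_slope
  -- The difference quotient completed by `f'` at `x` is continuous there, so terms with `y m = x`
  -- need no separate treatment.
  obtain ⟨g, hg, hgx⟩ : ∃ g : ℝ → ℝ, ContinuousAt g x ∧ g x = f' ∧
      ∀ z, f z - f x = g z * (z - x) := by
    refine ⟨Function.update (slope f x) x f', ?_, by simp, fun z => ?_⟩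
    · rw [continuousAt_update_same]; exact h1
    · rcases eq_or_ne z x with rfl | hz
      · simp
      · rw [Function.update_of_ne hz, slope_def_field, div_mul_cancel₀ _ (sub_ne_zero.2 hz)]
  have := (hg.tendsto.comp hy).mul hl
  rw [hgx.1] at this
  refine this.congr fun m => ?_
  rw [hgx.2 (y m)]
  simp [mul_div_assoc]

end SharpInterfaces

namespace SharpInterfaces

/-! ### The potential -/

variable {W : ℝ → ℝ} {α : ℝ}

theorem hasDerivAt_iteratedDeriv_potential (hW : ContDiffOn ℝ ∞ W {0}ᶜ) (i : ℕ) {x : ℝ}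
    (hx : x ≠ 0) : HasDerivAt (iteratedDeriv i W) (iteratedDeriv (i + 1) W x) x := by
  have hopen : IsOpen ({0}ᶜ : Set ℝ) := isOpen_compl_singleton
  have hmem := hopen.mem_nhds hx
  rw [iteratedDeriv_succ]
  refine DifferentiableAt.hasDerivAt ?_
  have h := (hW.differentiableOn_iteratedDerivWithin (m := i)
    (by exact_mod_cast WithTop.coe_lt_top _) hopen.uniqueDiffOn).differentiableAt hmem
  refine h.congr_of_eventuallyEq ?_
  filter_upwards [hmem] with y hy
  exact (iteratedDerivWithin_of_isOpen hopen hy).symm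

/-- Decay of the derivatives of the potential away from the origin, at any scale. -/
theorem Decays.exists_bound (hd : Decays W α) (hW : ContDiffOn ℝ ∞ W {0}ᶜ) (hα : 0 ≤ α) {δ : ℝ}
    (hδ : 0 < δ) (i : ℕ) : ∃ K > 0, ∀ j : ℝ, 0 < j → ∀ x, δ ≤ x → δ * j ≤ x →
      |iteratedDeriv i W x| ≤ K * j ^ (-α - i) := by
  obtain ⟨R, -, hR⟩ := hd
  obtain ⟨C, hC, hCx⟩ := hR i
  -- Decay is assumed only beyond `R`; between `δ` and `R` compactness gives the same bound with
  -- another constant.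
  have hcont : ContinuousOn (fun x => iteratedDeriv i W x * x ^ (α + i)) (Set.Icc δ R) := by
    intro x hx
    have hx0 : x ≠ 0 := (hδ.trans_le hx.1).ne'
    exact ((hasDerivAt_iteratedDeriv_potential hW i hx0).continuousAt.mul
      (Real.continuousAt_rpow_const _ _ (Or.inl hx0))).continuousWithinAt
  obtain ⟨B, hB⟩ := isCompact_Icc.exists_bound_of_continuousOn hcont
  refine ⟨max C B * δ ^ (-α - i), by positivity, fun j hj x hδx hx => ?_⟩
  have hx0 : 0 < x := by nlinarith
  have h1 : |iteratedDeriv i W x| ≤ max C B * x ^ (-α - i) := by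
    rcases le_or_gt R x with h | h
    · have := hCx x (h.trans (le_abs_self x))
      rw [abs_of_pos hx0] at this
      exact this.trans (by gcongr; exact le_max_left _ _)
    · have := hB x ⟨hδx, h.le⟩
      rw [Real.norm_eq_abs, abs_mul, abs_of_pos (Real.rpow_pos_of_pos hx0 _)] at this
      have e : (-α - i : ℝ) = -(α + i) := by ring
      rw [e, Real.rpow_neg hx0.le, ← div_eq_mul_inv, le_div_iff₀ (Real.rpow_pos_of_pos hx0 _)]
      exact this.trans (le_max_right _ _)
  refine h1.trans ?_
  rw [mul_assoc, ← Real.mul_rpow hδ.le hj.le]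
  gcongr ?_ * ?_
  apply Real.rpow_le_rpow_of_nonpos (by positivity) hx
  have : (0 : ℝ) ≤ i := Nat.cast_nonneg i
  linarith

/-! ### Lattice sums -/

/-- The sum of the `i`-th derivative of `W` along a family of linear forms, with coefficients. -/
noncomputable def latticeSum {ι E G : Type} [NormedAddCommGroup E] [NormedSpace ℝ E] [NormedAddCommGroup G]
    [NormedSpace ℝ G] (W : ℝ → ℝ) (i : ℕ) (L : ι → E →L[ℝ] ℝ) (c : ι → G) (v : E) : G :=
  ∑' k, iteratedDeriv i W (L k v) • c k

section

variable {ι E : Type} [NormedAddCommGroup E] [NormedSpace ℝ E] {L : ι → E →L[ℝ] ℝ}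
  {mag : ι → ℝ} {B : ℝ} {U : Set E}

/-- Local uniform lower bound of a family of linear forms by its magnitude. -/
def LocallyBelow (L : ι → E →L[ℝ] ℝ) (mag : ι → ℝ) (U : Set E) : Prop :=
  ∀ x ∈ U, ∃ r > 0, ∃ δ > 0, ∀ y ∈ Metric.ball x r, ∀ k, δ * mag k ≤ L k y

theorem summable_latticeSum (hα : 0 ≤ α) (hW : ContDiffOn ℝ ∞ W {0}ᶜ) (hd : Decays W α)
    (hm : ∀ k, 1 ≤ mag k) (hbelow : LocallyBelow L mag U)
    {G : Type} [NormedAddCommGroup G] [NormedSpace ℝ G] [CompleteSpace G]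
    (i : ℕ) (c : ι → G) (hc : Summable fun k => ‖c k‖ * mag k ^ (-α - i)) {x : E} (hx : x ∈ U) :
    Summable fun k => iteratedDeriv i W (L k x) • c k := by
  obtain ⟨r, hr, δ, hδ, hb⟩ := hbelow x hx
  obtain ⟨K, hK, hKb⟩ := hd.exists_bound hW hα hδ i
  refine Summable.of_norm_bounded (hc.mul_left K) fun k => ?_
  have h := hb x (Metric.mem_ball_self hr) k
  have hmk := hm k
  have := hKb (mag k) (by linarith) (L k x) (by nlinarith) h
  rw [norm_smul, Real.norm_eq_abs]
  calc _ ≤ K * mag k ^ (-α - i) * ‖c k‖ := by gcongr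
    _ = _ := by ring

/-- Differentiating a term multiplies its coefficient by `L k`, of norm at most `B * mag k`, while
the next derivative of `W` decays by one more power of `mag k`. The two cancel, so one summability
condition on `c` serves for every derivative. -/
theorem hasFDerivAt_latticeSum (hα : 0 ≤ α) (hW : ContDiffOn ℝ ∞ W {0}ᶜ) (hd : Decays W α)
    (hm : ∀ k, 1 ≤ mag k) (hL : ∀ k, ‖L k‖ ≤ B * mag k) (hbelow : LocallyBelow L mag U)
    {G : Type} [NormedAddCommGroup G] [NormedSpace ℝ G] [CompleteSpace G]
    (i : ℕ) (c : ι → G) (hc : Summable fun k => ‖c k‖ * mag k ^ (-α - i)) {x : E} (hx : x ∈ U) :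
    HasFDerivAt (latticeSum W i L c) (latticeSum W (i + 1) L (fun k => (L k).smulRight (c k)) x)
      x := by
  obtain ⟨r, hr, δ, hδ, hb⟩ := hbelow x hx
  obtain ⟨K, hK, hKb⟩ := hd.exists_bound hW hα hδ (i + 1)
  have hpos : ∀ y ∈ Metric.ball x r, ∀ k, δ ≤ L k y := fun y hy k => by
    nlinarith [hb y hy k, hm k]
  have hder : ∀ k, ∀ y ∈ Metric.ball x r, HasFDerivAt (fun y => iteratedDeriv i W (L k y) • c k)
      (iteratedDeriv (i + 1) W (L k y) • (L k).smulRight (c k)) y := fun k y hy => by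
    have h1 := (hasDerivAt_iteratedDeriv_potential hW i
      (hδ.trans_le (hpos y hy k)).ne').hasFDerivAt.comp y (L k).hasFDerivAt
    have h2 := h1.smul_const (c k)
    refine h2.congr_fderiv (ContinuousLinearMap.ext fun z => ?_)
    simp only [ContinuousLinearMap.smulRight_apply, ContinuousLinearMap.comp_apply,
      smul_apply, ContinuousLinearMap.toSpanSingleton_apply, smul_smul,
      smul_eq_mul, mul_comm]
  have hbound : ∀ k, ∀ y ∈ Metric.ball x r,
      ‖iteratedDeriv (i + 1) W (L k y) • (L k).smulRight (c k)‖ ≤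
        K * B * (‖c k‖ * mag k ^ (-α - i)) := fun k y hy => by
    have hmk := hm k
    have := hKb (mag k) (by linarith) (L k y) (hpos y hy k) (hb y hy k)
    have hn : ‖(L k).smulRight (c k)‖ = ‖L k‖ * ‖c k‖ :=
      ContinuousLinearMap.norm_smulRight_apply _ _
    rw [norm_smul, Real.norm_eq_abs, hn]
    have hmk0 : 0 < mag k := by linarith
    have e : mag k ^ (-α - ((i + 1 : ℕ) : ℝ)) * mag k = mag k ^ (-α - i) := by
      rw [← Real.rpow_add_one hmk0.ne']; congr 1; push_cast; ring
    calc _ ≤ (K * mag k ^ (-α - ((i + 1 : ℕ) : ℝ))) * ((B * mag k) * ‖c k‖) := by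
          gcongr; exact hL k
      _ = K * B * (‖c k‖ * (mag k ^ (-α - ((i + 1 : ℕ) : ℝ)) * mag k)) := by ring
      _ = _ := by rw [e]
  exact hasFDerivAt_tsum_of_isPreconnected (hc.mul_left (K * B)) Metric.isOpen_ball
    (convex_ball x r).isPreconnected hder hbound (Metric.mem_ball_self hr)
    (summable_latticeSum hα hW hd hm hbelow i c hc hx) (Metric.mem_ball_self hr)

/-- Lattice sums depend smoothly on the parameter. -/
theorem contDiffOn_latticeSum (hα : 0 ≤ α) (hW : ContDiffOn ℝ ∞ W {0}ᶜ) (hd : Decays W α)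
    (hU : IsOpen U) (hm : ∀ k, 1 ≤ mag k) (hL : ∀ k, ‖L k‖ ≤ B * mag k)
    (hbelow : LocallyBelow L mag U)
    {G : Type} [NormedAddCommGroup G] [NormedSpace ℝ G] [CompleteSpace G]
    (i : ℕ) (c : ι → G) (hc : Summable fun k => ‖c k‖ * mag k ^ (-α - i)) :
    ContDiffOn ℝ ∞ (latticeSum W i L c) U := by
  rw [contDiffOn_infty]
  intro n
  -- Each derivative turns coefficients in `G` into coefficients in `E →L[ℝ] G`, so the coefficient
  -- space must vary in the induction.
  induction n generalizing i G with
  | zero =>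
    simp only [Nat.cast_zero, contDiffOn_zero]
    exact fun x hx => (hasFDerivAt_latticeSum hα hW hd hm hL hbelow i c
      hc hx).continuousAt.continuousWithinAt
  | succ n ih =>
    push_cast
    rw [contDiffOn_succ_iff_fderiv_of_isOpen hU]
    have hder := fun x (hx : x ∈ U) => hasFDerivAt_latticeSum hα hW hd hm hL hbelow i c hc hx
    refine ⟨fun x hx => (hder x hx).differentiableAt.differentiableWithinAt, fun h => ?_, ?_⟩
    · exact absurd h (by exact_mod_cast WithTop.coe_ne_top)
    · refine (ih (i + 1) (fun k => (L k).smulRight (c k)) ?_).congr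
        fun x hx => (hder x hx).fderiv
      refine Summable.of_nonneg_of_le (fun k => ?_) (fun k => ?_) (hc.mul_left B)
      · have := hm k
        positivity
      · have hmk0 : 0 < mag k := by linarith [hm k]
        have e : mag k ^ (-α - ((i + 1 : ℕ) : ℝ)) * mag k = mag k ^ (-α - i) := by
          rw [← Real.rpow_add_one hmk0.ne']; congr 1; push_cast; ring
        rw [ContinuousLinearMap.norm_smulRight_apply]
        calc _ ≤ (B * mag k * ‖c k‖) * mag k ^ (-α - ((i + 1 : ℕ) : ℝ)) := by
              gcongr; exact hL k
          _ = B * (‖c k‖ * (mag k ^ (-α - ((i + 1 : ℕ) : ℝ)) * mag k)) := by ring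
          _ = _ := by rw [e]

end

theorem summable_rpow_of_lt {s : ℝ} (hs : s < -1) : Summable fun d : ℕ => ((d : ℝ) + 1) ^ s := by
  have := (summable_nat_add_iff 1).2 (Real.summable_nat_rpow.2 hs)
  simpa using this

/-- From `(1 + p) (1 + q) ≤ (1 + p + q)²` the double series is dominated by the product of two
simple series with exponent `s / 2 < -1`. -/
theorem summable_pair_rpow {s : ℝ} (hs : s < -2) :
    Summable fun p : ℕ × ℕ => (1 + (p.1 : ℝ) + p.2) ^ s := by
  have h := summable_rpow_of_lt (s := s / 2) (by linarith)
  refine Summable.of_nonneg_of_le (fun p => by positivity) (fun p => ?_)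
    (h.mul_of_nonneg h (fun d => by positivity) (fun d => by positivity))
  rw [← Real.mul_rpow (by positivity) (by positivity)]
  have e : (1 + (p.1 : ℝ) + p.2) ^ s = ((1 + (p.1 : ℝ) + p.2) ^ (2 : ℝ)) ^ (s / 2) := by
    rw [← Real.rpow_mul (by positivity)]; congr 1; ring
  rw [e]
  apply Real.rpow_le_rpow_of_nonpos (by positivity) _ (by linarith)
  have h1 : (0 : ℝ) ≤ p.1 := Nat.cast_nonneg _
  have h2 : (0 : ℝ) ≤ p.2 := Nat.cast_nonneg _
  norm_num
  nlinarith

end SharpInterfaces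

namespace SharpInterfaces

/-! ### The energy of one smooth piece -/

theorem exists_mean_value {f f' : ℝ → ℝ} (hf : ∀ x, HasDerivAt f (f' x) x) (a b : ℝ) :
    ∃ ξ ∈ Set.uIcc a b, f b - f a = f' ξ * (b - a) := by
  have cont : ∀ s, ContinuousOn f s := fun s t _ => (hf t).continuousAt.continuousWithinAt
  rcases lt_trichotomy a b with h | rfl | h
  · obtain ⟨ξ, hξ, e⟩ := exists_hasDerivAt_eq_slope f f' h (cont _) fun x _ => hf x
    refine ⟨ξ, by rw [Set.uIcc_of_le h.le]; exact Set.Ioo_subset_Icc_self hξ, ?_⟩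
    rw [e, div_mul_cancel₀ _ (sub_ne_zero.2 h.ne')]
  · exact ⟨a, by simp, by simp⟩
  · obtain ⟨ξ, hξ, e⟩ := exists_hasDerivAt_eq_slope f f' h (cont _) fun x _ => hf x
    refine ⟨ξ, by rw [Set.uIcc_of_ge h.le]; exact Set.Ioo_subset_Icc_self hξ, ?_⟩
    rw [e]
    have := (sub_pos.2 h).ne'
    field_simp
    ring

/-- A potential and a displacement, both extended to the line, with the bounds that hold on the
piece `[r, s]`. -/
structure PieceModel (W₀ W₁ W₂ u₀ u₁ u₂ u₃ : ℝ → ℝ) (r s δ K M α : ℝ) : Prop where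
  hW₀ : ∀ x, HasDerivAt W₀ (W₁ x) x
  hW₁ : ∀ x, HasDerivAt W₁ (W₂ x) x
  hW₂ : Continuous W₂
  hu₀ : ∀ x, HasDerivAt u₀ (u₁ x) x
  hu₁ : ∀ x, HasDerivAt u₁ (u₂ x) x
  hu₂ : ∀ x, HasDerivAt u₂ (u₃ x) x
  hu₃ : Continuous u₃
  lt : r < s
  δ_pos : 0 < δ
  K_pos : 0 < K
  M_pos : 0 < M
  lower : ∀ x ∈ Set.Icc r s, δ ≤ u₁ x
  upper₂ : ∀ x ∈ Set.Icc r s, |u₂ x| ≤ M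
  upper₃ : ∀ x ∈ Set.Icc r s, |u₃ x| ≤ M
  upper₁ : ∀ x ∈ Set.Icc r s, |u₁ x| ≤ M
  decay₀ : ∀ j : ℝ, 1 ≤ j → ∀ x, δ * j ≤ x → |W₀ x| ≤ K * j ^ (-α)
  decay₁ : ∀ j : ℝ, 1 ≤ j → ∀ x, δ * j ≤ x → j * |W₁ x| ≤ K * j ^ (-α)
  decay₂ : ∀ j : ℝ, 1 ≤ j → ∀ x, δ * j ≤ x → j ^ 2 * |W₂ x| ≤ K * j ^ (-α)

namespace PieceModel

variable {W₀ W₁ W₂ u₀ u₁ u₂ u₃ : ℝ → ℝ} {r s δ K M α : ℝ}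

theorem increment_ge (S : PieceModel W₀ W₁ W₂ u₀ u₁ u₂ u₃ r s δ K M α) {x y : ℝ} (hx : r ≤ x)
    (hxy : x ≤ y) (hy : y ≤ s) : δ * (y - x) ≤ u₀ y - u₀ x := by
  obtain ⟨ξ, hξ, e⟩ := exists_mean_value S.hu₀ x y
  rw [Set.uIcc_of_le hxy] at hξ
  rw [e]
  exact mul_le_mul_of_nonneg_right (S.lower ξ ⟨hx.trans hξ.1, hξ.2.trans hy⟩) (sub_nonneg.2 hxy)

theorem continuous_u₁ (S : PieceModel W₀ W₁ W₂ u₀ u₁ u₂ u₃ r s δ K M α) : Continuous u₁ :=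
  continuous_iff_continuousAt.2 fun x => (S.hu₁ x).continuousAt

theorem continuous_u₂ (S : PieceModel W₀ W₁ W₂ u₀ u₁ u₂ u₃ r s δ K M α) : Continuous u₂ :=
  continuous_iff_continuousAt.2 fun x => (S.hu₂ x).continuousAt

theorem continuous_W₀ (S : PieceModel W₀ W₁ W₂ u₀ u₁ u₂ u₃ r s δ K M α) : Continuous W₀ :=
  continuous_iff_continuousAt.2 fun x => (S.hW₀ x).continuousAt

theorem continuous_W₁ (S : PieceModel W₀ W₁ W₂ u₀ u₁ u₂ u₃ r s δ K M α) : Continuous W₁ :=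
  continuous_iff_continuousAt.2 fun x => (S.hW₁ x).continuousAt

theorem hasDerivAt_energyDensity (S : PieceModel W₀ W₁ W₂ u₀ u₁ u₂ u₃ r s δ K M α) (j x : ℝ) :
    HasDerivAt (fun x => W₀ (j * u₁ x)) (W₁ (j * u₁ x) * j * u₂ x) x := by
  refine ((S.hW₀ (j * u₁ x)).comp x ((S.hu₁ x).const_mul j)).congr_deriv ?_
  ring

theorem hasDerivAt_energyDensity_deriv (S : PieceModel W₀ W₁ W₂ u₀ u₁ u₂ u₃ r s δ K M α)
    (j x : ℝ) :
    HasDerivAt (fun x => W₁ (j * u₁ x) * j * u₂ x)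
      (j ^ 2 * W₂ (j * u₁ x) * u₂ x ^ 2 + j * W₁ (j * u₁ x) * u₃ x) x := by
  have h := ((S.hW₁ (j * u₁ x)).comp x ((S.hu₁ x).const_mul j))
  refine ((h.mul_const j).mul (S.hu₂ x)).congr_deriv ?_
  simp only [Function.comp]
  ring

/-- Both mean value forms for one bond of length `j` around its centre. -/
theorem exists_cell_error (S : PieceModel W₀ W₁ W₂ u₀ u₁ u₂ u₃ r s δ K M α) {j ε y : ℝ}
    (hj : 1 ≤ j) (hε : 0 < ε) (hr : r ≤ y - j * ε / 2) (hs : y + j * ε / 2 ≤ s) :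
    ∃ η ξ ξ' ζ ζ', ξ ∈ Set.Icc (y - j * ε / 2) (y + j * ε / 2) ∧
      ξ' ∈ Set.Icc (y - j * ε / 2) (y + j * ε / 2) ∧
      ζ ∈ Set.Icc (y - j * ε / 2) (y + j * ε / 2) ∧
      ζ' ∈ Set.Icc (y - j * ε / 2) (y + j * ε / 2) ∧
      δ * j ≤ η ∧ |η - j * u₁ y| ≤ ε ^ 2 * j ^ 3 * M ∧
      W₀ ((u₀ (y + j * ε / 2) - u₀ (y - j * ε / 2)) / ε)
        - (∫ x in (y - ε / 2)..(y + ε / 2), W₀ (j * u₁ x)) / ε =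
      ε ^ 2 / 24 * ((j ^ 3 * (W₁ η * u₃ ξ)
          - (j ^ 2 * W₂ (j * u₁ ζ) * u₂ ζ ^ 2 + j * W₁ (j * u₁ ζ) * u₃ ζ)) / 2
        + (j ^ 3 * (W₁ η * u₃ ξ')
          - (j ^ 2 * W₂ (j * u₁ ζ') * u₂ ζ' ^ 2 + j * W₁ (j * u₁ ζ') * u₃ ζ')) / 2) := by
  have hjε : 0 < j * ε := by positivity
  -- The bond is a central difference of `u₀` with step `j ε / 2`, the cell integral one of a
  -- primitive of `W₀ (j u₁)` with step `ε / 2`. Both have leading term `W₀ (j u₁ y)`.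
  obtain ⟨τ, ⟨hτ0, hτ⟩, e₁⟩ := exists_central_difference S.hu₀ S.hu₁ S.hu₂ y
    (h := j * ε / 2) (by positivity)
  have hcont : Continuous fun x => W₀ (j * u₁ x) :=
    S.continuous_W₀.comp (S.continuous_u₁.const_mul j)
  have hprim : ∀ x, HasDerivAt (fun x => ∫ z in y..x, W₀ (j * u₁ z)) (W₀ (j * u₁ x)) x := fun x =>
    intervalIntegral.integral_hasDerivAt_right (hcont.intervalIntegrable _ _)
      (hcont.stronglyMeasurableAtFilter _ _) hcont.continuousAt
  obtain ⟨τ', ⟨hτ0', hτ'⟩, e₂⟩ := exists_central_difference hprim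
    (S.hasDerivAt_energyDensity j) (S.hasDerivAt_energyDensity_deriv j) y
    (h := ε / 2) (by positivity)
  rw [intervalIntegral.integral_interval_sub_left (hcont.intervalIntegrable _ _)
    (hcont.intervalIntegrable _ _)] at e₂
  have hτ'' : τ' < j * ε / 2 := hτ'.trans_le (by nlinarith)
  have hyr : r ≤ y := by linarith
  have hys : y ≤ s := by linarith
  have hD : (u₀ (y + j * ε / 2) - u₀ (y - j * ε / 2)) / ε =
      j * u₁ y + ε ^ 2 * j ^ 3 / 48 * (u₃ (y + τ) + u₃ (y - τ)) := by
    rw [e₁]; field_simp; ring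
  have hDge : δ * j ≤ (u₀ (y + j * ε / 2) - u₀ (y - j * ε / 2)) / ε := by
    rw [le_div_iff₀ hε]
    have := S.increment_ge hr (by linarith : y - j * ε / 2 ≤ y + j * ε / 2) hs
    calc _ = δ * (y + j * ε / 2 - (y - j * ε / 2)) := by ring
      _ ≤ _ := this
  have hyge : δ * j ≤ j * u₁ y := by
    rw [mul_comm δ]
    exact mul_le_mul_of_nonneg_left (S.lower y ⟨hyr, hys⟩) (by linarith)
  -- Both the linearized and the true strain are at least `δ j`, hence so is `η`, and the decay
  -- bounds apply to `W₁ η`.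
  obtain ⟨η, hη, e₃⟩ := exists_mean_value S.hW₀ (j * u₁ y)
    ((u₀ (y + j * ε / 2) - u₀ (y - j * ε / 2)) / ε)
  refine ⟨η, y + τ, y - τ, y + τ', y - τ', ⟨by linarith, by linarith⟩, ⟨by linarith, by linarith⟩,
    ⟨by linarith, by linarith⟩, ⟨by linarith, by linarith⟩, ?_, ?_, ?_⟩
  · exact (le_min hyge hDge).trans hη.1
  · refine (Set.abs_sub_left_of_mem_uIcc hη).trans ?_
    rw [hD, add_sub_cancel_left, abs_mul, abs_of_nonneg (by positivity)]
    have h₁ := S.upper₃ (y + τ) ⟨by linarith, by linarith⟩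
    have h₂ := S.upper₃ (y - τ) ⟨by linarith, by linarith⟩
    have := S.M_pos
    calc _ ≤ ε ^ 2 * j ^ 3 / 48 * (M + M) := by
          gcongr
          exact (abs_add_le _ _).trans (add_le_add h₁ h₂)
      _ ≤ _ := by nlinarith [show 0 ≤ ε ^ 2 * j ^ 3 * M by positivity]
  · rw [e₂]
    have h₁ : W₀ ((u₀ (y + j * ε / 2) - u₀ (y - j * ε / 2)) / ε) = W₀ (j * u₁ y) +
        W₁ η * (ε ^ 2 * j ^ 3 / 48 * (u₃ (y + τ) + u₃ (y - τ))) := by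
      rw [hD, add_sub_cancel_left] at e₃
      rw [hD]
      linarith
    rw [h₁]
    field_simp
    ring

/-- The limit density of the error per atom, for bonds of length `j`. -/
noncomputable def errorDensity (W₁ W₂ u₁ u₂ u₃ : ℝ → ℝ) (j x : ℝ) : ℝ :=
  (j ^ 3 * (W₁ (j * u₁ x) * u₃ x)
    - (j ^ 2 * W₂ (j * u₁ x) * u₂ x ^ 2 + j * W₁ (j * u₁ x) * u₃ x)) / 24

theorem rpow_pos {j : ℝ} (hj : 1 ≤ j) (a : ℝ) : 0 < j ^ a :=
  Real.rpow_pos_of_pos (by linarith) _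

theorem abs_energyDensity_deriv_le (S : PieceModel W₀ W₁ W₂ u₀ u₁ u₂ u₃ r s δ K M α) {j x : ℝ}
    (hj : 1 ≤ j) (hx : x ∈ Set.Icc r s) : |W₁ (j * u₁ x) * j * u₂ x| ≤ K * M * j ^ (-α) := by
  have hge : δ * j ≤ j * u₁ x := by
    rw [mul_comm δ]
    exact mul_le_mul_of_nonneg_left (S.lower x hx) (by linarith)
  have h := S.decay₁ j hj _ hge
  have hK := S.K_pos
  have := rpow_pos hj (-α)
  rw [abs_mul, abs_mul, abs_of_pos (by linarith : 0 < j), mul_comm |W₁ _|]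
  calc _ ≤ K * j ^ (-α) * M := by gcongr; exact S.upper₂ x hx
    _ = _ := by ring

theorem abs_second_deriv_le (S : PieceModel W₀ W₁ W₂ u₀ u₁ u₂ u₃ r s δ K M α) {j x : ℝ}
    (hj : 1 ≤ j) (hx : x ∈ Set.Icc r s) :
    |j ^ 2 * W₂ (j * u₁ x) * u₂ x ^ 2 + j * W₁ (j * u₁ x) * u₃ x| ≤
      (K * M ^ 2 + K * M) * j ^ (-α) := by
  have hge : δ * j ≤ j * u₁ x := by
    rw [mul_comm δ]
    exact mul_le_mul_of_nonneg_left (S.lower x hx) (by linarith)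
  have h₁ := S.decay₁ j hj _ hge
  have h₂ := S.decay₂ j hj _ hge
  have hK := S.K_pos
  have hM := S.M_pos
  have := rpow_pos hj (-α)
  have hj0 : 0 < j := by linarith
  have u2 : u₂ x ^ 2 ≤ M ^ 2 := by
    rw [← sq_abs]; exact pow_le_pow_left₀ (abs_nonneg _) (S.upper₂ x hx) 2
  refine (abs_add_le _ _).trans ?_
  rw [abs_mul, abs_mul, abs_mul, abs_mul, abs_of_pos hj0, abs_of_nonneg (sq_nonneg (u₂ x)),
    abs_of_nonneg (sq_nonneg j)]
  calc _ ≤ K * j ^ (-α) * M ^ 2 + K * j ^ (-α) * M := by gcongr; exact S.upper₃ x hx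
    _ = _ := by ring

/-- The worst term is `j³ W₁ η u₃`: one factor `j` is absorbed by the decay of `W₁`, and `j^(2 - α)`
is left. This exponent is why `α > 3` is needed. -/
theorem abs_cell_error_le (S : PieceModel W₀ W₁ W₂ u₀ u₁ u₂ u₃ r s δ K M α) {j ε y : ℝ}
    (hj : 1 ≤ j) (hε : 0 < ε) (hr : r ≤ y - j * ε / 2) (hs : y + j * ε / 2 ≤ s) :
    |W₀ ((u₀ (y + j * ε / 2) - u₀ (y - j * ε / 2)) / ε)
        - (∫ x in (y - ε / 2)..(y + ε / 2), W₀ (j * u₁ x)) / ε| ≤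
      ε ^ 2 * ((K * M ^ 2 + 2 * (K * M)) * (j ^ 2 * j ^ (-α))) := by
  obtain ⟨η, ξ, ξ', ζ, ζ', hξ, hξ', hζ, hζ', hη, -, e⟩ := S.exists_cell_error hj hε hr hs
  rw [e, abs_mul, abs_of_nonneg (by positivity : 0 ≤ ε ^ 2 / 24)]
  have hK := S.K_pos
  have hM := S.M_pos
  have hq := rpow_pos hj (-α)
  have hj0 : 0 < j := by linarith
  have hsub : ∀ z ∈ Set.Icc (y - j * ε / 2) (y + j * ε / 2), z ∈ Set.Icc r s := fun z hz =>
    ⟨hr.trans hz.1, hz.2.trans hs⟩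
  have hj2 : 1 ≤ j ^ 2 := one_le_pow₀ hj
  have main : ∀ x ∈ Set.Icc r s, ∀ z ∈ Set.Icc r s, |j ^ 3 * (W₁ η * u₃ x)
      - (j ^ 2 * W₂ (j * u₁ z) * u₂ z ^ 2 + j * W₁ (j * u₁ z) * u₃ z)| ≤
      (K * M ^ 2 + 2 * (K * M)) * (j ^ 2 * j ^ (-α)) := fun x hx z hz => by
    refine (abs_sub _ _).trans ?_
    have h₁ : |j ^ 3 * (W₁ η * u₃ x)| ≤ K * M * (j ^ 2 * j ^ (-α)) := by
      rw [abs_mul, abs_mul, abs_of_pos (by positivity : 0 < j ^ 3)]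
      calc _ = j ^ 2 * (j * |W₁ η|) * |u₃ x| := by ring
        _ ≤ j ^ 2 * (K * j ^ (-α)) * M := by
          gcongr ?_ * ?_
          · gcongr j ^ 2 * ?_
            exact S.decay₁ j hj η hη
          · exact S.upper₃ x hx
        _ = _ := by ring
    have h₂ := S.abs_second_deriv_le hj hz
    have h₃ : (K * M ^ 2 + K * M) * j ^ (-α) ≤ (K * M ^ 2 + K * M) * (j ^ 2 * j ^ (-α)) := by
      gcongr
      nlinarith
    linarith
  have m₁ := main ξ (hsub ξ hξ) ζ (hsub ζ hζ)
  have m₂ := main ξ' (hsub ξ' hξ') ζ' (hsub ζ' hζ')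
  have : ∀ A B C : ℝ, |A| ≤ C → |B| ≤ C → |A / 2 + B / 2| ≤ C := fun A B C hA hB => by
    rw [abs_le] at *
    constructor <;> linarith
  have h := this _ _ _ m₁ m₂
  have hC : 0 ≤ (K * M ^ 2 + 2 * (K * M)) * (j ^ 2 * j ^ (-α)) := by positivity
  calc _ ≤ ε ^ 2 / 24 * ((K * M ^ 2 + 2 * (K * M)) * (j ^ 2 * j ^ (-α))) := by gcongr
    _ ≤ _ := by nlinarith [mul_nonneg (sq_nonneg ε) hC]

theorem continuous_errorDensity (S : PieceModel W₀ W₁ W₂ u₀ u₁ u₂ u₃ r s δ K M α) (j : ℝ) :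
    Continuous (errorDensity W₁ W₂ u₁ u₂ u₃ j) := by
  have := S.continuous_u₁
  have := S.continuous_u₂
  have := S.continuous_W₁
  have := S.hW₂
  have := S.hu₃
  unfold errorDensity
  fun_prop

/-- For bonds of fixed length the error per atom is uniformly close to its limit density. -/
theorem exists_cell_error_close (S : PieceModel W₀ W₁ W₂ u₀ u₁ u₂ u₃ r s δ K M α) {j : ℝ}
    (hj : 1 ≤ j) {ρ : ℝ} (hρ : 0 < ρ) : ∃ ε₀ > 0, ∀ ε, 0 < ε → ε < ε₀ → ∀ y,
      r ≤ y - j * ε / 2 → y + j * ε / 2 ≤ s → ∀ z ∈ Set.Icc (y - ε / 2) (y + ε / 2),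
      |(W₀ ((u₀ (y + j * ε / 2) - u₀ (y - j * ε / 2)) / ε)
        - (∫ x in (y - ε / 2)..(y + ε / 2), W₀ (j * u₁ x)) / ε) / ε ^ 2
        - errorDensity W₁ W₂ u₁ u₂ u₃ j z| ≤ ρ := by
  have hM := S.M_pos
  have hj0 : 0 < j := by linarith
  -- The intermediate points of the mean value form become independent variables; uniform continuity
  -- of `H` on a compact box then compares them all with `z`.
  let H : ℝ × ℝ × ℝ → ℝ := fun p => (j ^ 3 * (W₁ p.1 * u₃ p.2.1)
    - (j ^ 2 * W₂ (j * u₁ p.2.2) * u₂ p.2.2 ^ 2 + j * W₁ (j * u₁ p.2.2) * u₃ p.2.2)) / 24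
  have hH : Continuous H := by
    have := S.continuous_u₁
    have := S.continuous_u₂
    have := S.continuous_W₁
    have := S.hW₂
    have := S.hu₃
    fun_prop
  let B := j * M + j ^ 3 * M
  have hcompact : IsCompact (Set.Icc (-B) B ×ˢ (Set.Icc r s ×ˢ Set.Icc r s)) :=
    isCompact_Icc.prod (isCompact_Icc.prod isCompact_Icc)
  obtain ⟨d, hd, hclose⟩ := Metric.uniformContinuousOn_iff.1
    (hcompact.uniformContinuousOn_of_continuous hH.continuousOn) ρ hρ
  -- The bound `1` gives `ε² ≤ ε`; the other keeps each coordinate of `H` within `d` of its value at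
  -- `z`.
  refine ⟨min 1 (d / (j ^ 3 * M + j * M + j)), lt_min one_pos (by positivity),
    fun ε hε hε₀ y hr hs z hz => ?_⟩
  have hε1 : ε < 1 := hε₀.trans_le (min_le_left _ _)
  have hεd : ε * (j ^ 3 * M + j * M + j) < d := by
    rw [← lt_div_iff₀ (by positivity)]
    exact hε₀.trans_le (min_le_right _ _)
  obtain ⟨η, ξ, ξ', ζ, ζ', hξ, hξ', hζ, hζ', hη, hηy, e⟩ := S.exists_cell_error hj hε hr hs
  have hsub : ∀ z ∈ Set.Icc (y - j * ε / 2) (y + j * ε / 2), z ∈ Set.Icc r s := fun z hz =>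
    ⟨hr.trans hz.1, hz.2.trans hs⟩
  have hεj : ε ≤ j * ε := by nlinarith
  have hz' : z ∈ Set.Icc (y - j * ε / 2) (y + j * ε / 2) :=
    ⟨by linarith [hz.1], by linarith [hz.2]⟩
  have hy' : y ∈ Set.Icc (y - j * ε / 2) (y + j * ε / 2) := ⟨by nlinarith, by nlinarith⟩
  have hε2 : ε ^ 2 * (j ^ 3 * M) ≤ ε * (j ^ 3 * M) := by
    gcongr
    nlinarith
  have hε3 : ε * (j ^ 3 * M) ≤ 1 * (j ^ 3 * M) := by gcongr
  have hu₁y := S.upper₁ y (hsub y hy')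
  have hu₁z := S.upper₁ z (hsub z hz')
  have hju : ∀ x, |u₁ x| ≤ M → |j * u₁ x| ≤ j * M := fun x hx => by
    rw [abs_mul, abs_of_pos hj0]; gcongr
  have hηB : η ∈ Set.Icc (-B) B := by
    refine abs_le.1 ?_
    have h1 : |η| ≤ |η - j * u₁ y| + |j * u₁ y| := by
      simpa using abs_add_le (η - j * u₁ y) (j * u₁ y)
    have := hju y hu₁y
    simp only [B]
    linarith
  have hzB : j * u₁ z ∈ Set.Icc (-B) B := by
    refine abs_le.1 ?_
    have := hju z hu₁z
    have : 0 < j ^ 3 * M := by positivity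
    simp only [B]
    linarith
  have hηz : |η - j * u₁ z| < d := by
    obtain ⟨χ, hχ, e'⟩ := exists_mean_value S.hu₁ z y
    have hχ' : χ ∈ Set.Icc r s :=
      Set.uIcc_subset_Icc (hsub z hz') (hsub y hy') hχ
    have hyz : |y - z| ≤ ε := by
      rw [abs_le]; constructor <;> linarith [hz.1, hz.2]
    have h2 : |j * u₁ y - j * u₁ z| ≤ j * (M * ε) := by
      rw [← mul_sub, abs_mul, abs_of_pos hj0, e', abs_mul]
      gcongr
      exact S.upper₂ χ hχ'
    have h1 : |η - j * u₁ z| ≤ |η - j * u₁ y| + |j * u₁ y - j * u₁ z| := by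
      simpa using abs_add_le (η - j * u₁ y) (j * u₁ y - j * u₁ z)
    have : 0 < ε * j := by positivity
    nlinarith
  have hclose' : ∀ x ∈ Set.Icc (y - j * ε / 2) (y + j * ε / 2), |x - z| < d := fun x hx => by
    have : |x - z| ≤ j * ε := by
      rw [abs_le]; constructor <;> linarith [hx.1, hx.2, hz'.1, hz'.2]
    have h2 : 0 < ε * (j ^ 3 * M + j * M) := by positivity
    nlinarith
  have main : ∀ x ∈ Set.Icc (y - j * ε / 2) (y + j * ε / 2),
      ∀ x' ∈ Set.Icc (y - j * ε / 2) (y + j * ε / 2),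
      |H (η, x, x') - H (j * u₁ z, z, z)| < ρ := fun x hx x' hx' => by
    rw [← Real.dist_eq]
    refine hclose _ ⟨hηB, hsub x hx, hsub x' hx'⟩ _ ⟨hzB, hsub z hz', hsub z hz'⟩ ?_
    simp only [Prod.dist_eq, Real.dist_eq, max_lt_iff]
    exact ⟨hηz, hclose' x hx, hclose' x' hx'⟩
  have m₁ := main ξ hξ ζ hζ
  have m₂ := main ξ' hξ' ζ' hζ'
  have e' : (W₀ ((u₀ (y + j * ε / 2) - u₀ (y - j * ε / 2)) / ε)
        - (∫ x in (y - ε / 2)..(y + ε / 2), W₀ (j * u₁ x)) / ε) / ε ^ 2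
      = H (η, ξ, ζ) / 2 + H (η, ξ', ζ') / 2 := by
    rw [e, div_eq_iff (by positivity)]
    simp only [H]
    ring
  have e'' : errorDensity W₁ W₂ u₁ u₂ u₃ j z = H (j * u₁ z, z, z) := by
    simp only [H, errorDensity]
  rw [e', e'']
  rw [abs_lt] at m₁ m₂
  rw [abs_le]
  constructor <;> linarith [m₁.1, m₁.2, m₂.1, m₂.2]

end PieceModel

end SharpInterfaces

/-! ### Bonds of a fixed length inside one piece. -/

namespace SharpInterfaces

/-- Midpoint cells: a sum of cell averages close to a continuous density is close to its
integral. -/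
theorem abs_sum_sub_integral_le {φ : ℝ → ℝ} (hφ : Continuous φ) {a ε ρ : ℝ} (hε : 0 < ε)
    {e : ℕ → ℝ} {n : ℕ}
    (h : ∀ k < n, ∀ z ∈ Set.Icc (a + k * ε) (a + (k + 1) * ε), |e k - φ z| ≤ ρ) :
    |∑ k ∈ Finset.range n, ε * e k - ∫ x in a..(a + n * ε), φ x| ≤ ρ * (n * ε) := by
  have hsum := intervalIntegral.sum_integral_adjacent_intervals (μ := MeasureTheory.volume)
    (f := φ) (a := fun k : ℕ => a + k * ε) (n := n) fun k _ => hφ.intervalIntegrable _ _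
  simp only [Nat.cast_zero, zero_mul, add_zero] at hsum
  rw [← hsum, ← Finset.sum_sub_distrib]
  refine (Finset.abs_sum_le_sum_abs _ _).trans ?_
  have : ∀ k ∈ Finset.range n,
      |ε * e k - ∫ x in (a + k * ε)..(a + ((k + 1 : ℕ) : ℝ) * ε), φ x| ≤ ρ * ε := fun k hk => by
    have hlen : a + ((k + 1 : ℕ) : ℝ) * ε - (a + k * ε) = ε := by push_cast; ring
    have e₁ : ε * e k - ∫ x in (a + k * ε)..(a + ((k + 1 : ℕ) : ℝ) * ε), φ x =
        ∫ x in (a + k * ε)..(a + ((k + 1 : ℕ) : ℝ) * ε), (e k - φ x) := by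
      rw [intervalIntegral.integral_sub (by simp) (hφ.intervalIntegrable _ _)]
      rw [intervalIntegral.integral_const, hlen, smul_eq_mul]
    rw [e₁, ← Real.norm_eq_abs]
    have hb := intervalIntegral.norm_integral_le_of_norm_le_const (a := a + k * ε)
      (b := a + ((k + 1 : ℕ) : ℝ) * ε) (f := fun x => e k - φ x) (C := ρ) fun x hx => ?_
    · rwa [hlen, abs_of_pos hε] at hb
    · rw [Set.uIoc_of_le (by linarith)] at hx
      refine h k (Finset.mem_range.1 hk) x ⟨hx.1.le, ?_⟩
      have := hx.2
      push_cast at this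
      exact this
  refine (Finset.sum_le_sum this).trans ?_
  simp only [Finset.sum_const, Finset.card_range, nsmul_eq_mul]
  exact le_of_eq (by ring)

/-- The sum of `W` over the bonds of length `d + 1` of `N` atoms starting at `x`. -/
noncomputable def bondSum (W u : ℝ → ℝ) (ε x : ℝ) (N d : ℕ) : ℝ :=
  -- The subtraction is truncated: when `d + 1 ≥ N` there is no bond and the sum is `0`.
  ∑ k ∈ Finset.range (N - 1 - d),
    W ((u (x + (k + (d + 1)) * ε) - u (x + k * ε)) / ε)

/-- A sequence of spacings `ε`, first atoms `x` and numbers of atoms `N` in `[r, s]`, with second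
order expansions of the distances to the ends. -/
structure AtomSeq (r s : ℝ) (ε x : ℕ → ℝ) (N : ℕ → ℕ) (a₁ a₂ b₁ b₂ : ℝ) : Prop where
  pos : ∀ m, 0 < ε m
  lim : Tendsto ε atTop (𝓝 0)
  left_mem : ∀ m, r ≤ x m
  right_mem : ∀ m, x m + (N m - 1) * ε m ≤ s
  left₁ : Tendsto (fun m => (x m - r) / ε m) atTop (𝓝 a₁)
  left₂ : Tendsto (fun m => ((x m - r) / ε m - a₁) / ε m) atTop (𝓝 a₂)
  right₁ : Tendsto (fun m => (s - (x m + (N m - 1) * ε m)) / ε m) atTop (𝓝 b₁)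
  right₂ : Tendsto (fun m => ((s - (x m + (N m - 1) * ε m)) / ε m - b₁) / ε m) atTop (𝓝 b₂)

namespace AtomSeq

variable {r s : ℝ} {ε x : ℕ → ℝ} {N : ℕ → ℕ} {a₁ a₂ b₁ b₂ : ℝ}

theorem tendsto_mul_of_div {y : ℕ → ℝ} {l : ℝ} (A : AtomSeq r s ε x N a₁ a₂ b₁ b₂)
    (h : Tendsto (fun m => y m / ε m) atTop (𝓝 l)) : Tendsto y atTop (𝓝 0) := by
  have := h.mul A.lim
  simpa [div_mul_cancel₀ _ (A.pos _).ne'] using this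

theorem tendsto_first (A : AtomSeq r s ε x N a₁ a₂ b₁ b₂) : Tendsto x atTop (𝓝 r) := by
  simpa using (A.tendsto_mul_of_div A.left₁).add_const r

theorem tendsto_last (A : AtomSeq r s ε x N a₁ a₂ b₁ b₂) :
    Tendsto (fun m => x m + (N m - 1) * ε m) atTop (𝓝 s) := by
  simpa using (A.tendsto_mul_of_div A.right₁).const_sub s

theorem tendsto_count (A : AtomSeq r s ε x N a₁ a₂ b₁ b₂) :
    Tendsto (fun m => N m * ε m) atTop (𝓝 (s - r)) := by
  have := (A.tendsto_last.sub A.tendsto_first).add A.lim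
  rw [add_zero] at this
  exact this.congr fun m => by ring

end AtomSeq

namespace PieceModel

variable {W₀ W₁ W₂ u₀ u₁ u₂ u₃ : ℝ → ℝ} {r s δ K M α : ℝ}

theorem continuous_energyDensity (S : PieceModel W₀ W₁ W₂ u₀ u₁ u₂ u₃ r s δ K M α) (j : ℝ) :
    Continuous fun x => W₀ (j * u₁ x) :=
  S.continuous_W₀.comp (S.continuous_u₁.const_mul j)

/-- The difference of a bond sum and the integral over the midpoint cells, as a sum over bonds. -/
theorem bondSum_sub_integral (S : PieceModel W₀ W₁ W₂ u₀ u₁ u₂ u₃ r s δ K M α) {ε x : ℝ}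
    {N d : ℕ} (hd : d + 1 ≤ N) :
    bondSum W₀ u₀ ε x N d - (∫ z in (x + d * ε / 2)..(x + (N - 1) * ε - d * ε / 2),
        W₀ (((d : ℝ) + 1) * u₁ z)) / ε =
      ∑ k ∈ Finset.range (N - 1 - d),
        (W₀ ((u₀ ((x + k * ε + (d + 1) * ε / 2) + (d + 1) * ε / 2)
            - u₀ ((x + k * ε + (d + 1) * ε / 2) - (d + 1) * ε / 2)) / ε)
          - (∫ z in ((x + k * ε + (d + 1) * ε / 2) - ε / 2)..((x + k * ε + (d + 1) * ε / 2) + ε / 2),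
              W₀ (((d : ℝ) + 1) * u₁ z)) / ε) := by
  -- The `k`-th bond has its centre at `x + k ε + (d + 1) ε / 2`; the cells of width `ε` around the
  -- centres tile the interval left after removing `d ε / 2` next to each extreme atom.
  have hsum := intervalIntegral.sum_integral_adjacent_intervals (μ := MeasureTheory.volume)
    (f := fun z => W₀ (((d : ℝ) + 1) * u₁ z)) (a := fun k : ℕ => x + d * ε / 2 + k * ε)
    (n := N - 1 - d) fun k _ => (S.continuous_energyDensity _).intervalIntegrable _ _
  have hcast : ((N - 1 - d : ℕ) : ℝ) = N - 1 - d := by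
    rw [Nat.cast_sub (by omega), Nat.cast_sub (by omega)]; simp
  have hend : x + (N - 1) * ε - d * ε / 2 = x + d * ε / 2 + ((N - 1 - d : ℕ) : ℝ) * ε := by
    rw [hcast]; ring
  have hstart : x + d * ε / 2 = x + d * ε / 2 + ((0 : ℕ) : ℝ) * ε := by simp
  rw [hend, hstart, Finset.sum_sub_distrib, ← Finset.sum_div]
  simp only [Nat.cast_zero, zero_mul, add_zero] at hsum ⊢
  rw [← hsum]
  congr 1
  · refine Finset.sum_congr rfl fun k _ => ?_
    congr 4 <;> ring
  · congr 1
    refine Finset.sum_congr rfl fun k _ => ?_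
    congr 1
    · ring
    · push_cast; ring

theorem cell_mem {ε x : ℝ} {N d k : ℕ} (hε : 0 < ε) (hx : r ≤ x) (hs : x + (N - 1) * ε ≤ s)
    (hk : k < N - 1 - d) :
    r ≤ (x + k * ε + (d + 1) * ε / 2) - (d + 1) * ε / 2 ∧
      (x + k * ε + (d + 1) * ε / 2) + (d + 1) * ε / 2 ≤ s := by
  have hk' : (k : ℝ) + d + 2 ≤ N := by exact_mod_cast (by omega : k + d + 2 ≤ N)
  have : 0 ≤ (k : ℝ) * ε := by positivity
  constructor
  · linarith
  · refine le_trans ?_ hs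
    nlinarith

/-- At most `(s - r) / ε` cells, each with an error of order `ε² j^(2 - α)`: division by `ε` leaves
a bound independent of `ε`. -/
theorem abs_bondSum_sub_le (S : PieceModel W₀ W₁ W₂ u₀ u₁ u₂ u₃ r s δ K M α) {ε x : ℝ}
    {N d : ℕ} (hε : 0 < ε) (hx : r ≤ x) (hs : x + (N - 1) * ε ≤ s) (hd : d + 1 ≤ N) :
    |(bondSum W₀ u₀ ε x N d - (∫ z in (x + d * ε / 2)..(x + (N - 1) * ε - d * ε / 2),
        W₀ (((d : ℝ) + 1) * u₁ z)) / ε) / ε| ≤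
      (s - r) * (K * M ^ 2 + 2 * (K * M)) * (((d : ℝ) + 1) ^ 2 * ((d : ℝ) + 1) ^ (-α)) := by
  rw [S.bondSum_sub_integral hd, abs_div, abs_of_pos hε, div_le_iff₀ hε]
  refine (Finset.abs_sum_le_sum_abs _ _).trans ?_
  have hj : (1 : ℝ) ≤ (d : ℝ) + 1 := by linarith [(Nat.cast_nonneg d : (0 : ℝ) ≤ d)]
  have hK := S.K_pos
  have hM := S.M_pos
  have hq := rpow_pos hj (-α)
  set Q := (K * M ^ 2 + 2 * (K * M)) * (((d : ℝ) + 1) ^ 2 * ((d : ℝ) + 1) ^ (-α)) with hQ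
  have hQ0 : 0 ≤ Q := by positivity
  refine (Finset.sum_le_sum (g := fun _ => ε ^ 2 * Q) fun k hk => ?_).trans ?_
  · obtain ⟨h₁, h₂⟩ := cell_mem hε hx hs (Finset.mem_range.1 hk)
    exact S.abs_cell_error_le hj hε h₁ h₂
  · simp only [Finset.sum_const, Finset.card_range, nsmul_eq_mul]
    have hcast : ((N - 1 - d : ℕ) : ℝ) ≤ N - 1 := by
      rw [Nat.cast_sub (by omega), Nat.cast_sub (by omega)]; simp
    have : ((N - 1 - d : ℕ) : ℝ) * ε ≤ s - r := by nlinarith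
    calc _ = ((N - 1 - d : ℕ) : ℝ) * ε * (ε * Q) := by ring
      _ ≤ (s - r) * (ε * Q) := by gcongr
      _ = _ := by rw [hQ]; ring

variable {ε x : ℕ → ℝ} {N : ℕ → ℕ} {a₁ a₂ b₁ b₂ : ℝ}

theorem eventually_lt_count (S : PieceModel W₀ W₁ W₂ u₀ u₁ u₂ u₃ r s δ K M α)
    (A : AtomSeq r s ε x N a₁ a₂ b₁ b₂) (d : ℕ) : ∀ᶠ m in atTop, d + 1 ≤ N m := by
  have h₁ := A.tendsto_count.eventually (lt_mem_nhds (half_lt_self (sub_pos.2 S.lt)))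
  have h₂ : ∀ᶠ m in atTop, ε m * (d + 1) < (s - r) / 2 := by
    have := A.lim.mul_const ((d : ℝ) + 1)
    rw [zero_mul] at this
    exact this.eventually (gt_mem_nhds (half_pos (sub_pos.2 S.lt)))
  filter_upwards [h₁, h₂] with m h₁ h₂
  have : ((d : ℝ) + 1) < N m := by
    have hε := A.pos m
    by_contra hcon
    push Not at hcon
    nlinarith
  exact_mod_cast this.le

/-- The cell errors divided by `ε²` are uniformly close to `errorDensity`, so the expression is
nearly a Riemann sum over an interval that tends to `[r, s]`. -/
theorem tendsto_bondSum_sub (S : PieceModel W₀ W₁ W₂ u₀ u₁ u₂ u₃ r s δ K M α)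
    (A : AtomSeq r s ε x N a₁ a₂ b₁ b₂) (d : ℕ) :
    Tendsto (fun m => (bondSum W₀ u₀ (ε m) (x m) (N m) d -
      (∫ z in (x m + d * ε m / 2)..(x m + (N m - 1) * ε m - d * ε m / 2),
        W₀ (((d : ℝ) + 1) * u₁ z)) / ε m) / ε m) atTop
      (𝓝 (∫ z in r..s, errorDensity W₁ W₂ u₁ u₂ u₃ (d + 1) z)) := by
  have hj : (1 : ℝ) ≤ (d : ℝ) + 1 := by linarith [(Nat.cast_nonneg d : (0 : ℝ) ≤ d)]
  have hcont := S.continuous_errorDensity ((d : ℝ) + 1)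
  have hdε : Tendsto (fun m => d * ε m / 2) atTop (𝓝 0) := by
    simpa using (A.lim.const_mul (d : ℝ)).div_const 2
  have hint : Tendsto (fun m => ∫ z in (x m + d * ε m / 2)..(x m + (N m - 1) * ε m - d * ε m / 2),
      errorDensity W₁ W₂ u₁ u₂ u₃ (d + 1) z) atTop
      (𝓝 (∫ z in r..s, errorDensity W₁ W₂ u₁ u₂ u₃ (d + 1) z)) := by
    have hprim : Continuous fun y => ∫ z in r..y, errorDensity W₁ W₂ u₁ u₂ u₃ (d + 1) z :=
      intervalIntegral.continuous_primitive (fun a b => hcont.intervalIntegrable a b) r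
    have e₁ : Tendsto (fun m => x m + d * ε m / 2) atTop (𝓝 r) := by
      simpa using A.tendsto_first.add hdε
    have e₂ : Tendsto (fun m => x m + (N m - 1) * ε m - d * ε m / 2) atTop (𝓝 s) := by
      simpa using A.tendsto_last.sub hdε
    have := ((hprim.tendsto s).comp e₂).sub ((hprim.tendsto r).comp e₁)
    simp only [intervalIntegral.integral_same, sub_zero, Function.comp_def] at this
    refine this.congr fun m => ?_
    exact intervalIntegral.integral_interval_sub_left (hcont.intervalIntegrable _ _)
      (hcont.intervalIntegrable _ _)
  suffices h : Tendsto (fun m => (bondSum W₀ u₀ (ε m) (x m) (N m) d -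
      (∫ z in (x m + d * ε m / 2)..(x m + (N m - 1) * ε m - d * ε m / 2),
        W₀ (((d : ℝ) + 1) * u₁ z)) / ε m) / ε m -
      ∫ z in (x m + d * ε m / 2)..(x m + (N m - 1) * ε m - d * ε m / 2),
      errorDensity W₁ W₂ u₁ u₂ u₃ (d + 1) z) atTop (𝓝 0) by
    simpa using h.add hint
  rw [Metric.tendsto_atTop']
  intro η hη
  have hsr : 0 < s - r := sub_pos.2 S.lt
  obtain ⟨ε₀, hε₀, hclose⟩ := S.exists_cell_error_close hj (ρ := η / (2 * (s - r)))
    (by positivity)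
  have hev : ∀ᶠ m in atTop, ε m < ε₀ := A.lim.eventually (gt_mem_nhds hε₀)
  obtain ⟨m₀, hm₀⟩ := eventually_atTop.1 (hev.and (S.eventually_lt_count A d))
  refine ⟨m₀, fun m hm => ?_⟩
  obtain ⟨hεm, hN⟩ := hm₀ m hm.le
  have hε := A.pos m
  have hx := A.left_mem m
  have hs := A.right_mem m
  rw [Real.dist_eq, sub_zero, S.bondSum_sub_integral hN]
  have hcast : ((N m - 1 - d : ℕ) : ℝ) = N m - 1 - d := by
    rw [Nat.cast_sub (by omega), Nat.cast_sub (by omega)]; simp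
  have hend : x m + (N m - 1) * ε m - d * ε m / 2 =
      x m + d * ε m / 2 + ((N m - 1 - d : ℕ) : ℝ) * ε m := by
    rw [hcast]; ring
  rw [hend]
  have key := abs_sum_sub_integral_le hcont (a := x m + d * ε m / 2) (n := N m - 1 - d)
    (ρ := η / (2 * (s - r))) hε (e := fun k =>
      (W₀ ((u₀ ((x m + k * ε m + (d + 1) * ε m / 2) + (d + 1) * ε m / 2)
            - u₀ ((x m + k * ε m + (d + 1) * ε m / 2) - (d + 1) * ε m / 2)) / ε m)
          - (∫ z in ((x m + k * ε m + (d + 1) * ε m / 2) - ε m / 2)..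
              ((x m + k * ε m + (d + 1) * ε m / 2) + ε m / 2),
              W₀ (((d : ℝ) + 1) * u₁ z)) / ε m) / ε m ^ 2) fun k hk z hz => ?_
  · rw [Finset.sum_div]
    have e₁ : ∀ y : ℝ, ε m * (y / ε m ^ 2) = y / ε m := fun y => by field_simp
    simp only [e₁] at key
    refine key.trans_lt ?_
    have hle : ((N m - 1 - d : ℕ) : ℝ) * ε m ≤ s - r := by
      rw [hcast]
      have : 0 ≤ (d : ℝ) * ε m := by positivity
      nlinarith
    calc _ ≤ η / (2 * (s - r)) * (s - r) := by gcongr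
      _ = η / 2 := by field_simp
      _ < η := half_lt_self hη
  · obtain ⟨h₁, h₂⟩ := cell_mem hε hx hs hk
    refine hclose (ε m) hε hεm _ h₁ h₂ z ⟨?_, ?_⟩
    · linarith [hz.1]
    · linarith [hz.2]

end PieceModel

end SharpInterfaces

/-! ### End strips, domination in the bond length, and integration by parts. -/

namespace SharpInterfaces

namespace PieceModel

variable {W₀ W₁ W₂ u₀ u₁ u₂ u₃ : ℝ → ℝ} {r s δ K M α : ℝ}
  {ε x : ℕ → ℝ} {N : ℕ → ℕ} {a₁ a₂ b₁ b₂ : ℝ}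

theorem le_slope (S : PieceModel W₀ W₁ W₂ u₀ u₁ u₂ u₃ r s δ K M α) {j z : ℝ} (hj : 1 ≤ j)
    (hz : z ∈ Set.Icc r s) : δ * j ≤ j * u₁ z := by
  rw [mul_comm δ]
  exact mul_le_mul_of_nonneg_left (S.lower z hz) (by linarith)

theorem abs_energyDensity_le (S : PieceModel W₀ W₁ W₂ u₀ u₁ u₂ u₃ r s δ K M α) {j z : ℝ}
    (hj : 1 ≤ j) (hz : z ∈ Set.Icc r s) : |W₀ (j * u₁ z)| ≤ K * j ^ (-α) :=
  S.decay₀ j hj _ (S.le_slope hj hz)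

theorem hasDerivAt_primitive (S : PieceModel W₀ W₁ W₂ u₀ u₁ u₂ u₃ r s δ K M α) (j z : ℝ) :
    HasDerivAt (fun z => ∫ y in r..z, W₀ (j * u₁ y)) (W₀ (j * u₁ z)) z :=
  intervalIntegral.integral_hasDerivAt_right
    ((S.continuous_energyDensity j).intervalIntegrable _ _)
    ((S.continuous_energyDensity j).stronglyMeasurableAtFilter _ _)
    (S.continuous_energyDensity j).continuousAt

theorem continuous_energyDensity_deriv (S : PieceModel W₀ W₁ W₂ u₀ u₁ u₂ u₃ r s δ K M α)
    (j : ℝ) : Continuous fun x => W₁ (j * u₁ x) * j * u₂ x :=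
  continuous_iff_continuousAt.2 fun x => (S.hasDerivAt_energyDensity_deriv j x).continuousAt

/-- The bonds of length `d + 1` at first order: what remains after the bulk term and the counting of
the missing bonds at both ends, divided by `ε`. -/
noncomputable def bondRemainder (W₀ u₀ u₁ : ℝ → ℝ) (r s a₁ b₁ ε x : ℝ) (N d : ℕ) : ℝ :=
  (bondSum W₀ u₀ ε x N d - (∫ z in r..s, W₀ (((d : ℝ) + 1) * u₁ z)) / ε
    + (a₁ + d / 2) * W₀ (((d : ℝ) + 1) * u₁ r) + (b₁ + d / 2) * W₀ (((d : ℝ) + 1) * u₁ s)) / ε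

/-- The integral over `[r, s]` is the one over the cells plus two end strips. The strips are written
as increments of one primitive at `r` and at `s`, with the displacement in units of `ε`, negative at
`s`: the form that `tendsto_scaled_sub` and `abs_scaled_sub_le` expect. -/
theorem bondRemainder_eq (S : PieceModel W₀ W₁ W₂ u₀ u₁ u₂ u₃ r s δ K M α) {ε x : ℝ}
    (hε : 0 < ε) (N d : ℕ) :
    bondRemainder W₀ u₀ u₁ r s a₁ b₁ ε x N d =
      (bondSum W₀ u₀ ε x N d - (∫ z in (x + d * ε / 2)..(x + (N - 1) * ε - d * ε / 2),
        W₀ (((d : ℝ) + 1) * u₁ z)) / ε) / ε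
      - (((∫ y in r..(r + ((x - r) / ε + d / 2) * ε), W₀ (((d : ℝ) + 1) * u₁ y))
          - ∫ y in r..r, W₀ (((d : ℝ) + 1) * u₁ y)) / ε
          - (a₁ + d / 2) * W₀ (((d : ℝ) + 1) * u₁ r)) / ε
      + (((∫ y in r..(s + (-((s - (x + (N - 1) * ε)) / ε + d / 2)) * ε),
            W₀ (((d : ℝ) + 1) * u₁ y))
          - ∫ y in r..s, W₀ (((d : ℝ) + 1) * u₁ y)) / ε
          - (-(b₁ + d / 2)) * W₀ (((d : ℝ) + 1) * u₁ s)) / ε := by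
  have hint : ∀ a b, IntervalIntegrable (fun z => W₀ (((d : ℝ) + 1) * u₁ z))
      MeasureTheory.volume a b := fun a b => (S.continuous_energyDensity _).intervalIntegrable _ _
  have e₁ : r + ((x - r) / ε + d / 2) * ε = x + d * ε / 2 := by field_simp; ring
  have e₂ : s + (-((s - (x + (N - 1) * ε)) / ε + d / 2)) * ε = x + (N - 1) * ε - d * ε / 2 := by
    field_simp; ring
  rw [e₁, e₂, ← intervalIntegral.integral_interval_sub_left (hint r _) (hint r _),
    intervalIntegral.integral_same, bondRemainder]
  field_simp
  ring

/-- The limit of the first order remainder of the bonds of length `d + 1`. -/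
noncomputable def bondLimit (W₀ W₁ W₂ u₁ u₂ u₃ : ℝ → ℝ) (r s a₁ a₂ b₁ b₂ : ℝ) (d : ℕ) : ℝ :=
  (∫ z in r..s, errorDensity W₁ W₂ u₁ u₂ u₃ (d + 1) z)
    - (a₂ * W₀ (((d : ℝ) + 1) * u₁ r)
      + (a₁ + d / 2) ^ 2 / 2 * (W₁ (((d : ℝ) + 1) * u₁ r) * (d + 1) * u₂ r))
    + (-b₂ * W₀ (((d : ℝ) + 1) * u₁ s)
      + (b₁ + d / 2) ^ 2 / 2 * (W₁ (((d : ℝ) + 1) * u₁ s) * (d + 1) * u₂ s))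

theorem tendsto_bondRemainder (S : PieceModel W₀ W₁ W₂ u₀ u₁ u₂ u₃ r s δ K M α)
    (A : AtomSeq r s ε x N a₁ a₂ b₁ b₂) (d : ℕ) :
    Tendsto (fun m => bondRemainder W₀ u₀ u₁ r s a₁ b₁ (ε m) (x m) (N m) d) atTop
      (𝓝 (bondLimit W₀ W₁ W₂ u₁ u₂ u₃ r s a₁ a₂ b₁ b₂ d)) := by
  have hl := tendsto_scaled_sub (S.hasDerivAt_primitive ((d : ℝ) + 1))
    (S.hasDerivAt_energyDensity ((d : ℝ) + 1)) (S.continuous_energyDensity_deriv _) (t := r)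
    (θ := a₁ + d / 2) (κ := a₂) A.pos A.lim (A.left₁.add_const ((d : ℝ) / 2))
    (A.left₂.congr fun m => by congr 1; ring)
  have hr := tendsto_scaled_sub (S.hasDerivAt_primitive ((d : ℝ) + 1))
    (S.hasDerivAt_energyDensity ((d : ℝ) + 1)) (S.continuous_energyDensity_deriv _) (t := s)
    (θ := -(b₁ + d / 2)) (κ := -b₂) A.pos A.lim (A.right₁.add_const ((d : ℝ) / 2)).neg
    (A.right₂.neg.congr fun m => by rw [← neg_div]; congr 1; ring)
  have := ((S.tendsto_bondSum_sub A d).sub hl).add hr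
  rw [neg_sq] at this
  exact this.congr fun m => (S.bondRemainder_eq (A.pos m) (N m) d).symm

/-- The first order remainders are dominated by a summable sequence if `α > 3`. -/
theorem exists_bondRemainder_bound (S : PieceModel W₀ W₁ W₂ u₀ u₁ u₂ u₃ r s δ K M α)
    (A : AtomSeq r s ε x N a₁ a₂ b₁ b₂) : ∃ C, ∀ᶠ m in atTop, ∀ d : ℕ,
      |bondRemainder W₀ u₀ u₁ r s a₁ b₁ (ε m) (x m) (N m) d| ≤
        C * (((d : ℝ) + 1) ^ 2 * ((d : ℝ) + 1) ^ (-α)) := by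
  have hK := S.K_pos
  have hM := S.M_pos
  have hsr : 0 < s - r := sub_pos.2 S.lt
  have abs_lim : ∀ {y : ℕ → ℝ} {l : ℝ}, Tendsto y atTop (𝓝 l) → ∀ᶠ m in atTop, |y m| ≤ |l| + 1 :=
    fun h => (h.abs.eventually (gt_mem_nhds (lt_add_one _))).mono fun m hm => hm.le
  -- The rescaled distances to the ends converge, so eventually `D - 1` bounds them and their
  -- rescaled defects.
  set D := |a₁| + |b₁| + |a₂| + |b₂| + 2 with hD
  -- Eventually `c` is a lower bound for `N ε`, whose limit is `s - r`.
  set c := (s - r) / 2 with hc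
  have hc0 : 0 < c := half_pos hsr
  have hD0 : 0 < D := by positivity
  refine ⟨(s - r) * (K * M ^ 2 + 2 * (K * M)) + 2 * (D * K + D ^ 2 / 2 * (K * M))
    + ((s - r) * K / c ^ 2 + 2 * (D * K / c)), ?_⟩
  filter_upwards [abs_lim A.left₁, abs_lim A.left₂, abs_lim A.right₁, abs_lim A.right₂,
    A.tendsto_count.eventually (lt_mem_nhds (half_lt_self hsr))] with m hl₁ hl₂ hr₁ hr₂ hcount d
  have hε := A.pos m
  have hx := A.left_mem m
  have hs := A.right_mem m
  have hd0 : (0 : ℝ) ≤ d := Nat.cast_nonneg d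
  have hj : (1 : ℝ) ≤ (d : ℝ) + 1 := by linarith
  have hq := rpow_pos hj (-α)
  have hrs : r ∈ Set.Icc r s := ⟨le_rfl, S.lt.le⟩
  have hss : s ∈ Set.Icc r s := ⟨S.lt.le, le_rfl⟩
  have gr := S.abs_energyDensity_le hj hrs
  have gs := S.abs_energyDensity_le hj hss
  set j : ℝ := (d : ℝ) + 1 with hjdef
  set q : ℝ := j ^ (-α) with hqdef
  have hj2 : 1 ≤ j ^ 2 := one_le_pow₀ hj
  have hjj2 : j ≤ j ^ 2 := by nlinarith
  have ha := abs_nonneg a₁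
  have hb := abs_nonneg b₁
  have ha' := abs_nonneg a₂
  have hb' := abs_nonneg b₂
  have scale : ∀ y : ℝ, |y| ≤ D - 1 → |y + d / 2| ≤ D * j := fun y hy => by
    have : |y + d / 2| ≤ |y| + d / 2 := by
      simpa [abs_of_nonneg (by positivity : 0 ≤ (d : ℝ) / 2)] using abs_add_le y ((d : ℝ) / 2)
    have h1 : D * j = D + D * d := by rw [hjdef]; ring
    have h2 : 1 * (d : ℝ) ≤ D * d := by gcongr; linarith
    linarith
  -- Lengths with `d + 1 ≤ N` are handled by the cell estimate and the Taylor bounds. For larger `d`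
  -- there is no bond, but the integral and the edge terms are still subtracted.
  rcases le_or_gt (d + 1) (N m) with hN | hN
  · rw [S.bondRemainder_eq hε]
    have hN' : j ≤ N m := by rw [hjdef]; exact_mod_cast hN
    have h0 := S.abs_bondSum_sub_le hε hx hs hN
    rw [← hjdef, ← hqdef] at h0
    rw [← hjdef]
    have hNd : (d : ℝ) * ε m ≤ (N m - 1) * ε m := by gcongr; linarith
    have hdε : 0 ≤ d * ε m := by positivity
    have e₁ : r + ((x m - r) / ε m + d / 2) * ε m = x m + d * ε m / 2 := by field_simp; ring
    have e₂ : s + (-((s - (x m + (N m - 1) * ε m)) / ε m + d / 2)) * ε m =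
        x m + (N m - 1) * ε m - d * ε m / 2 := by field_simp; ring
    have h1 := abs_scaled_sub_le (S.hasDerivAt_primitive j) (S.hasDerivAt_energyDensity j)
      (t := r) (θ := (x m - r) / ε m + d / 2) (θ' := a₁ + d / 2) (M := K * M * q) hε
      fun z hz => S.abs_energyDensity_deriv_le hj <| Set.uIcc_subset_Icc hrs
        (by rw [e₁]; exact ⟨by linarith, by linarith⟩) hz
    have h2 := abs_scaled_sub_le (S.hasDerivAt_primitive j) (S.hasDerivAt_energyDensity j)
      (t := s) (θ := -((s - (x m + (N m - 1) * ε m)) / ε m + d / 2)) (θ' := -(b₁ + d / 2))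
      (M := K * M * q) hε
      fun z hz => S.abs_energyDensity_deriv_le hj <| Set.uIcc_subset_Icc hss
        (by rw [e₂]; exact ⟨by linarith, by linarith⟩) hz
    have bound : ∀ A θ Γ : ℝ, |A| ≤ D → |θ| ≤ D * j → |Γ| ≤ K * q →
        |A| * |Γ| + θ ^ 2 / 2 * (K * M * q) ≤ (D * K + D ^ 2 / 2 * (K * M)) * (j ^ 2 * q) := by
      intro A θ Γ hA hθ hΓ
      have hθ2 : θ ^ 2 ≤ (D * j) ^ 2 := by
        rw [← sq_abs]; exact pow_le_pow_left₀ (abs_nonneg _) hθ 2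
      calc |A| * |Γ| + θ ^ 2 / 2 * (K * M * q) ≤ D * (K * q) + (D * j) ^ 2 / 2 * (K * M * q) := by
            gcongr
        _ = D * K * (1 * q) + D ^ 2 / 2 * (K * M) * (j ^ 2 * q) := by ring
        _ ≤ D * K * (j ^ 2 * q) + D ^ 2 / 2 * (K * M) * (j ^ 2 * q) := by gcongr
        _ = _ := by ring
    have e₃ : ((x m - r) / ε m + d / 2 - (a₁ + d / 2)) / ε m = ((x m - r) / ε m - a₁) / ε m := by
      congr 1; ring
    have e₄ : (-((s - (x m + (N m - 1) * ε m)) / ε m + d / 2) - -(b₁ + d / 2)) / ε m =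
        -(((s - (x m + (N m - 1) * ε m)) / ε m - b₁) / ε m) := by
      rw [← neg_div]; congr 1; ring
    have b₁' := bound (((x m - r) / ε m - a₁) / ε m) ((x m - r) / ε m + d / 2) _ (by linarith)
      (scale _ (by linarith)) gr
    have b₂' := bound (-(((s - (x m + (N m - 1) * ε m)) / ε m - b₁) / ε m))
      (-((s - (x m + (N m - 1) * ε m)) / ε m + d / 2)) _ (by rw [abs_neg]; linarith)
      (by rw [abs_neg]; exact scale _ (by linarith)) gs
    rw [e₃] at h1
    rw [e₄] at h2
    have h1' := h1.trans b₁'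
    have h2' := h2.trans b₂'
    have hrest : 0 ≤ ((s - r) * K / c ^ 2 + 2 * (D * K / c)) * (j ^ 2 * q) := by positivity
    refine (abs_add_le _ _).trans ?_
    refine (add_le_add_left (abs_sub _ _) _).trans ?_
    linarith
  · have hT : bondSum W₀ u₀ (ε m) (x m) (N m) d = 0 := by
      rw [bondSum, show N m - 1 - d = 0 by omega, Finset.sum_range_zero]
    have hN' : (N m : ℝ) ≤ j := by rw [hjdef]; exact_mod_cast hN.le
    -- Such a length is at least comparable to the whole piece, so every factor `1 / ε` costs at
    -- most a factor `j / c`.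
    have hcj : c ≤ j * ε m := by nlinarith
    have hinv : 1 / ε m ≤ j / c := by
      rw [div_le_div_iff₀ hε hc0]; linarith
    have hI : |∫ z in r..s, W₀ (j * u₁ z)| ≤ K * q * (s - r) := by
      have := intervalIntegral.norm_integral_le_of_norm_le_const (a := r) (b := s)
        (f := fun z => W₀ (j * u₁ z)) (C := K * q) fun z hz => ?_
      · rwa [abs_of_pos hsr] at this
      · rw [Set.uIoc_of_le S.lt.le] at hz
        exact S.abs_energyDensity_le hj ⟨hz.1.le, hz.2⟩
    rw [bondRemainder, hT, ← hjdef]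
    have e : (0 - (∫ z in r..s, W₀ (j * u₁ z)) / ε m + (a₁ + d / 2) * W₀ (j * u₁ r)
        + (b₁ + d / 2) * W₀ (j * u₁ s)) / ε m = -(∫ z in r..s, W₀ (j * u₁ z)) * (1 / ε m) ^ 2
        + (a₁ + d / 2) * W₀ (j * u₁ r) * (1 / ε m) + (b₁ + d / 2) * W₀ (j * u₁ s) * (1 / ε m) := by
      field_simp
      ring
    rw [e]
    have hinv0 : 0 < 1 / ε m := by positivity
    have t₁ : |-(∫ z in r..s, W₀ (j * u₁ z)) * (1 / ε m) ^ 2| ≤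
        (s - r) * K / c ^ 2 * (j ^ 2 * q) := by
      rw [abs_mul, abs_neg, abs_of_nonneg (by positivity : 0 ≤ (1 / ε m) ^ 2)]
      calc _ ≤ K * q * (s - r) * (j / c) ^ 2 := by gcongr
        _ = _ := by field_simp
    have t₂ : ∀ y Γ : ℝ, |y| ≤ D - 1 → |Γ| ≤ K * q →
        |(y + d / 2) * Γ * (1 / ε m)| ≤ D * K / c * (j ^ 2 * q) := fun y Γ hy hΓ => by
      rw [abs_mul, abs_mul, abs_of_pos hinv0]
      calc _ ≤ D * j * (K * q) * (j / c) := by gcongr; exact scale y hy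
        _ = _ := by field_simp
    have t₃ := t₂ a₁ _ (by linarith) gr
    have t₄ := t₂ b₁ _ (by linarith) gs
    have hrest : 0 ≤ ((s - r) * (K * M ^ 2 + 2 * (K * M))
      + 2 * (D * K + D ^ 2 / 2 * (K * M))) * (j ^ 2 * q) := by positivity
    refine (abs_add_le _ _).trans ?_
    refine (add_le_add_left (abs_add_le _ _) _).trans ?_
    linarith

theorem sq_mul_rpow {j : ℝ} (hj : 1 ≤ j) : j ^ 2 * j ^ (-α) = j ^ (2 - α) := by
  rw [← Real.rpow_natCast, ← Real.rpow_add (by linarith)]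
  norm_num [sub_eq_add_neg]

/-- Dominated convergence for series; the dominating terms `(d + 1)^(2 - α)` are summable because `α
> 3`. -/
theorem tendsto_tsum_bondRemainder (S : PieceModel W₀ W₁ W₂ u₀ u₁ u₂ u₃ r s δ K M α)
    (A : AtomSeq r s ε x N a₁ a₂ b₁ b₂) (hα : 3 < α) :
    Tendsto (fun m => ∑' d, bondRemainder W₀ u₀ u₁ r s a₁ b₁ (ε m) (x m) (N m) d) atTop
      (𝓝 (∑' d, bondLimit W₀ W₁ W₂ u₁ u₂ u₃ r s a₁ a₂ b₁ b₂ d)) := by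
  obtain ⟨C, hC⟩ := S.exists_bondRemainder_bound A
  refine tendsto_tsum_of_dominated_convergence
    (bound := fun d : ℕ => C * ((d : ℝ) + 1) ^ (2 - α))
    ((summable_rpow_of_lt (by linarith)).mul_left C) (S.tendsto_bondRemainder A) ?_
  filter_upwards [hC] with m hm d
  rw [Real.norm_eq_abs, ← sq_mul_rpow (by linarith [(Nat.cast_nonneg d : (0 : ℝ) ≤ d)])]
  exact hm d

/-- The derivative of `(j³ - j) / 24 * W₁ (j u₁) u₂` is `errorDensity` plus `j⁴ W₂ (j u₁) u₂² / 24`.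
Integrating removes the third derivative of `u` and produces the coefficient `-1/24` of the bulk
term. -/
theorem integral_errorDensity (S : PieceModel W₀ W₁ W₂ u₀ u₁ u₂ u₃ r s δ K M α) (j : ℝ) :
    ∫ z in r..s, errorDensity W₁ W₂ u₁ u₂ u₃ j z =
      (j ^ 3 - j) / 24 * (W₁ (j * u₁ s) * u₂ s) - (j ^ 3 - j) / 24 * (W₁ (j * u₁ r) * u₂ r)
        - 1 / 24 * ∫ z in r..s, W₂ (j * u₁ z) * u₂ z ^ 2 * j ^ 4 := by
  have hd : ∀ z, HasDerivAt (fun z => (j ^ 3 - j) / 24 * (W₁ (j * u₁ z) * u₂ z))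
      (errorDensity W₁ W₂ u₁ u₂ u₃ j z + 1 / 24 * (W₂ (j * u₁ z) * u₂ z ^ 2 * j ^ 4)) z :=
    fun z => by
      have h := ((S.hW₁ (j * u₁ z)).comp z ((S.hu₁ z).const_mul j)).mul (S.hu₂ z)
      refine (h.const_mul ((j ^ 3 - j) / 24)).congr_deriv ?_
      simp only [Function.comp, errorDensity]
      ring
  have c₁ := S.continuous_errorDensity j
  have c₂ : Continuous fun z => W₂ (j * u₁ z) * u₂ z ^ 2 * j ^ 4 := by
    have := S.continuous_u₁
    have := S.continuous_u₂
    have := S.hW₂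
    fun_prop
  have h := intervalIntegral.integral_eq_sub_of_hasDerivAt (a := r) (b := s) (fun z _ => hd z)
    ((c₁.add (c₂.const_mul _)).intervalIntegrable _ _)
  rw [intervalIntegral.integral_add (c₁.intervalIntegrable _ _)
    ((c₂.const_mul _).intervalIntegrable _ _), intervalIntegral.integral_const_mul] at h
  linarith

end PieceModel

end SharpInterfaces

/-! ### Summed edge terms and the expansion for one piece. -/

namespace SharpInterfaces

/-- The linear form `v ↦ (d + 1) v`. -/
noncomputable def bondForm (d : ℕ) : ℝ →L[ℝ] ℝ := ((d : ℝ) + 1) • ContinuousLinearMap.id ℝ ℝ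

theorem bondForm_apply (d : ℕ) (v : ℝ) : bondForm d v = ((d : ℝ) + 1) * v := by
  simp [bondForm]

/-- The bonds missing at an end of a piece, at order zero. -/
noncomputable def edgeEnergy (W : ℝ → ℝ) (a v : ℝ) : ℝ :=
  -latticeSum W 0 bondForm (fun d : ℕ => a + (d : ℝ) / 2) v

/-- The first order correction to the energy at an end of a piece, in terms of the inward jet. -/
noncomputable def edgeCorrection (W : ℝ → ℝ) (a₁ a₂ v w : ℝ) : ℝ :=
  -(a₂ * latticeSum W 0 bondForm (fun _ : ℕ => (1 : ℝ)) v
    + w * latticeSum W 1 bondForm (fun d : ℕ => (a₁ + (d : ℝ) / 2) ^ 2 / 2 * ((d : ℝ) + 1)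
      + (((d : ℝ) + 1) ^ 3 - ((d : ℝ) + 1)) / 24) v)

theorem hasSum_intervalIntegral {f : ℕ → ℝ → ℝ} {b : ℕ → ℝ} {r s : ℝ} (hrs : r ≤ s)
    (hf : ∀ d, Continuous (f d)) (hb : Summable b) (hfb : ∀ d, ∀ z ∈ Set.Icc r s, |f d z| ≤ b d) :
    HasSum (fun d => ∫ z in r..s, f d z) (∫ z in r..s, ∑' d, f d z) := by
  refine intervalIntegral.hasSum_integral_of_dominated_convergence (fun d _ => b d)
    (fun d => (hf d).aestronglyMeasurable) (fun d => .of_forall fun z hz => ?_)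
    (.of_forall fun z _ => hb) (by simp) (.of_forall fun z hz => ?_)
  · rw [Set.uIoc_of_le hrs] at hz
    exact hfb d z (Set.Ioc_subset_Icc_self hz)
  · rw [Set.uIoc_of_le hrs] at hz
    exact (Summable.of_norm_bounded hb fun d => hfb d z (Set.Ioc_subset_Icc_self hz)).hasSum

namespace PieceModel

variable {W W₀ W₁ W₂ u₀ u₁ u₂ u₃ : ℝ → ℝ} {r s δ K M α : ℝ}
  {ε x : ℕ → ℝ} {N : ℕ → ℕ} {a₁ a₂ b₁ b₂ : ℝ}

theorem one_le_cast (d : ℕ) : (1 : ℝ) ≤ (d : ℝ) + 1 := by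
  linarith [(Nat.cast_nonneg d : (0 : ℝ) ≤ d)]

theorem summable_of_le_sq {f : ℕ → ℝ} (hα : 3 < α) (C : ℝ)
    (h : ∀ d : ℕ, |f d| ≤ C * (((d : ℝ) + 1) ^ 2 * ((d : ℝ) + 1) ^ (-α))) : Summable f := by
  refine Summable.of_norm_bounded
    ((summable_rpow_of_lt (s := 2 - α) (by linarith)).mul_left C) fun d => ?_
  rw [← sq_mul_rpow (one_le_cast d)]
  exact h d

theorem hasSum_integral_energyDensity (S : PieceModel W₀ W₁ W₂ u₀ u₁ u₂ u₃ r s δ K M α)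
    (hα : 3 < α) : HasSum (fun d : ℕ => ∫ z in r..s, W₀ (((d : ℝ) + 1) * u₁ z))
      (∫ z in r..s, ∑' d : ℕ, W₀ (((d : ℝ) + 1) * u₁ z)) :=
  hasSum_intervalIntegral (b := fun d : ℕ => K * ((d : ℝ) + 1) ^ (-α)) S.lt.le
    (fun d => S.continuous_energyDensity _)
    ((summable_rpow_of_lt (by linarith)).mul_left K)
    fun d z hz => S.abs_energyDensity_le (one_le_cast d) hz

theorem continuous_gradient (S : PieceModel W₀ W₁ W₂ u₀ u₁ u₂ u₃ r s δ K M α) (j : ℝ) :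
    Continuous fun z => W₂ (j * u₁ z) * u₂ z ^ 2 * j ^ 4 := by
  have := S.continuous_u₁
  have := S.continuous_u₂
  have := S.hW₂
  fun_prop

theorem abs_gradient_le (S : PieceModel W₀ W₁ W₂ u₀ u₁ u₂ u₃ r s δ K M α) {j z : ℝ}
    (hj : 1 ≤ j) (hz : z ∈ Set.Icc r s) :
    |W₂ (j * u₁ z) * u₂ z ^ 2 * j ^ 4| ≤ K * M ^ 2 * (j ^ 2 * j ^ (-α)) := by
  have h := S.decay₂ j hj _ (S.le_slope hj hz)
  have hK := S.K_pos
  have := rpow_pos hj (-α)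
  have hj0 : 0 < j := by linarith
  have u2 : u₂ z ^ 2 ≤ M ^ 2 := by
    rw [← sq_abs]; exact pow_le_pow_left₀ (abs_nonneg _) (S.upper₂ z hz) 2
  rw [abs_mul, abs_mul, abs_of_nonneg (sq_nonneg (u₂ z)), abs_of_nonneg (by positivity : 0 ≤ j ^ 4)]
  calc _ = j ^ 2 * ((j ^ 2 * |W₂ (j * u₁ z)|) * u₂ z ^ 2) := by ring
    _ ≤ j ^ 2 * ((K * j ^ (-α)) * M ^ 2) := by gcongr
    _ = _ := by ring

theorem hasSum_integral_gradient (S : PieceModel W₀ W₁ W₂ u₀ u₁ u₂ u₃ r s δ K M α)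
    (hα : 3 < α) :
    HasSum (fun d : ℕ => ∫ z in r..s, W₂ (((d : ℝ) + 1) * u₁ z) * u₂ z ^ 2 * ((d : ℝ) + 1) ^ 4)
      (∫ z in r..s, ∑' d : ℕ, W₂ (((d : ℝ) + 1) * u₁ z) * u₂ z ^ 2 * ((d : ℝ) + 1) ^ 4) :=
  hasSum_intervalIntegral (b := fun d : ℕ => K * M ^ 2 * ((d : ℝ) + 1) ^ (2 - α)) S.lt.le
    (fun d => S.continuous_gradient _) ((summable_rpow_of_lt (by linarith)).mul_left _)
    fun d z hz => by
      rw [← sq_mul_rpow (one_le_cast d)]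
      exact S.abs_gradient_le (one_le_cast d) hz

/-- The extended potential agrees with `W`, with two derivatives, on `[δ, ∞)`. -/
def Agrees (W W₀ W₁ W₂ : ℝ → ℝ) (δ : ℝ) : Prop :=
  ∀ x, δ ≤ x → W₀ x = W x ∧ W₁ x = iteratedDeriv 1 W x ∧ W₂ x = iteratedDeriv 2 W x

theorem le_mul_slope (S : PieceModel W₀ W₁ W₂ u₀ u₁ u₂ u₃ r s δ K M α) {j z : ℝ} (hj : 1 ≤ j)
    (hz : z ∈ Set.Icc r s) : δ ≤ j * u₁ z := by
  have := S.le_slope hj hz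
  have := S.δ_pos
  nlinarith

theorem hasSum_edgeEnergy (S : PieceModel W₀ W₁ W₂ u₀ u₁ u₂ u₃ r s δ K M α)
    (hW : Agrees W W₀ W₁ W₂ δ) (hα : 3 < α) (a : ℝ) {z : ℝ} (hz : z ∈ Set.Icc r s) :
    HasSum (fun d : ℕ => (a + d / 2) * W₀ (((d : ℝ) + 1) * u₁ z)) (-edgeEnergy W a (u₁ z)) := by
  have hs : Summable fun d : ℕ => (a + d / 2) * W₀ (((d : ℝ) + 1) * u₁ z) := by
    refine summable_of_le_sq hα ((|a| + 1) * K) fun d => ?_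
    have hj := one_le_cast d
    have hq := rpow_pos hj (-α)
    have hd0 : (0 : ℝ) ≤ d := Nat.cast_nonneg d
    have hK := S.K_pos
    have ha := abs_nonneg a
    have h1 : |a + d / 2| ≤ (|a| + 1) * ((d : ℝ) + 1) ^ 2 := by
      have : |a + (d : ℝ) / 2| ≤ |a| + d / 2 := by
        simpa [abs_of_nonneg (by positivity : 0 ≤ (d : ℝ) / 2)] using abs_add_le a ((d : ℝ) / 2)
      nlinarith [mul_nonneg ha hd0, mul_nonneg ha (sq_nonneg (d : ℝ))]
    rw [abs_mul]
    calc _ ≤ ((|a| + 1) * ((d : ℝ) + 1) ^ 2) * (K * ((d : ℝ) + 1) ^ (-α)) := by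
          gcongr; exact S.abs_energyDensity_le hj hz
      _ = _ := by ring
  convert hs.hasSum using 1
  rw [edgeEnergy, neg_neg, latticeSum]
  refine tsum_congr fun d => ?_
  rw [bondForm_apply, smul_eq_mul, mul_comm, iteratedDeriv_zero,
    (hW _ (S.le_mul_slope (one_le_cast d) hz)).1]

/-- With `j = d + 1`, the coefficient of `W₁` has two sources: `(a₁ + d / 2)² / 2 * j` from the
quadratic Taylor term of the end strip, and `(j³ - j) / 24` from the integration by parts. Both grow
like `j³`, which the decay of `W₁` reduces to `j^(2 - α)`. -/
theorem hasSum_edgeCorrection (S : PieceModel W₀ W₁ W₂ u₀ u₁ u₂ u₃ r s δ K M α)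
    (hW : Agrees W W₀ W₁ W₂ δ) (hα : 3 < α) (a₁ a₂ w : ℝ) {z : ℝ} (hz : z ∈ Set.Icc r s) :
    HasSum (fun d : ℕ => -(a₂ * W₀ (((d : ℝ) + 1) * u₁ z)
      + w * (((a₁ + d / 2) ^ 2 / 2 * ((d : ℝ) + 1) + (((d : ℝ) + 1) ^ 3 - ((d : ℝ) + 1)) / 24) *
        W₁ (((d : ℝ) + 1) * u₁ z)))) (edgeCorrection W a₁ a₂ (u₁ z) w) := by
  have hK := S.K_pos
  have h₀ : Summable fun d : ℕ => W₀ (((d : ℝ) + 1) * u₁ z) := by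
    refine summable_of_le_sq hα K fun d => ?_
    have hj := one_le_cast d
    have hq := rpow_pos hj (-α)
    have hj2 : 1 ≤ ((d : ℝ) + 1) ^ 2 := one_le_pow₀ hj
    calc _ ≤ K * (1 * ((d : ℝ) + 1) ^ (-α)) := by
          rw [one_mul]; exact S.abs_energyDensity_le hj hz
      _ ≤ _ := by gcongr
  have h₁ : Summable fun d : ℕ => ((a₁ + d / 2) ^ 2 / 2 * ((d : ℝ) + 1)
      + (((d : ℝ) + 1) ^ 3 - ((d : ℝ) + 1)) / 24) * W₁ (((d : ℝ) + 1) * u₁ z) := by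
    refine summable_of_le_sq hα (((|a₁| + 1) ^ 2 + 1) * K) fun d => ?_
    have hj := one_le_cast d
    have hq := rpow_pos hj (-α)
    have hd0 : (0 : ℝ) ≤ d := Nat.cast_nonneg d
    have ha := abs_nonneg a₁
    have hW₁ := S.decay₁ _ hj _ (S.le_slope hj hz)
    have h1 : |a₁ + (d : ℝ) / 2| ≤ (|a₁| + 1) * ((d : ℝ) + 1) := by
      have : |a₁ + (d : ℝ) / 2| ≤ |a₁| + d / 2 := by
        simpa [abs_of_nonneg (by positivity : 0 ≤ (d : ℝ) / 2)] using abs_add_le a₁ ((d : ℝ) / 2)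
      nlinarith [mul_nonneg ha hd0]
    set j : ℝ := (d : ℝ) + 1
    have hj0 : 0 < j := by linarith
    have h2 : (a₁ + (d : ℝ) / 2) ^ 2 ≤ ((|a₁| + 1) * j) ^ 2 := by
      rw [← sq_abs]; exact pow_le_pow_left₀ (abs_nonneg _) h1 2
    have h3 : j ≤ j ^ 3 := by
      have : j * 1 ≤ j * j ^ 2 := by gcongr; exact one_le_pow₀ hj
      linarith [this, (by ring : j * j ^ 2 = j ^ 3)]
    have h4 : |(a₁ + (d : ℝ) / 2) ^ 2 / 2 * j + (j ^ 3 - j) / 24| ≤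
        ((|a₁| + 1) ^ 2 + 1) * j ^ 3 := by
      have hnn : 0 ≤ (j ^ 3 - j) / 24 := by linarith
      rw [abs_of_nonneg (by positivity)]
      have h5 : (a₁ + (d : ℝ) / 2) ^ 2 / 2 * j ≤ ((|a₁| + 1) * j) ^ 2 / 2 * j := by gcongr
      have h6 : 0 ≤ (|a₁| + 1) ^ 2 * j ^ 3 := by positivity
      have h7 : ((|a₁| + 1) * j) ^ 2 / 2 * j = (|a₁| + 1) ^ 2 * j ^ 3 / 2 := by ring
      linarith
    rw [abs_mul]
    calc _ ≤ ((|a₁| + 1) ^ 2 + 1) * j ^ 3 * |W₁ (j * u₁ z)| := by gcongr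
      _ = ((|a₁| + 1) ^ 2 + 1) * j ^ 2 * (j * |W₁ (j * u₁ z)|) := by ring
      _ ≤ ((|a₁| + 1) ^ 2 + 1) * j ^ 2 * (K * j ^ (-α)) := by gcongr
      _ = _ := by ring
  suffices e : edgeCorrection W a₁ a₂ (u₁ z) w = -(a₂ * _ + w * _) from
    e ▸ ((h₀.hasSum.mul_left a₂).add (h₁.hasSum.mul_left w)).neg
  unfold edgeCorrection latticeSum
  congr 3
  · refine tsum_congr fun d => ?_
    rw [bondForm_apply, smul_eq_mul, mul_one, iteratedDeriv_zero,
      (hW _ (S.le_mul_slope (one_le_cast d) hz)).1]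
  · refine tsum_congr fun d => ?_
    rw [bondForm_apply, smul_eq_mul, mul_comm,
      (hW _ (S.le_mul_slope (one_le_cast d) hz)).2.1]

/-- The expansion of the energy of one smooth piece. -/
theorem tendsto_pieceEnergy (S : PieceModel W₀ W₁ W₂ u₀ u₁ u₂ u₃ r s δ K M α)
    (hW : Agrees W W₀ W₁ W₂ δ) (A : AtomSeq r s ε x N a₁ a₂ b₁ b₂) (hα : 3 < α) :
    Tendsto (fun m => (∑' d, bondSum W₀ u₀ (ε m) (x m) (N m) d
      - (∫ z in r..s, ∑' d : ℕ, W₀ (((d : ℝ) + 1) * u₁ z)) / ε m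
      - (edgeEnergy W a₁ (u₁ r) + edgeEnergy W b₁ (u₁ s))) / ε m) atTop
      (𝓝 (-(1 / 24) * (∫ z in r..s,
          ∑' d : ℕ, W₂ (((d : ℝ) + 1) * u₁ z) * u₂ z ^ 2 * ((d : ℝ) + 1) ^ 4)
        + (edgeCorrection W a₁ a₂ (u₁ r) (u₂ r) + edgeCorrection W b₁ b₂ (u₁ s) (-u₂ s)))) := by
  have hrs : r ∈ Set.Icc r s := ⟨le_rfl, S.lt.le⟩
  have hss : s ∈ Set.Icc r s := ⟨S.lt.le, le_rfl⟩
  have hlim : HasSum (bondLimit W₀ W₁ W₂ u₁ u₂ u₃ r s a₁ a₂ b₁ b₂)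
      (-(1 / 24) * (∫ z in r..s,
          ∑' d : ℕ, W₂ (((d : ℝ) + 1) * u₁ z) * u₂ z ^ 2 * ((d : ℝ) + 1) ^ 4)
        + (edgeCorrection W a₁ a₂ (u₁ r) (u₂ r) + edgeCorrection W b₁ b₂ (u₁ s) (-u₂ s))) := by
    -- Seen from inside the piece, the right end is a left end for the function reflected in domain
    -- and range: `u'` is kept and `u''` changes sign.
    have h := ((S.hasSum_integral_gradient hα).mul_left (-(1 / 24))).add
      ((S.hasSum_edgeCorrection hW hα a₁ a₂ (u₂ r) hrs).add
        (S.hasSum_edgeCorrection hW hα b₁ b₂ (-u₂ s) hss))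
    refine h.congr_fun fun d => ?_
    rw [bondLimit, S.integral_errorDensity]
    ring
  have h := S.tendsto_tsum_bondRemainder A hα
  rw [hlim.tsum_eq] at h
  refine h.congr fun m => ?_
  -- Only finitely many lengths occur, so the series of bond sums is a finite sum.
  have hbond : Summable fun d => bondSum W₀ u₀ (ε m) (x m) (N m) d := by
    refine summable_of_ne_finset_zero (s := Finset.range (N m)) fun d hd => ?_
    rw [Finset.mem_range, not_lt] at hd
    rw [bondSum, show N m - 1 - d = 0 by omega, Finset.sum_range_zero]
  have := (((hbond.hasSum.sub ((S.hasSum_integral_energyDensity hα).div_const (ε m))).add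
    (S.hasSum_edgeEnergy hW hα a₁ hrs)).add (S.hasSum_edgeEnergy hW hα b₁ hss)).div_const (ε m)
  refine (this.tsum_eq).trans ?_
  congr 1
  ring

end PieceModel

end SharpInterfaces

namespace SharpInterfaces

/-! ### The interaction across one interface -/

/-- The linear form `(v, v') ↦ (b + i) v + (a + k) v'`. -/
noncomputable def crossForm (a b : ℝ) (p : ℕ × ℕ) : ℝ × ℝ →L[ℝ] ℝ :=
  (b + p.1) • ContinuousLinearMap.fst ℝ ℝ ℝ + (a + p.2) • ContinuousLinearMap.snd ℝ ℝ ℝ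

theorem crossForm_apply (a b : ℝ) (p : ℕ × ℕ) (v : ℝ × ℝ) :
    crossForm a b p v = (b + p.1) * v.1 + (a + p.2) * v.2 := by
  simp [crossForm]

/-- The energy of the bonds across an interface, at order zero. -/
noncomputable def crossEnergy (W : ℝ → ℝ) (a b : ℝ) (v : ℝ × ℝ) : ℝ :=
  latticeSum W 0 (crossForm a b) (fun _ => (1 : ℝ)) v

/-- The first order correction to the energy of the bonds across an interface; `v` and `w` hold the
first and second derivatives on the two sides. -/
noncomputable def crossCorrection (W : ℝ → ℝ) (a a₂ b b₂ : ℝ) (v w : ℝ × ℝ) : ℝ :=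
  (a₂ * v.2 + b₂ * v.1) * latticeSum W 1 (crossForm a b) (fun _ => (1 : ℝ)) v
    + w.2 * latticeSum W 1 (crossForm a b) (fun p => (a + (p.2 : ℝ)) ^ 2 / 2) v
    - w.1 * latticeSum W 1 (crossForm a b) (fun p => (b + (p.1 : ℝ)) ^ 2 / 2) v

/-- The length, in lattice units, of a bond across an interface. -/
noncomputable def crossLength (p : ℕ × ℕ) : ℝ := 1 + (p.1 : ℝ) + p.2

theorem one_le_crossLength (p : ℕ × ℕ) : 1 ≤ crossLength p := by
  have h1 : (0 : ℝ) ≤ p.1 := Nat.cast_nonneg _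
  have h2 : (0 : ℝ) ≤ p.2 := Nat.cast_nonneg _
  unfold crossLength
  linarith

/-- Over pairs of atoms the admissible rate is `crossLength^(1 - α)`: `1 - α < -2` is again `α > 3`.
-/
theorem summable_of_le_crossLength {α : ℝ} {f : ℕ × ℕ → ℝ} (hα : 3 < α) (C : ℝ)
    (h : ∀ p, |f p| ≤ C * (crossLength p * crossLength p ^ (-α))) : Summable f := by
  refine Summable.of_norm_bounded
    ((summable_pair_rpow (s := 1 - α) (by linarith)).mul_left C) fun p => ?_
  have h1 := one_le_crossLength p
  have e : crossLength p ^ (1 - α) = crossLength p * crossLength p ^ (-α) := by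
    rw [sub_eq_add_neg, Real.rpow_add (by linarith), Real.rpow_one]
  refine (h p).trans (le_of_eq ?_)
  rw [← e]
  rfl

/-- Sequences of atoms on the two sides of an interface `t`: `n⁻` atoms ending in `y ≤ t` and `n⁺`
atoms starting from `x ≥ t`, with second order expansions. -/
structure InterfaceSeq (r t s : ℝ) (ε x y : ℕ → ℝ) (n n' : ℕ → ℕ) (a a₂ b b₂ : ℝ) : Prop where
  pos : ∀ m, 0 < ε m
  lim : Tendsto ε atTop (𝓝 0)
  left_le : ∀ m, y m ≤ t
  le_right : ∀ m, t ≤ x m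
  dist : ∀ m, y m + ε m ≤ x m
  left_mem : ∀ m, r ≤ y m - (n m - 1) * ε m
  right_mem : ∀ m, x m + (n' m - 1) * ε m ≤ s
  right₁ : Tendsto (fun m => (x m - t) / ε m) atTop (𝓝 a)
  right₂ : Tendsto (fun m => ((x m - t) / ε m - a) / ε m) atTop (𝓝 a₂)
  left₁ : Tendsto (fun m => (t - y m) / ε m) atTop (𝓝 b)
  left₂ : Tendsto (fun m => ((t - y m) / ε m - b) / ε m) atTop (𝓝 b₂)
  many : ∃ c > 0, ∀ᶠ m in atTop, c ≤ n m * ε m ∧ c ≤ n' m * ε m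

/-- The energy of the bonds across an interface. -/
noncomputable def crossSum (W u u' : ℝ → ℝ) (ε x y : ℝ) (n n' : ℕ) : ℝ :=
  ∑ i ∈ Finset.range n, ∑ k ∈ Finset.range n', W ((u' (x + k * ε) - u (y - i * ε)) / ε)

/-- Remainder of one bond across an interface. -/
noncomputable def crossRemainder (W u u' : ℝ → ℝ) (v : ℝ × ℝ) (a b ε x y : ℝ) (n n' : ℕ)
    (p : ℕ × ℕ) : ℝ :=
  ((if p.1 < n ∧ p.2 < n' then W ((u' (x + p.2 * ε) - u (y - p.1 * ε)) / ε) else 0)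
    - W (crossForm a b p v)) / ε

namespace InterfaceSeq

variable {r t s : ℝ} {ε x y : ℕ → ℝ} {n n' : ℕ → ℕ} {a a₂ b b₂ : ℝ}

theorem nonneg_left (I : InterfaceSeq r t s ε x y n n' a a₂ b b₂) : 0 ≤ b :=
  ge_of_tendsto' I.left₁ fun m => div_nonneg (sub_nonneg.2 (I.left_le m)) (I.pos m).le

theorem nonneg_right (I : InterfaceSeq r t s ε x y n n' a a₂ b b₂) : 0 ≤ a :=
  ge_of_tendsto' I.right₁ fun m => div_nonneg (sub_nonneg.2 (I.le_right m)) (I.pos m).le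

/-- Two distinct atoms are at least one spacing apart. This keeps the strain of every limiting bond
away from the singularity of `W`, even for `i = k = 0`. -/
theorem one_le (I : InterfaceSeq r t s ε x y n n' a a₂ b b₂) : 1 ≤ b + a := by
  refine ge_of_tendsto' (I.left₁.add I.right₁) fun m => ?_
  rw [← add_div, one_le_div (I.pos m)]
  linarith [I.dist m]

variable {W W₀ W₁ W₂ u₀ u₁ u₂ u₃ v₀ v₁ v₂ v₃ : ℝ → ℝ} {δ K M α : ℝ}

theorem le_crossForm (I : InterfaceSeq r t s ε x y n n' a a₂ b b₂)
    (S : PieceModel W₀ W₁ W₂ u₀ u₁ u₂ u₃ r t δ K M α)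
    (S' : PieceModel W₀ W₁ W₂ v₀ v₁ v₂ v₃ t s δ K M α) (p : ℕ × ℕ) :
    δ * crossLength p ≤ crossForm a b p (u₁ t, v₁ t) := by
  rw [crossForm_apply]
  have h1 : (0 : ℝ) ≤ p.1 := Nat.cast_nonneg _
  have h2 : (0 : ℝ) ≤ p.2 := Nat.cast_nonneg _
  have hu := S.lower t ⟨S.lt.le, le_rfl⟩
  have hv := S'.lower t ⟨le_rfl, S'.lt.le⟩
  have := I.nonneg_left
  have := I.nonneg_right
  have := I.one_le
  have hδ := S.δ_pos
  calc δ * crossLength p ≤ δ * (b + a + p.1 + p.2) := by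
        unfold crossLength; gcongr
    _ = (b + p.1) * δ + (a + p.2) * δ := by ring
    _ ≤ _ := by gcongr

/-- The bond vectors of active bonds, at first order. -/
theorem strain_sub_eq (hε : ∀ m, 0 < ε m) (htt : u₀ t = v₀ t) (p : ℕ × ℕ) (m : ℕ) :
    ((v₀ (x m + p.2 * ε m) - u₀ (y m - p.1 * ε m)) / ε m - crossForm a b p (u₁ t, v₁ t)) / ε m =
      ((v₀ (t + ((x m - t) / ε m + p.2) * ε m) - v₀ t) / ε m - (a + p.2) * v₁ t) / ε m
      - ((u₀ (t + (-((t - y m) / ε m + p.1)) * ε m) - u₀ t) / ε m - (-(b + p.1)) * u₁ t)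
        / ε m := by
  have := hε m
  have e₁ : t + ((x m - t) / ε m + p.2) * ε m = x m + p.2 * ε m := by field_simp; ring
  have e₂ : t + (-((t - y m) / ε m + p.1)) * ε m = y m - p.1 * ε m := by field_simp; ring
  -- Continuity of the displacement at `t` enters here: the two values at `t` cancel, and each side
  -- is expanded separately.
  rw [e₁, e₂, crossForm_apply, htt]
  field_simp
  ring

theorem tendsto_strain (I : InterfaceSeq r t s ε x y n n' a a₂ b b₂)
    (S : PieceModel W₀ W₁ W₂ u₀ u₁ u₂ u₃ r t δ K M α)
    (S' : PieceModel W₀ W₁ W₂ v₀ v₁ v₂ v₃ t s δ K M α) (htt : u₀ t = v₀ t) (p : ℕ × ℕ) :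
    Tendsto (fun m => ((v₀ (x m + p.2 * ε m) - u₀ (y m - p.1 * ε m)) / ε m
        - crossForm a b p (u₁ t, v₁ t)) / ε m) atTop
      (𝓝 (a₂ * v₁ t + (a + p.2) ^ 2 / 2 * v₂ t
        - (-b₂ * u₁ t + (b + p.1) ^ 2 / 2 * u₂ t))) := by
  have h₁ := tendsto_scaled_sub S'.hu₀ S'.hu₁ S'.continuous_u₂ (t := t)
    (θ := a + p.2) (κ := a₂) I.pos I.lim (I.right₁.add_const (p.2 : ℝ))
    (I.right₂.congr fun m => by congr 1; ring)
  have h₂ := tendsto_scaled_sub S.hu₀ S.hu₁ S.continuous_u₂ (t := t)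
    (θ := -(b + p.1)) (κ := -b₂) I.pos I.lim (I.left₁.add_const (p.1 : ℝ)).neg
    (I.left₂.neg.congr fun m => by rw [← neg_div]; congr 1; ring)
  rw [neg_sq] at h₂
  exact (h₁.sub h₂).congr fun m => (strain_sub_eq I.pos htt p m).symm

theorem eventually_active (I : InterfaceSeq r t s ε x y n n' a a₂ b b₂) (p : ℕ × ℕ) :
    ∀ᶠ m in atTop, p.1 < n m ∧ p.2 < n' m := by
  obtain ⟨c, hc, h⟩ := I.many
  have h₁ : ∀ k : ℕ, ∀ᶠ m in atTop, k * ε m < c := fun k => by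
    have := I.lim.const_mul (k : ℝ)
    rw [mul_zero] at this
    exact this.eventually (gt_mem_nhds hc)
  filter_upwards [h, h₁ p.1, h₁ p.2] with m h h₁ h₂
  have hε := I.pos m
  constructor
  · have : (p.1 : ℝ) < n m := lt_of_mul_lt_mul_right (h₁.trans_le h.1) hε.le
    exact_mod_cast this
  · have : (p.2 : ℝ) < n' m := lt_of_mul_lt_mul_right (h₂.trans_le h.2) hε.le
    exact_mod_cast this

theorem tendsto_crossRemainder (I : InterfaceSeq r t s ε x y n n' a a₂ b b₂)
    (S : PieceModel W₀ W₁ W₂ u₀ u₁ u₂ u₃ r t δ K M α)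
    (S' : PieceModel W₀ W₁ W₂ v₀ v₁ v₂ v₃ t s δ K M α) (htt : u₀ t = v₀ t) (p : ℕ × ℕ) :
    Tendsto (fun m => crossRemainder W₀ u₀ v₀ (u₁ t, v₁ t) a b (ε m) (x m) (y m) (n m) (n' m) p)
      atTop (𝓝 (W₁ (crossForm a b p (u₁ t, v₁ t)) *
        (a₂ * v₁ t + (a + p.2) ^ 2 / 2 * v₂ t
        - (-b₂ * u₁ t + (b + p.1) ^ 2 / 2 * u₂ t)))) := by
  refine (tendsto_div_of_hasDerivAt (S.hW₀ _) I.pos I.lim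
    (I.tendsto_strain S S' htt p)).congr' ?_
  filter_upwards [I.eventually_active p] with m hm
  rw [crossRemainder, if_pos hm]

-- For a bond that is present, the mean value theorem bounds the remainder by `|W₁ η|` times a
-- strain error of order `j²`; since `j |W₁ η| ≤ K j^(-α)`, what remains is of order `j^(1 - α)`. A
-- bond that is absent has `j ε ≥ c`, so the factor `1 / ε` is at most `j / c`.
set_option maxHeartbeats 1000000 in
theorem exists_crossRemainder_bound (I : InterfaceSeq r t s ε x y n n' a a₂ b b₂)
    (S : PieceModel W₀ W₁ W₂ u₀ u₁ u₂ u₃ r t δ K M α)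
    (S' : PieceModel W₀ W₁ W₂ v₀ v₁ v₂ v₃ t s δ K M α) (htt : u₀ t = v₀ t) :
    ∃ C, ∀ᶠ m in atTop, ∀ p,
      |crossRemainder W₀ u₀ v₀ (u₁ t, v₁ t) a b (ε m) (x m) (y m) (n m) (n' m) p| ≤
        C * (crossLength p * crossLength p ^ (-α)) := by
  have hK := S.K_pos
  have hM := S.M_pos
  have hδ := S.δ_pos
  obtain ⟨c, hc, hmany⟩ := I.many
  have abs_lim : ∀ {y : ℕ → ℝ} {l : ℝ}, Tendsto y atTop (𝓝 l) → ∀ᶠ m in atTop, |y m| ≤ |l| + 1 :=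
    fun h => (h.abs.eventually (gt_mem_nhds (lt_add_one _))).mono fun m hm => hm.le
  set D := |a| + |b| + |a₂| + |b₂| + 1 with hD
  have hD0 : 0 < D := by positivity
  refine ⟨2 * (D * M + D ^ 2 / 2 * M) * K + K / c, ?_⟩
  filter_upwards [abs_lim I.left₁, abs_lim I.left₂, abs_lim I.right₁, abs_lim I.right₂, hmany]
    with m hl₁ hl₂ hr₁ hr₂ hcount p
  have hε := I.pos m
  have h1 : (0 : ℝ) ≤ p.1 := Nat.cast_nonneg _
  have h2 : (0 : ℝ) ≤ p.2 := Nat.cast_nonneg _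
  have hj := one_le_crossLength p
  have hq := PieceModel.rpow_pos hj (-α)
  have hbase := I.le_crossForm S S' p
  set j := crossLength p with hjdef
  have hj0 : 0 < j := by linarith
  have ha := abs_nonneg a
  have hb := abs_nonneg b
  have ha' := abs_nonneg a₂
  have hb' := abs_nonneg b₂
  have hj1 : j = 1 + (p.1 : ℝ) + p.2 := rfl
  have hj2 : 1 ≤ j ^ 2 := one_le_pow₀ hj
  have hrt : t ∈ Set.Icc r t := ⟨S.lt.le, le_rfl⟩
  have hts : t ∈ Set.Icc t s := ⟨le_rfl, S'.lt.le⟩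
  by_cases hact : p.1 < n m ∧ p.2 < n' m
  · rw [crossRemainder, if_pos hact]
    have hn : (p.1 : ℝ) + 1 ≤ n m := by exact_mod_cast hact.1
    have hn' : (p.2 : ℝ) + 1 ≤ n' m := by exact_mod_cast hact.2
    have hyl : r ≤ y m - p.1 * ε m := (I.left_mem m).trans (by nlinarith)
    have hyt : y m - p.1 * ε m ≤ t := by
      have : 0 ≤ p.1 * ε m := by positivity
      linarith [I.left_le m]
    have hxs : x m + p.2 * ε m ≤ s := le_trans (by nlinarith) (I.right_mem m)
    have hxt : t ≤ x m + p.2 * ε m := by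
      have : 0 ≤ p.2 * ε m := by positivity
      linarith [I.le_right m]
    have hstrain : δ * j ≤ (v₀ (x m + p.2 * ε m) - u₀ (y m - p.1 * ε m)) / ε m := by
      rw [le_div_iff₀ hε]
      have i₁ := S.increment_ge hyl hyt le_rfl
      have i₂ := S'.increment_ge le_rfl hxt hxs
      have i₃ : j * ε m ≤ (x m + p.2 * ε m - t) + (t - (y m - p.1 * ε m)) := by
        rw [hj1]
        linarith [I.dist m]
      calc δ * j * ε m = δ * (j * ε m) := by ring
        _ ≤ δ * ((x m + p.2 * ε m - t) + (t - (y m - p.1 * ε m))) := by gcongr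
        _ ≤ _ := by rw [mul_add]; linarith
    obtain ⟨η, hη, e⟩ := exists_mean_value S.hW₀ (crossForm a b p (u₁ t, v₁ t))
      ((v₀ (x m + p.2 * ε m) - u₀ (y m - p.1 * ε m)) / ε m)
    have hη' : δ * j ≤ η := (le_min hbase hstrain).trans hη.1
    have hW₁ := S.decay₁ j hj η hη'
    rw [e, mul_div_assoc, abs_mul, strain_sub_eq I.pos htt]
    have e₁ : t + ((x m - t) / ε m + p.2) * ε m = x m + p.2 * ε m := by field_simp; ring
    have e₂ : t + (-((t - y m) / ε m + p.1)) * ε m = y m - p.1 * ε m := by field_simp; ring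
    have k₁ := abs_scaled_sub_le S'.hu₀ S'.hu₁ (t := t) (θ := (x m - t) / ε m + p.2)
      (θ' := a + p.2) (M := M) hε fun z hz => S'.upper₂ z <| Set.uIcc_subset_Icc hts
        (by rw [e₁]; exact ⟨hxt, hxs⟩) hz
    have k₂ := abs_scaled_sub_le S.hu₀ S.hu₁ (t := t) (θ := -((t - y m) / ε m + p.1))
      (θ' := -(b + p.1)) (M := M) hε fun z hz => S.upper₂ z <| Set.uIcc_subset_Icc hrt
        (by rw [e₂]; exact ⟨hyl, hyt⟩) hz
    have e₃ : ((x m - t) / ε m + p.2 - (a + p.2)) / ε m = ((x m - t) / ε m - a) / ε m := by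
      congr 1; ring
    have e₄ : (-((t - y m) / ε m + p.1) - -(b + p.1)) / ε m =
        -(((t - y m) / ε m - b) / ε m) := by
      rw [← neg_div]; congr 1; ring
    rw [e₃] at k₁
    rw [e₄, abs_neg, neg_sq] at k₂
    have bound : ∀ A θ Γ : ℝ, |A| ≤ D → |θ| ≤ D * j → |Γ| ≤ M →
        |A| * |Γ| + θ ^ 2 / 2 * M ≤ (D * M + D ^ 2 / 2 * M) * j ^ 2 := by
      intro A θ Γ hA hθ hΓ
      have hθ2 : θ ^ 2 ≤ (D * j) ^ 2 := by
        rw [← sq_abs]; exact pow_le_pow_left₀ (abs_nonneg _) hθ 2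
      calc |A| * |Γ| + θ ^ 2 / 2 * M ≤ D * M + (D * j) ^ 2 / 2 * M := by gcongr
        _ = D * M * 1 + D ^ 2 / 2 * M * j ^ 2 := by ring
        _ ≤ D * M * j ^ 2 + D ^ 2 / 2 * M * j ^ 2 := by gcongr
        _ = _ := by ring
    have scale : ∀ z l : ℝ, |z| ≤ D → 0 ≤ l → l ≤ j - 1 → |z + l| ≤ D * j := fun z l hz hl hlj => by
      have : |z + l| ≤ |z| + l := by simpa [abs_of_nonneg hl] using abs_add_le z l
      nlinarith
    have b₁ := bound _ _ _ (by linarith : |((x m - t) / ε m - a) / ε m| ≤ D)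
      (scale ((x m - t) / ε m) p.2 (by linarith) h2 (by linarith)) (S'.upper₁ t hts)
    have b₂' := bound _ _ _ (by linarith : |((t - y m) / ε m - b) / ε m| ≤ D)
      (scale ((t - y m) / ε m) p.1 (by linarith) h1 (by linarith)) (S.upper₁ t hrt)
    have hsum := (abs_sub _ _).trans (add_le_add (k₁.trans b₁) (k₂.trans b₂'))
    calc _ ≤ |W₁ η| * ((D * M + D ^ 2 / 2 * M) * j ^ 2 + (D * M + D ^ 2 / 2 * M) * j ^ 2) := by
          gcongr
      _ = 2 * (D * M + D ^ 2 / 2 * M) * j * (j * |W₁ η|) := by ring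
      _ ≤ 2 * (D * M + D ^ 2 / 2 * M) * j * (K * j ^ (-α)) := by gcongr
      _ = 2 * (D * M + D ^ 2 / 2 * M) * K * (j * j ^ (-α)) := by ring
      _ ≤ _ := by
        gcongr
        have : 0 < K / c := by positivity
        linarith
  · rw [crossRemainder, if_neg hact, zero_sub, neg_div, abs_neg, abs_div, abs_of_pos hε]
    have hcj : c ≤ j * ε m := by
      rcases not_and_or.1 hact with h | h
      · have : (n m : ℝ) ≤ p.1 := by exact_mod_cast not_lt.1 h
        refine hcount.1.trans ?_
        gcongr
        linarith
      · have : (n' m : ℝ) ≤ p.2 := by exact_mod_cast not_lt.1 h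
        refine hcount.2.trans ?_
        gcongr
        linarith
    have hinv : 1 / ε m ≤ j / c := by
      rw [div_le_div_iff₀ hε hc]; linarith
    have hW₀ := S.decay₀ j hj _ hbase
    calc _ = |W₀ (crossForm a b p (u₁ t, v₁ t))| * (1 / ε m) := by ring
      _ ≤ K * j ^ (-α) * (j / c) := by gcongr
      _ = K / c * (j * j ^ (-α)) := by ring
      _ ≤ _ := by
        gcongr
        have : 0 < 2 * (D * M + D ^ 2 / 2 * M) * K := by positivity
        linarith

theorem hasSum_crossEnergy (I : InterfaceSeq r t s ε x y n n' a a₂ b b₂)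
    (S : PieceModel W₀ W₁ W₂ u₀ u₁ u₂ u₃ r t δ K M α)
    (S' : PieceModel W₀ W₁ W₂ v₀ v₁ v₂ v₃ t s δ K M α) (hα : 3 < α)
    (hW : PieceModel.Agrees W W₀ W₁ W₂ δ) :
    HasSum (fun p => W₀ (crossForm a b p (u₁ t, v₁ t))) (crossEnergy W a b (u₁ t, v₁ t)) := by
  have hs : Summable fun p => W₀ (crossForm a b p (u₁ t, v₁ t)) := by
    refine summable_of_le_crossLength hα K fun p => ?_
    have hj := one_le_crossLength p
    have hq := PieceModel.rpow_pos hj (-α)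
    have hK := S.K_pos
    calc _ ≤ K * (1 * crossLength p ^ (-α)) := by
          rw [one_mul]; exact S.decay₀ _ hj _ (I.le_crossForm S S' p)
      _ ≤ _ := by gcongr
  convert hs.hasSum using 1
  rw [crossEnergy, latticeSum]
  refine tsum_congr fun p => ?_
  rw [smul_eq_mul, mul_one, iteratedDeriv_zero, (hW _ ?_).1]
  have := I.le_crossForm S S' p
  have := one_le_crossLength p
  have := S.δ_pos
  nlinarith

theorem hasSum_crossCorrection (I : InterfaceSeq r t s ε x y n n' a a₂ b b₂)
    (S : PieceModel W₀ W₁ W₂ u₀ u₁ u₂ u₃ r t δ K M α)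
    (S' : PieceModel W₀ W₁ W₂ v₀ v₁ v₂ v₃ t s δ K M α) (hα : 3 < α)
    (hW : PieceModel.Agrees W W₀ W₁ W₂ δ) :
    HasSum (fun p : ℕ × ℕ => W₁ (crossForm a b p (u₁ t, v₁ t)) *
        (a₂ * v₁ t + (a + p.2) ^ 2 / 2 * v₂ t - (-b₂ * u₁ t + (b + p.1) ^ 2 / 2 * u₂ t)))
      (crossCorrection W a a₂ b b₂ (u₁ t, v₁ t) (u₂ t, v₂ t)) := by
  have hK := S.K_pos
  have ha := I.nonneg_right
  have hb := I.nonneg_left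
  have hs : ∀ f : ℕ × ℕ → ℝ, ∀ C, (∀ p, |f p| ≤ C * crossLength p ^ 2) →
      HasSum (fun p => f p * W₁ (crossForm a b p (u₁ t, v₁ t)))
        (latticeSum W 1 (crossForm a b) f (u₁ t, v₁ t)) := fun f C hf => by
    have hsm : Summable fun p => f p * W₁ (crossForm a b p (u₁ t, v₁ t)) := by
      refine summable_of_le_crossLength hα (C * K) fun p => ?_
      have hj := one_le_crossLength p
      have hW₁ := S.decay₁ _ hj _ (I.le_crossForm S S' p)
      have hj0 : 0 < crossLength p := by linarith
      have hC : 0 ≤ C := by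
        have := (abs_nonneg _).trans (hf p)
        by_contra hneg
        push Not at hneg
        nlinarith [mul_neg_of_neg_of_pos hneg (pow_pos hj0 2)]
      rw [abs_mul]
      calc _ ≤ C * crossLength p ^ 2 * |W₁ (crossForm a b p (u₁ t, v₁ t))| := by
            gcongr; exact hf p
        _ = C * crossLength p * (crossLength p * |W₁ (crossForm a b p (u₁ t, v₁ t))|) := by ring
        _ ≤ C * crossLength p * (K * crossLength p ^ (-α)) := by gcongr
        _ = _ := by ring
    convert hsm.hasSum using 1
    rw [latticeSum]
    refine tsum_congr fun p => ?_
    rw [smul_eq_mul, mul_comm, (hW _ ?_).2.1]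
    have := I.le_crossForm S S' p
    have := one_le_crossLength p
    have := S.δ_pos
    nlinarith
  have q₀ := hs (fun _ => 1) 1 fun p => by
    rw [abs_one, one_mul]; exact one_le_pow₀ (one_le_crossLength p)
  have quad : ∀ (z : ℝ) (k : ℕ) (p : ℕ × ℕ), 0 ≤ z → (k : ℝ) ≤ crossLength p →
      |(z + k) ^ 2 / 2| ≤ (z + 1) ^ 2 * crossLength p ^ 2 := fun z k p hz hk => by
    have hj := one_le_crossLength p
    have hk0 : (0 : ℝ) ≤ k := Nat.cast_nonneg _
    rw [abs_of_nonneg (by positivity), ← mul_pow]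
    have : z + k ≤ (z + 1) * crossLength p := by nlinarith
    have h2 : (z + k) ^ 2 ≤ ((z + 1) * crossLength p) ^ 2 := by gcongr
    have : 0 ≤ (z + k) ^ 2 := by positivity
    linarith
  have hlen : ∀ p : ℕ × ℕ, (p.1 : ℝ) ≤ crossLength p ∧ (p.2 : ℝ) ≤ crossLength p := fun p => by
    have h1 : (0 : ℝ) ≤ p.1 := Nat.cast_nonneg _
    have h2 : (0 : ℝ) ≤ p.2 := Nat.cast_nonneg _
    unfold crossLength
    constructor <;> linarith
  have q₁ := hs (fun p => (a + p.2) ^ 2 / 2) _ fun p => quad a p.2 p ha (hlen p).2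
  have q₂ := hs (fun p => (b + p.1) ^ 2 / 2) _ fun p => quad b p.1 p hb (hlen p).1
  have h := ((q₀.mul_left (a₂ * v₁ t + b₂ * u₁ t)).add (q₁.mul_left (v₂ t))).sub
    (q₂.mul_left (u₂ t))
  refine h.congr_fun fun p => ?_
  ring

theorem tsum_crossRemainder (I : InterfaceSeq r t s ε x y n n' a a₂ b b₂)
    (S : PieceModel W₀ W₁ W₂ u₀ u₁ u₂ u₃ r t δ K M α)
    (S' : PieceModel W₀ W₁ W₂ v₀ v₁ v₂ v₃ t s δ K M α) (hα : 3 < α)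
    (hW : PieceModel.Agrees W W₀ W₁ W₂ δ) (m : ℕ) :
    ∑' p, crossRemainder W₀ u₀ v₀ (u₁ t, v₁ t) a b (ε m) (x m) (y m) (n m) (n' m) p =
      (crossSum W₀ u₀ v₀ (ε m) (x m) (y m) (n m) (n' m) - crossEnergy W a b (u₁ t, v₁ t))
        / ε m := by
  have h : HasSum (fun p : ℕ × ℕ => if p.1 < n m ∧ p.2 < n' m then
      W₀ ((v₀ (x m + p.2 * ε m) - u₀ (y m - p.1 * ε m)) / ε m) else 0)
      (crossSum W₀ u₀ v₀ (ε m) (x m) (y m) (n m) (n' m)) := by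
    have e : crossSum W₀ u₀ v₀ (ε m) (x m) (y m) (n m) (n' m) =
        ∑ p ∈ Finset.range (n m) ×ˢ Finset.range (n' m), if p.1 < n m ∧ p.2 < n' m then
          W₀ ((v₀ (x m + p.2 * ε m) - u₀ (y m - p.1 * ε m)) / ε m) else 0 := by
      rw [Finset.sum_product, crossSum]
      refine Finset.sum_congr rfl fun i hi => Finset.sum_congr rfl fun k hk => ?_
      rw [if_pos ⟨Finset.mem_range.1 hi, Finset.mem_range.1 hk⟩]
    rw [e]
    refine hasSum_sum_of_ne_finset_zero fun p hp => if_neg fun h => hp ?_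
    simpa using h
  exact ((h.sub (I.hasSum_crossEnergy S S' hα hW)).div_const (ε m)).tsum_eq

/-- The expansion of the energy of the bonds across one interface. -/
theorem tendsto_crossSum (I : InterfaceSeq r t s ε x y n n' a a₂ b b₂)
    (S : PieceModel W₀ W₁ W₂ u₀ u₁ u₂ u₃ r t δ K M α)
    (S' : PieceModel W₀ W₁ W₂ v₀ v₁ v₂ v₃ t s δ K M α) (hα : 3 < α)
    (hW : PieceModel.Agrees W W₀ W₁ W₂ δ) (htt : u₀ t = v₀ t) :
    Tendsto (fun m => (crossSum W₀ u₀ v₀ (ε m) (x m) (y m) (n m) (n' m)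
      - crossEnergy W a b (u₁ t, v₁ t)) / ε m) atTop
      (𝓝 (crossCorrection W a a₂ b b₂ (u₁ t, v₁ t) (u₂ t, v₂ t))) := by
  obtain ⟨C, hC⟩ := I.exists_crossRemainder_bound S S' htt
  have hb : Summable fun p => C * (crossLength p * crossLength p ^ (-α)) :=
    summable_of_le_crossLength hα |C| fun p => by
      have hj := one_le_crossLength p
      have := PieceModel.rpow_pos hj (-α)
      rw [abs_mul, abs_of_nonneg (by positivity : 0 ≤ crossLength p * crossLength p ^ (-α))]
  have h := tendsto_tsum_of_dominated_convergence hb (I.tendsto_crossRemainder S S' htt) hC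
  rw [(I.hasSum_crossCorrection S S' hα hW).tsum_eq] at h
  exact h.congr fun m => I.tsum_crossRemainder S S' hα hW m

end InterfaceSeq

end SharpInterfaces

namespace SharpInterfaces

/-! ### Sums over pairs of atoms -/

/-- The sum of `f i j` over the pairs `i < j` in `s`. -/
noncomputable def pairSum (f : ℤ → ℤ → ℝ) (s : Finset ℤ) : ℝ :=
  ∑ i ∈ s, ∑ j ∈ s with i < j, f i j

theorem sum_erase_eq_two_mul_pairSum {f : ℤ → ℤ → ℝ} (hf : ∀ i j, f i j = f j i) (s : Finset ℤ) :
    ∑ i ∈ s, ∑ j ∈ s.erase i, f i j = 2 * pairSum f s := by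
  have h : ∀ i ∈ s, ∑ j ∈ s.erase i, f i j =
      (∑ j ∈ s with i < j, f i j) + ∑ j ∈ s with j < i, f i j := fun i _ => by
    rw [← Finset.sum_union]
    · refine Finset.sum_congr ?_ fun _ _ => rfl
      ext j
      simp only [Finset.mem_erase, Finset.mem_union, Finset.mem_filter]
      constructor
      · rintro ⟨h1, h2⟩
        rcases lt_or_gt_of_ne h1 with h | h
        · exact Or.inr ⟨h2, h⟩
        · exact Or.inl ⟨h2, h⟩
      · rintro (⟨h1, h2⟩ | ⟨h1, h2⟩)
        · exact ⟨h2.ne', h1⟩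
        · exact ⟨h2.ne, h1⟩
    · rw [Finset.disjoint_filter]
      intro j _ h1 h2
      exact absurd h1 (not_lt.2 h2.le)
  have h2 : ∑ i ∈ s, ∑ j ∈ s with j < i, f i j = pairSum f s := by
    simp only [pairSum, Finset.sum_filter]
    rw [Finset.sum_comm]
    exact Finset.sum_congr rfl fun i _ => Finset.sum_congr rfl fun j _ => by rw [hf]
  rw [Finset.sum_congr rfl h, Finset.sum_add_distrib, h2, pairSum]
  ring

/-- The order hypothesis leaves at most one common element, an atom sitting on the interface. Its
bonds already occur in the sums over `s` and over `t`, hence the set differences. In the proof all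
sums become indicator sums over the square of `s ∪ t` and are compared termwise. -/
theorem pairSum_union (f : ℤ → ℤ → ℝ) {s t : Finset ℤ} (h : ∀ i ∈ s, ∀ j ∈ t, i ≤ j) :
    pairSum f (s ∪ t) = pairSum f s + pairSum f t + ∑ i ∈ s \ t, ∑ j ∈ t \ s, f i j := by
  have key : ∀ (A B : Finset ℤ) (P : ℤ → ℤ → Prop) [∀ i j, Decidable (P i j)], A ⊆ s ∪ t → B ⊆ s ∪ t →
      ∑ i ∈ A, ∑ j ∈ B, (if P i j then f i j else 0) =
        ∑ i ∈ s ∪ t, ∑ j ∈ s ∪ t, if i ∈ A ∧ j ∈ B ∧ P i j then f i j else 0 := by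
    intro A B P _ hA hB
    rw [← Finset.sum_subset hA]
    · refine Finset.sum_congr rfl fun i hi => ?_
      rw [← Finset.sum_subset hB]
      · exact Finset.sum_congr rfl fun j hj => by simp [hi, hj]
      · intro j _ hj; simp [hj]
    · intro i _ hi; simp [hi]
  have k₁ := key (s ∪ t) (s ∪ t) (fun i j => i < j) subset_rfl subset_rfl
  have k₂ := key s s (fun i j => i < j) Finset.subset_union_left Finset.subset_union_left
  have k₃ := key t t (fun i j => i < j) Finset.subset_union_right Finset.subset_union_right
  have k₄ := key (s \ t) (t \ s) (fun _ _ => True)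
    (Finset.sdiff_subset.trans Finset.subset_union_left)
    (Finset.sdiff_subset.trans Finset.subset_union_right)
  simp only [if_true] at k₄
  simp only [pairSum, Finset.sum_filter]
  rw [k₁, k₂, k₃, k₄, ← Finset.sum_add_distrib, ← Finset.sum_add_distrib]
  refine Finset.sum_congr rfl fun i hi => ?_
  rw [← Finset.sum_add_distrib, ← Finset.sum_add_distrib]
  refine Finset.sum_congr rfl fun j hj => ?_
  have h₁ : i ∈ s → j ∈ t → i ≤ j := fun hi hj => h i hi j hj
  have h₂ : j ∈ s → i ∈ t → j ≤ i := fun hj hi => h j hj i hi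
  have h₃ : i ∈ s → j ∉ s → i ≠ j := fun hi hj hij => hj (hij ▸ hi)
  simp only [Finset.mem_union] at hi hj
  simp only [Finset.mem_union, Finset.mem_sdiff, and_true]
  grind

theorem pairSum_Icc (f : ℤ → ℤ → ℝ) (k₁ k₂ : ℤ) :
    pairSum f (Finset.Icc k₁ k₂) = ∑ d ∈ Finset.range (k₂ + 1 - k₁).toNat,
      ∑ k ∈ Finset.range ((k₂ + 1 - k₁).toNat - 1 - d), f (k₁ + k) (k₁ + k + (d + 1)) := by
  rw [pairSum, Finset.sum_sigma', Finset.sum_sigma']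
  refine Finset.sum_bij' (fun p _ => ⟨(p.2 - p.1 - 1).toNat, (p.1 - k₁).toNat⟩)
    (fun q _ => ⟨k₁ + q.2, k₁ + q.2 + (q.1 + 1)⟩) ?_ ?_ ?_ ?_ ?_
  · rintro ⟨i, j⟩ h
    simp only [Finset.mem_sigma, Finset.mem_filter, Finset.mem_Icc, Finset.mem_range] at h ⊢
    omega
  · rintro ⟨d, k⟩ h
    simp only [Finset.mem_sigma, Finset.mem_filter, Finset.mem_Icc, Finset.mem_range] at h ⊢
    omega
  · rintro ⟨i, j⟩ h
    simp only [Finset.mem_sigma, Finset.mem_filter, Finset.mem_Icc] at h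
    simp only [Sigma.mk.injEq, heq_eq_eq]
    omega
  · rintro ⟨d, k⟩ h
    simp only [Sigma.mk.injEq, heq_eq_eq]
    omega
  · rintro ⟨i, j⟩ h
    simp only [Finset.mem_sigma, Finset.mem_filter, Finset.mem_Icc] at h
    dsimp only
    congr 1 <;> omega

theorem sum_Icc_eq_sum_range_add (F : ℤ → ℝ) (k₁ k₂ : ℤ) :
    ∑ i ∈ Finset.Icc k₁ k₂, F i = ∑ k ∈ Finset.range (k₂ + 1 - k₁).toNat, F (k₁ + k) := by
  refine Finset.sum_bij' (fun i _ => (i - k₁).toNat) (fun k _ => k₁ + k) ?_ ?_ ?_ ?_ ?_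
  · intro i h; simp only [Finset.mem_Icc, Finset.mem_range] at h ⊢; omega
  · intro i h; simp only [Finset.mem_Icc, Finset.mem_range] at h ⊢; omega
  · intro i h; simp only [Finset.mem_Icc] at h; omega
  · intro i h; omega
  · intro i h; simp only [Finset.mem_Icc] at h; congr 1; omega

theorem sum_Icc_eq_sum_range_sub (F : ℤ → ℝ) (k₁ k₂ : ℤ) :
    ∑ i ∈ Finset.Icc k₁ k₂, F i = ∑ k ∈ Finset.range (k₂ + 1 - k₁).toNat, F (k₂ - k) := by
  refine Finset.sum_bij' (fun i _ => (k₂ - i).toNat) (fun k _ => k₂ - k) ?_ ?_ ?_ ?_ ?_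
  · intro i h; simp only [Finset.mem_Icc, Finset.mem_range] at h ⊢; omega
  · intro i h; simp only [Finset.mem_Icc, Finset.mem_range] at h ⊢; omega
  · intro i h; simp only [Finset.mem_Icc] at h; omega
  · intro i h; omega
  · intro i h; simp only [Finset.mem_Icc] at h; congr 1; omega

/-- The energy of one bond. -/
noncomputable def bond (W u : ℝ → ℝ) (c ε : ℝ) (i j : ℤ) : ℝ :=
  W ((u (ε * (c + j)) - u (ε * (c + i))) / ε)

theorem energy_eq_pairSum {W u : ℝ → ℝ} (hW : ∀ x, x ≠ 0 → W x = W (-x)) (a b c ε : ℝ) :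
    energy W u a b c ε =
      1 / ((atoms a b c ε).card : ℝ) * pairSum (bond W u c ε) (atoms a b c ε) := by
  -- Evenness is assumed away from `0`, but at `0` it holds trivially.
  have hW' : ∀ x, W x = W (-x) := fun x => by
    rcases eq_or_ne x 0 with rfl | h
    · rw [neg_zero]
    · exact hW x h
  have h := sum_erase_eq_two_mul_pairSum (f := bond W u c ε) (fun i j => by
    rw [bond, hW', bond, ← neg_div, neg_sub]) (atoms a b c ε)
  simp only [bond] at h
  rw [energy, h]
  rcases eq_or_ne ((atoms a b c ε).card : ℝ) 0 with h0 | h0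
  · simp [h0]
  · field_simp

theorem pairSum_eq_tsum_bondSum {W u v : ℝ → ℝ} {r s c ε : ℝ} (hε : 0 < ε)
    (huv : ∀ x ∈ Set.Icc r s, u x = v x) :
    pairSum (bond W u c ε) (atoms r s c ε) =
      ∑' d, bondSum W v ε (ε * (c + firstIdx r c ε))
        (lastIdx s c ε + 1 - firstIdx r c ε).toNat d := by
  rw [atoms, pairSum_Icc, tsum_eq_sum (s := Finset.range (lastIdx s c ε + 1 - firstIdx r c ε).toNat)]
  · refine Finset.sum_congr rfl fun d hd => Finset.sum_congr rfl fun k hk => ?_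
    rw [Finset.mem_range] at hk
    have m₁ : firstIdx r c ε + (k : ℤ) ∈ atoms r s c ε := by
      rw [atoms, Finset.mem_Icc]; omega
    have m₂ : firstIdx r c ε + (k : ℤ) + (d + 1) ∈ atoms r s c ε := by
      rw [atoms, Finset.mem_Icc]; omega
    rw [mem_atoms hε] at m₁ m₂
    rw [bond, huv _ m₁, huv _ m₂]
    congr 4 <;> push_cast <;> ring
  · intro d hd
    rw [Finset.mem_range, not_lt] at hd
    rw [bondSum, show (lastIdx s c ε + 1 - firstIdx r c ε).toNat - 1 - d = 0 by omega,
      Finset.sum_range_zero]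

theorem le_of_mem_atoms {r t s c ε : ℝ} (hε : 0 < ε) {i j : ℤ} (hi : i ∈ atoms r t c ε)
    (hj : j ∈ atoms t s c ε) : i ≤ j := by
  rw [mem_atoms hε] at hi hj
  have : ε * (c + i) ≤ ε * (c + j) := hi.2.trans hj.1
  have := le_of_mul_le_mul_left this hε
  exact_mod_cast (add_le_add_iff_left c).1 this

theorem atoms_union {r t s c ε : ℝ} (hε : 0 < ε) (hrt : r ≤ t) (hts : t ≤ s) :
    atoms r s c ε = atoms r t c ε ∪ atoms t s c ε := by
  ext i
  rw [Finset.mem_union, mem_atoms hε, mem_atoms hε, mem_atoms hε, ← Set.mem_union,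
    Set.Icc_union_Icc_eq_Icc hrt hts]

theorem atoms_subset {r s r' s' c ε : ℝ} (hε : 0 < ε) (hr : r' ≤ r) (hs : s ≤ s') :
    atoms r s c ε ⊆ atoms r' s' c ε := fun i hi => by
  rw [mem_atoms hε] at hi ⊢
  exact ⟨hr.trans hi.1, hi.2.trans hs⟩

theorem abs_sum_sum_le {f : ℤ → ℤ → ℝ} {A B U : Finset ℤ} {w : ℝ} (hA : A ⊆ U) (hB : B ⊆ U)
    (hw : 0 ≤ w) (h : ∀ i ∈ A, ∀ j ∈ B, |f i j| ≤ w) :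
    |∑ i ∈ A, ∑ j ∈ B, f i j| ≤ (U.card : ℝ) ^ 2 * w := by
  have hAc : (A.card : ℝ) ≤ U.card := by exact_mod_cast Finset.card_le_card hA
  have hBc : (B.card : ℝ) ≤ U.card := by exact_mod_cast Finset.card_le_card hB
  calc _ ≤ ∑ i ∈ A, |∑ j ∈ B, f i j| := Finset.abs_sum_le_sum_abs _ _
    _ ≤ ∑ i ∈ A, ∑ j ∈ B, |f i j| := Finset.sum_le_sum fun i _ => Finset.abs_sum_le_sum_abs _ _
    _ ≤ ∑ i ∈ A, ∑ j ∈ B, w := Finset.sum_le_sum fun i hi => Finset.sum_le_sum fun j hj => h i hi j hj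
    _ = A.card * (B.card * w) := by simp
    _ ≤ U.card * (U.card * w) := by gcongr
    _ = _ := by ring

/-- The sum over the bonds across the interface `t`, an atom on the interface excluded. -/
noncomputable def adjacentSum (f : ℤ → ℤ → ℝ) (r t s c ε : ℝ) : ℝ :=
  ∑ i ∈ atoms r t c ε \ atoms t s c ε, ∑ j ∈ atoms t s c ε \ atoms r t c ε, f i j

/-- The pair sum splits into the pieces and the interfaces, up to the bonds that are longer than a
piece. -/
theorem abs_pairSum_sub_le {f : ℤ → ℤ → ℝ} {T : ℕ → ℝ} {n : ℕ} {c ε l w : ℝ} (hε : 0 < ε)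
    (hT : ∀ p < n + 1, T p ≤ T (p + 1)) (hl : ∀ p < n + 1, l ≤ T (p + 1) - T p) (hw : 0 ≤ w)
    {U : Finset ℤ} (hU : ∀ p ≤ n, atoms (T p) (T (p + 1)) c ε ⊆ U)
    (hf : ∀ i ∈ U, ∀ j ∈ U, l ≤ ε * (c + j) - ε * (c + i) → |f i j| ≤ w) :
    |pairSum f (atoms (T 0) (T (n + 1)) c ε)
      - ∑ p ∈ Finset.range (n + 1), pairSum f (atoms (T p) (T (p + 1)) c ε)
      - ∑ p ∈ Finset.range n, adjacentSum f (T p) (T (p + 1)) (T (p + 2)) c ε| ≤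
      n * ((U.card : ℝ) ^ 2 * w) := by
  have hT0 : ∀ p ≤ n + 1, T 0 ≤ T p := fun p => by
    induction p with
    | zero => intro _; rfl
    | succ p ih => intro hp; exact (ih (by omega)).trans (hT p (by omega))
  have hUB : ∀ p ≤ n, atoms (T 0) (T (p + 1)) c ε ⊆ U := fun p => by
    induction p with
    | zero => exact hU 0
    | succ p ih =>
      intro hp
      rw [atoms_union hε (hT0 (p + 1) (by omega)) (hT (p + 1) (by omega))]
      exact Finset.union_subset (ih (by omega)) (hU _ hp)
  -- The pieces are appended one at a time; each new one costs one error term `(U.card)² * w`.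
  suffices h : ∀ m ≤ n, |pairSum f (atoms (T 0) (T (m + 1)) c ε)
      - ∑ p ∈ Finset.range (m + 1), pairSum f (atoms (T p) (T (p + 1)) c ε)
      - ∑ p ∈ Finset.range m, adjacentSum f (T p) (T (p + 1)) (T (p + 2)) c ε| ≤
      m * ((U.card : ℝ) ^ 2 * w) from h n le_rfl
  intro m
  induction m with
  | zero => intro _; simp
  | succ m ih =>
    intro hm
    have ih := ih (by omega)
    set B := atoms (T 0) (T (m + 1)) c ε with hB
    set P := atoms (T m) (T (m + 1)) c ε with hP
    set Q := atoms (T (m + 1)) (T (m + 2)) c ε with hQ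
    have hPB : P ⊆ B := atoms_subset hε (hT0 m (by omega)) le_rfl
    have hQB : Q \ B = Q \ P := by
      ext i
      simp only [Finset.mem_sdiff, hQ, hB, hP, mem_atoms hε, Set.mem_Icc]
      have := hT0 m (by omega)
      have := hT m (by omega)
      constructor
      · rintro ⟨h1, h2⟩
        exact ⟨h1, fun h3 => h2 ⟨by linarith, h3.2⟩⟩
      · rintro ⟨h1, h2⟩
        exact ⟨h1, fun h3 => h2 ⟨by linarith [h1.1], h3.2⟩⟩
    rw [show m + 1 + 1 = m + 2 from rfl, Finset.sum_range_succ _ (m + 1),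
      Finset.sum_range_succ (fun p => adjacentSum f _ _ _ c ε) m, atoms_union hε (hT0 (m + 1) (by omega)) (hT (m + 1) (by omega)),
      show m + 1 + 1 = m + 2 from rfl, ← hB, ← hQ, pairSum_union f fun i hi j hj =>
      le_of_mem_atoms hε hi hj, hQB]
    -- Bonds from the old atoms `B` to the new piece `Q` either start in the last old piece `P` and
    -- are adjacent, or jump over all of `P` and are longer than `l`.
    have hsplit : ∑ i ∈ B \ Q, ∑ j ∈ Q \ P, f i j =
        adjacentSum f (T m) (T (m + 1)) (T (m + 2)) c ε
          + ∑ i ∈ (B \ Q) \ (P \ Q), ∑ j ∈ Q \ P, f i j := by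
      rw [adjacentSum, ← hP, ← hQ, add_comm]
      exact (Finset.sum_sdiff (Finset.sdiff_subset_sdiff hPB le_rfl)).symm
    have hfar : |∑ i ∈ (B \ Q) \ (P \ Q), ∑ j ∈ Q \ P, f i j| ≤ (U.card : ℝ) ^ 2 * w := by
      refine abs_sum_sum_le
        ((Finset.sdiff_subset.trans Finset.sdiff_subset).trans (hUB m (by omega)))
        (Finset.sdiff_subset.trans (hU (m + 1) hm)) hw fun i hi j hj => ?_
      simp only [Finset.mem_sdiff] at hi hj
      have hiP : i ∉ P := fun h => hi.2 ⟨h, hi.1.2⟩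
      refine hf i (hUB m (by omega) hi.1.1) j (hU (m + 1) hm hj.1) ?_
      have h1 := hi.1.1
      have h2 := hj.1
      rw [hP, mem_atoms hε, Set.mem_Icc] at hiP
      rw [hB, mem_atoms hε] at h1
      rw [hQ, mem_atoms hε] at h2
      have : ε * (c + i) < T m := by
        by_contra hcon
        exact hiP ⟨not_lt.1 hcon, h1.2⟩
      linarith [hl m (by omega), h2.1]
    rw [hsplit]
    rw [abs_le] at ih hfar ⊢
    push_cast
    constructor <;> linarith [ih.1, ih.2, hfar.1, hfar.2]

end SharpInterfaces

namespace SharpInterfaces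

/-! ### Extension of the data to the line -/

/-- Displacement of one piece, extended to the line with three derivatives. -/
structure DisplacementExtension (u u₀ u₁ u₂ u₃ : ℝ → ℝ) (r s δ : ℝ) : Prop where
  hu₀ : ∀ x, HasDerivAt u₀ (u₁ x) x
  hu₁ : ∀ x, HasDerivAt u₁ (u₂ x) x
  hu₂ : ∀ x, HasDerivAt u₂ (u₃ x) x
  hu₃ : Continuous u₃
  δ_pos : 0 < δ
  lower : ∀ x ∈ Set.Icc r s, δ ≤ u₁ x
  eq₀ : ∀ x ∈ Set.Icc r s, u₀ x = u x
  eq₁ : ∀ x ∈ Set.Icc r s, u₁ x = derivWithin u (Set.Icc r s) x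
  eq₂ : ∀ x ∈ Set.Icc r s, u₂ x = iteratedDerivWithin 2 u (Set.Icc r s) x

/-- Monotonicity gives a nonnegative derivative; the chain rule for the differentiable left inverse,
`g'(u x) u'(x) = 1`, excludes zero. -/
theorem IsSmoothDiffeoOn.derivWithin_pos {u : ℝ → ℝ} {r s : ℝ} (hrs : r < s)
    (hu : IsSmoothDiffeoOn u (Set.Icc r s)) (hmono : MonotoneOn u (Set.Icc r s)) {x : ℝ}
    (hx : x ∈ Set.Icc r s) : 0 < derivWithin u (Set.Icc r s) x := by
  obtain ⟨hu, g, hg, hgu⟩ := hu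
  refine lt_of_le_of_ne hmono.derivWithin_nonneg fun h0 => ?_
  have hud : HasDerivWithinAt u (derivWithin u (Set.Icc r s) x) (Set.Icc r s) x :=
    ((hu.differentiableOn (by simp)) x hx).hasDerivWithinAt
  have hgd : HasDerivWithinAt g (derivWithin g (u '' Set.Icc r s) (u x)) (u '' Set.Icc r s) (u x) :=
    ((hg.differentiableOn (by simp)) (u x) ⟨x, hx, rfl⟩).hasDerivWithinAt
  have hcomp := hgd.comp x hud (Set.mapsTo_image u _)
  have hid : HasDerivWithinAt (g ∘ u) 1 (Set.Icc r s) x :=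
    (hasDerivWithinAt_id x _).congr (fun y hy => hgu hy) (hgu hx)
  have huniq := (uniqueDiffOn_Icc hrs x hx).eq_deriv _ hcomp hid
  rw [← h0, mul_zero] at huniq
  exact zero_ne_one huniq

/-- The third derivative is extended by its end values and integrated three times. The constant `δ`
is the minimum of the first derivative on the piece. -/
theorem exists_displacementExtension {u : ℝ → ℝ} {r s : ℝ} (hrs : r < s)
    (hu : IsSmoothDiffeoOn u (Set.Icc r s)) (hmono : MonotoneOn u (Set.Icc r s)) :
    ∃ u₀ u₁ u₂ u₃ δ, DisplacementExtension u u₀ u₁ u₂ u₃ r s δ := by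
  set I := Set.Icc r s with hI
  have hud : UniqueDiffOn ℝ I := uniqueDiffOn_Icc hrs
  have hr : r ∈ I := ⟨le_rfl, hrs.le⟩
  have hder : ∀ i : ℕ, ∀ x ∈ I, HasDerivWithinAt (iteratedDerivWithin i u I)
      (iteratedDerivWithin (i + 1) u I x) I x := fun i x hx => by
    rw [iteratedDerivWithin_succ]
    exact ((hu.1.differentiableOn_iteratedDerivWithin (m := i)
      (by exact_mod_cast WithTop.coe_lt_top _) hud) x hx).hasDerivWithinAt
  have hcont : ∀ i : ℕ, ContinuousOn (iteratedDerivWithin i u I) I := fun i =>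
    hu.1.continuousOn_iteratedDerivWithin (by exact_mod_cast (WithTop.coe_lt_top _).le) hud
  obtain ⟨u₃, hu₃, e₃⟩ : ∃ u₃ : ℝ → ℝ, Continuous u₃ ∧
      ∀ x ∈ I, u₃ x = iteratedDerivWithin 3 u I x :=
    ⟨fun x => iteratedDerivWithin 3 u I (Set.projIcc r s hrs.le x),
      (hcont 3).domRestrict.comp continuous_projIcc, fun x hx => by
        simp only [Set.projIcc_of_mem hrs.le hx]⟩
  obtain ⟨u₂, hu₂, e₂⟩ := exists_extension_of_hasDerivWithinAt (convex_Icc r s) hr hu₃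
    (f := iteratedDerivWithin 2 u I) fun x hx => by rw [e₃ x hx]; exact hder 2 x hx
  obtain ⟨u₁, hu₁, e₁⟩ := exists_extension_of_hasDerivWithinAt (convex_Icc r s) hr
    (continuous_iff_continuousAt.2 fun x => (hu₂ x).continuousAt)
    (f := iteratedDerivWithin 1 u I) fun x hx => by rw [e₂ x hx]; exact hder 1 x hx
  have c₁ : Continuous u₁ := continuous_iff_continuousAt.2 fun x => (hu₁ x).continuousAt
  obtain ⟨u₀, hu₀, e₀⟩ := exists_extension_of_hasDerivWithinAt (convex_Icc r s) hr c₁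
    (f := iteratedDerivWithin 0 u I) fun x hx => by rw [e₁ x hx]; exact hder 0 x hx
  obtain ⟨z, hz, hmin⟩ := isCompact_Icc.exists_isMinOn ⟨r, hr⟩ c₁.continuousOn
  have e₁' : ∀ x ∈ I, u₁ x = derivWithin u I x := fun x hx => by
    rw [e₁ x hx, iteratedDerivWithin_one]
  refine ⟨u₀, u₁, u₂, u₃, u₁ z, hu₀, hu₁, hu₂, hu₃, ?_, fun x hx => hmin hx, fun x hx => ?_, e₁', e₂⟩
  · rw [e₁' z hz]
    exact hu.derivWithin_pos hrs hmono hz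
  · rw [e₀ x hx, iteratedDerivWithin_zero]

theorem DisplacementExtension.deriv_eq {u u₀ u₁ u₂ u₃ : ℝ → ℝ} {r s δ : ℝ}
    (h : DisplacementExtension u u₀ u₁ u₂ u₃ r s δ) {x : ℝ} (hx : x ∈ Set.Ioo r s) :
    deriv u x = u₁ x ∧ iteratedDeriv 2 u x = u₂ x := by
  have hev : ∀ y ∈ Set.Ioo r s, deriv u y = u₁ y := fun y hy => by
    rw [h.eq₁ y (Set.Ioo_subset_Icc_self hy), derivWithin_of_mem_nhds (Icc_mem_nhds hy.1 hy.2)]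
  refine ⟨hev x hx, ?_⟩
  have : deriv u =ᶠ[𝓝 x] u₁ := by
    filter_upwards [isOpen_Ioo.mem_nhds hx] with y hy using hev y hy
  rw [iteratedDeriv_succ, iteratedDeriv_one, this.deriv_eq, (h.hu₁ x).deriv]

/-- Forward bonds have strain at least `δ`, so `W` may be changed below `δ`: its second derivative
is frozen there and integrated twice. Weighting the derivatives by `j` and `j²` gives all three
bounds the same rate. -/
theorem exists_potentialExtension {W : ℝ → ℝ} {α : ℝ} (hα : 0 ≤ α) (hW : ContDiffOn ℝ ∞ W {0}ᶜ)
    (hd : Decays W α) {δ : ℝ} (hδ : 0 < δ) :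
    ∃ W₀ W₁ W₂ : ℝ → ℝ, ∃ K > 0, (∀ x, HasDerivAt W₀ (W₁ x) x) ∧ (∀ x, HasDerivAt W₁ (W₂ x) x) ∧
      Continuous W₂ ∧ PieceModel.Agrees W W₀ W₁ W₂ δ ∧
      (∀ j : ℝ, 1 ≤ j → ∀ x, δ * j ≤ x → |W₀ x| ≤ K * j ^ (-α)) ∧
      (∀ j : ℝ, 1 ≤ j → ∀ x, δ * j ≤ x → j * |W₁ x| ≤ K * j ^ (-α)) ∧
      (∀ j : ℝ, 1 ≤ j → ∀ x, δ * j ≤ x → j ^ 2 * |W₂ x| ≤ K * j ^ (-α)) := by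
  have hne : ∀ x : ℝ, δ ≤ x → x ≠ 0 := fun x hx => (hδ.trans_le hx).ne'
  have hder : ∀ i : ℕ, ∀ x ∈ Set.Ici δ, HasDerivWithinAt (iteratedDeriv i W)
      (iteratedDeriv (i + 1) W x) (Set.Ici δ) x := fun i x hx =>
    (hasDerivAt_iteratedDeriv_potential hW i (hne x hx)).hasDerivWithinAt
  obtain ⟨W₂, hW₂, e₂⟩ : ∃ W₂ : ℝ → ℝ, Continuous W₂ ∧
      ∀ x ∈ Set.Ici δ, W₂ x = iteratedDeriv 2 W x := by
    refine ⟨fun x => iteratedDeriv 2 W (max x δ), continuous_iff_continuousAt.2 fun x => ?_,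
      fun x hx => by simp only [max_eq_left (Set.mem_Ici.1 hx)]⟩
    exact ContinuousAt.comp (g := iteratedDeriv 2 W) (f := fun x => max x δ)
      (hasDerivAt_iteratedDeriv_potential hW 2 (hne _ (le_max_right _ _))).continuousAt
      (by fun_prop)
  obtain ⟨W₁, hW₁, e₁⟩ := exists_extension_of_hasDerivWithinAt (convex_Ici δ) Set.self_mem_Ici hW₂
    (f := iteratedDeriv 1 W) fun x hx => by rw [e₂ x hx]; exact hder 1 x hx
  obtain ⟨W₀, hW₀, e₀⟩ := exists_extension_of_hasDerivWithinAt (convex_Ici δ) Set.self_mem_Ici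
    (continuous_iff_continuousAt.2 fun x => (hW₁ x).continuousAt)
    (f := iteratedDeriv 0 W) fun x hx => by rw [e₁ x hx]; exact hder 0 x hx
  obtain ⟨K₀, hK₀, b₀⟩ := hd.exists_bound hW hα hδ 0
  obtain ⟨K₁, hK₁, b₁⟩ := hd.exists_bound hW hα hδ 1
  obtain ⟨K₂, hK₂, b₂⟩ := hd.exists_bound hW hα hδ 2
  have hle : ∀ j : ℝ, 1 ≤ j → ∀ x, δ * j ≤ x → δ ≤ x := fun j hj x hx => by nlinarith
  refine ⟨W₀, W₁, W₂, K₀ + K₁ + K₂, by positivity, hW₀, hW₁, hW₂, fun x hx => ⟨?_, e₁ x hx, e₂ x hx⟩,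
    fun j hj x hx => ?_, fun j hj x hx => ?_, fun j hj x hx => ?_⟩
  · rw [e₀ x hx, iteratedDeriv_zero]
  · have hj0 : 0 < j := by linarith
    have := b₀ j hj0 x (hle j hj x hx) hx
    rw [e₀ x (hle j hj x hx)]
    simp only [Nat.cast_zero, sub_zero] at this
    refine this.trans ?_
    gcongr
    linarith
  · have hj0 : 0 < j := by linarith
    have := b₁ j hj0 x (hle j hj x hx) hx
    rw [e₁ x (hle j hj x hx)]
    have e : j * j ^ (-α - ((1 : ℕ) : ℝ)) = j ^ (-α) := by
      rw [mul_comm, ← Real.rpow_add_one hj0.ne']; congr 1; push_cast; ring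
    calc _ ≤ j * (K₁ * j ^ (-α - ((1 : ℕ) : ℝ))) := by gcongr
      _ = K₁ * (j * j ^ (-α - ((1 : ℕ) : ℝ))) := by ring
      _ ≤ _ := by rw [e]; gcongr; linarith
  · have hj0 : 0 < j := by linarith
    have := b₂ j hj0 x (hle j hj x hx) hx
    rw [e₂ x (hle j hj x hx)]
    have e : j ^ 2 * j ^ (-α - ((2 : ℕ) : ℝ)) = j ^ (-α) := by
      rw [← Real.rpow_natCast, ← Real.rpow_add hj0]; congr 1; push_cast; ring
    calc _ ≤ j ^ 2 * (K₂ * j ^ (-α - ((2 : ℕ) : ℝ))) := by gcongr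
      _ = K₂ * (j ^ 2 * j ^ (-α - ((2 : ℕ) : ℝ))) := by ring
      _ ≤ _ := by rw [e]; gcongr; linarith

theorem DisplacementExtension.exists_bound {u u₀ u₁ u₂ u₃ : ℝ → ℝ} {r s δ : ℝ}
    (h : DisplacementExtension u u₀ u₁ u₂ u₃ r s δ) :
    ∃ M > 0, ∀ x ∈ Set.Icc r s, |u₁ x| ≤ M ∧ |u₂ x| ≤ M ∧ |u₃ x| ≤ M := by
  have c₁ : Continuous u₁ := continuous_iff_continuousAt.2 fun x => (h.hu₁ x).continuousAt
  have c₂ : Continuous u₂ := continuous_iff_continuousAt.2 fun x => (h.hu₂ x).continuousAt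
  obtain ⟨M₁, b₁⟩ := isCompact_Icc.exists_bound_of_continuousOn (c₁.continuousOn (s := Set.Icc r s))
  obtain ⟨M₂, b₂⟩ := isCompact_Icc.exists_bound_of_continuousOn (c₂.continuousOn (s := Set.Icc r s))
  obtain ⟨M₃, b₃⟩ := isCompact_Icc.exists_bound_of_continuousOn
    (h.hu₃.continuousOn (s := Set.Icc r s))
  refine ⟨max 1 (max M₁ (max M₂ M₃)), by positivity, fun x hx => ⟨?_, ?_, ?_⟩⟩
  · exact (b₁ x hx).trans (by simp)
  · exact (b₂ x hx).trans (by simp)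
  · exact (b₃ x hx).trans (by simp)

/-! ### Atoms along a sequence of spacings -/

theorem tendsto_of_isLittleO_expansion {ε X : ℕ → ℝ} {a₁ a₂ : ℝ} (hε : ∀ m, 0 < ε m)
    (hlim : Tendsto ε atTop (𝓝 0))
    (h : (fun m => X m - (a₁ * ε m + a₂ * ε m ^ 2)) =o[atTop] fun m => ε m ^ 2) :
    Tendsto (fun m => X m / ε m) atTop (𝓝 a₁) ∧
      Tendsto (fun m => (X m / ε m - a₁) / ε m) atTop (𝓝 a₂) := by
  have h0 := h.tendsto_div_nhds_zero.add_const a₂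
  rw [zero_add] at h0
  have h2 : Tendsto (fun m => (X m / ε m - a₁) / ε m) atTop (𝓝 a₂) := h0.congr fun m => by
    have := (hε m).ne'
    field_simp
    ring
  refine ⟨?_, h2⟩
  have h1 := (h2.mul hlim).add_const a₁
  rw [mul_zero, zero_add] at h1
  refine h1.congr fun m => ?_
  have := (hε m).ne'
  field_simp
  ring

theorem le_firstIdx {r c ε : ℝ} (hε : 0 < ε) : r ≤ ε * (c + firstIdx r c ε) := by
  have := Int.le_ceil (r / ε - c)
  rw [sub_le_iff_le_add, div_le_iff₀ hε] at this
  unfold firstIdx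
  linarith

theorem lastIdx_le {s c ε : ℝ} (hε : 0 < ε) : ε * (c + lastIdx s c ε) ≤ s := by
  have := Int.floor_le (s / ε - c)
  rw [le_sub_iff_add_le, le_div_iff₀ hε] at this
  unfold lastIdx
  linarith

theorem firstIdx_mono {r s c ε : ℝ} (hε : 0 < ε) (h : r ≤ s) : firstIdx r c ε ≤ firstIdx s c ε :=
  Int.ceil_le_ceil (by gcongr)

theorem lastIdx_mono {r s c ε : ℝ} (hε : 0 < ε) (h : r ≤ s) : lastIdx r c ε ≤ lastIdx s c ε :=
  Int.floor_le_floor (by gcongr)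

theorem firstIdx_le_lastIdx_add_one (t c ε : ℝ) : firstIdx t c ε ≤ lastIdx t c ε + 1 :=
  Int.ceil_le_floor_add_one _

theorem lastIdx_le_firstIdx (t c ε : ℝ) : lastIdx t c ε ≤ firstIdx t c ε :=
  Int.floor_le_ceil _

/-- For `r ≤ s` the integer difference is nonnegative, even when the interval contains no atom, so
`toNat` loses nothing. -/
theorem count_cast {r s c ε : ℝ} (hε : 0 < ε) (h : r ≤ s) :
    (((lastIdx s c ε + 1 - firstIdx r c ε).toNat : ℕ) : ℝ) =
      lastIdx s c ε + 1 - firstIdx r c ε := by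
  have h1 := firstIdx_mono (c := c) hε h
  have h2 := firstIdx_le_lastIdx_add_one s c ε
  have : ((lastIdx s c ε + 1 - firstIdx r c ε).toNat : ℤ) =
      lastIdx s c ε + 1 - firstIdx r c ε := by omega
  exact_mod_cast this

variable {r t s c : ℝ} {ε : ℕ → ℝ}

theorem LatticeExpansion.atomSeq {a₁ a₂ b₁ b₂ c₁ c₂ : ℝ}
    (h : LatticeExpansion r s c ε a₁ a₂ b₁ b₂ c₁ c₂) (hε : ∀ m, 0 < ε m)
    (hlim : Tendsto ε atTop (𝓝 0)) (hrs : r ≤ s) :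
    AtomSeq r s ε (fun m => ε m * (c + firstIdx r c (ε m)))
      (fun m => (lastIdx s c (ε m) + 1 - firstIdx r c (ε m)).toNat) a₁ a₂ b₁ b₂ := by
  have e : ∀ m, ε m * (c + firstIdx r c (ε m)) +
      ((((lastIdx s c (ε m) + 1 - firstIdx r c (ε m)).toNat : ℕ) : ℝ) - 1) * ε m =
      ε m * (c + lastIdx s c (ε m)) := fun m => by
    rw [count_cast (hε m) hrs]; ring
  obtain ⟨l₁, l₂⟩ := tendsto_of_isLittleO_expansion hε hlim h.left
  obtain ⟨r₁, r₂⟩ := tendsto_of_isLittleO_expansion hε hlim h.right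
  refine ⟨hε, hlim, fun m => le_firstIdx (hε m), fun m => ?_, l₁, l₂, ?_, ?_⟩
  · rw [e]; exact lastIdx_le (hε m)
  · simpa only [e] using r₁
  · simpa only [e] using r₂

/-- The atoms strictly to the left and strictly to the right of an interface. -/
theorem LatticeExpansion.interfaceSeq {a₁ a₂ b₁ b₂ c₁ c₂ a₁' a₂' b₁' b₂' c₁' c₂' : ℝ}
    (h : LatticeExpansion r t c ε a₁ a₂ b₁ b₂ c₁ c₂)
    (h' : LatticeExpansion t s c ε a₁' a₂' b₁' b₂' c₁' c₂') (hε : ∀ m, 0 < ε m)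
    (hlim : Tendsto ε atTop (𝓝 0)) (hrt : r < t) (hts : t < s) :
    InterfaceSeq r t s ε (fun m => ε m * (c + (lastIdx t c (ε m) + 1 : ℤ)))
      (fun m => ε m * (c + (firstIdx t c (ε m) - 1 : ℤ)))
      (fun m => (firstIdx t c (ε m) - 1 + 1 - firstIdx r c (ε m)).toNat)
      (fun m => (lastIdx s c (ε m) + 1 - (lastIdx t c (ε m) + 1)).toNat)
      (1 - b₁) (-b₂) (1 - a₁') (-a₂') := by
  -- The nearest atom strictly to the right of `t` follows the last atom up to `t`, so its distance
  -- to `t` is `ε` minus that of the latter: coefficients `1 - b₁`, `-b₂`. Symmetrically `1 - a₁'`,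
  -- `-a₂'` on the left. This holds whether or not an atom sits on `t`.
  obtain ⟨-, -, -, -, l₁, l₂, r₁, r₂⟩ := h.atomSeq hε hlim hrt.le
  obtain ⟨-, -, -, -, l₁', l₂', r₁', r₂'⟩ := h'.atomSeq hε hlim hts.le
  have n₁ : ∀ m, (((firstIdx t c (ε m) - 1 + 1 - firstIdx r c (ε m)).toNat : ℕ) : ℝ) =
      firstIdx t c (ε m) - firstIdx r c (ε m) := fun m => by
    have := firstIdx_mono (c := c) (hε m) hrt.le
    have : ((firstIdx t c (ε m) - 1 + 1 - firstIdx r c (ε m)).toNat : ℤ) =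
      firstIdx t c (ε m) - firstIdx r c (ε m) := by omega
    exact_mod_cast this
  have n₂ : ∀ m, (((lastIdx s c (ε m) + 1 - (lastIdx t c (ε m) + 1)).toNat : ℕ) : ℝ) =
      lastIdx s c (ε m) - lastIdx t c (ε m) := fun m => by
    have := lastIdx_mono (c := c) (hε m) hts.le
    have : ((lastIdx s c (ε m) + 1 - (lastIdx t c (ε m) + 1)).toNat : ℤ) =
      lastIdx s c (ε m) - lastIdx t c (ε m) := by omega
    exact_mod_cast this
  obtain ⟨rr₁, rr₂⟩ := tendsto_of_isLittleO_expansion hε hlim h.right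
  obtain ⟨ll₁, ll₂⟩ := tendsto_of_isLittleO_expansion hε hlim h'.left
  obtain ⟨fl₁, -⟩ := tendsto_of_isLittleO_expansion hε hlim h.left
  obtain ⟨lr₁, -⟩ := tendsto_of_isLittleO_expansion hε hlim h'.right
  have zero : ∀ {X : ℕ → ℝ} {l : ℝ}, Tendsto (fun m => X m / ε m) atTop (𝓝 l) →
      Tendsto X atTop (𝓝 0) := fun hX => by
    have := hX.mul hlim
    simpa [div_mul_cancel₀ _ (hε _).ne'] using this
  refine ⟨hε, hlim, fun m => ?_, fun m => ?_, fun m => ?_, fun m => ?_, fun m => ?_,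
    ?_, ?_, ?_, ?_, ?_⟩
  · have h1 := Int.ceil_lt_add_one (t / ε m - c)
    have h2 : (firstIdx t c (ε m) : ℝ) - 1 < t / ε m - c := by unfold firstIdx; linarith
    rw [lt_sub_iff_add_lt, lt_div_iff₀ (hε m)] at h2
    push_cast
    linarith
  · have h1 := Int.lt_floor_add_one (t / ε m - c)
    have h2 : t / ε m - c < (lastIdx t c (ε m) : ℝ) + 1 := by unfold lastIdx; linarith
    rw [sub_lt_iff_lt_add, div_lt_iff₀ (hε m)] at h2
    push_cast
    linarith
  · have h1 : (firstIdx t c (ε m) : ℝ) ≤ lastIdx t c (ε m) + 1 := by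
      exact_mod_cast firstIdx_le_lastIdx_add_one t c (ε m)
    have := hε m
    push_cast
    nlinarith
  · rw [n₁]
    have := le_firstIdx (r := r) (c := c) (hε m)
    push_cast
    linarith
  · rw [n₂]
    have := lastIdx_le (s := s) (c := c) (hε m)
    push_cast
    linarith
  · refine (rr₁.const_sub 1).congr fun m => ?_
    have := (hε m).ne'
    push_cast
    field_simp
    ring
  · refine rr₂.neg.congr fun m => ?_
    have := (hε m).ne'
    push_cast
    field_simp
    ring
  · refine (ll₁.const_sub 1).congr fun m => ?_
    have := (hε m).ne'
    push_cast
    field_simp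
    ring
  · refine ll₂.neg.congr fun m => ?_
    have := (hε m).ne'
    push_cast
    field_simp
    ring
  · refine ⟨min ((t - r) / 2) ((s - t) / 2), lt_min (by linarith) (by linarith), ?_⟩
    have k₁ : Tendsto (fun m => (((firstIdx t c (ε m) - 1 + 1 - firstIdx r c (ε m)).toNat : ℕ) : ℝ)
        * ε m) atTop (𝓝 (t - r)) := by
      have := ((zero ll₁).sub (zero fl₁)).add_const (t - r)
      rw [sub_zero, zero_add] at this
      refine this.congr fun m => ?_
      rw [n₁]; ring
    have k₂ : Tendsto (fun m => (((lastIdx s c (ε m) + 1 - (lastIdx t c (ε m) + 1)).toNat : ℕ) : ℝ)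
        * ε m) atTop (𝓝 (s - t)) := by
      have := ((zero rr₁).sub (zero lr₁)).add_const (s - t)
      rw [sub_zero, zero_add] at this
      refine this.congr fun m => ?_
      rw [n₂]; ring
    filter_upwards [k₁.eventually (lt_mem_nhds (half_lt_self (sub_pos.2 hrt))),
      k₂.eventually (lt_mem_nhds (half_lt_self (sub_pos.2 hts)))] with m h1 h2
    exact ⟨(min_le_left _ _).trans h1.le, (min_le_right _ _).trans h2.le⟩

/-- Both sides are numbered outwards from the interface, backwards on the left, so that a fixed pair
of indices has a limiting bond as `ε → 0`. -/
theorem adjacentSum_eq_crossSum {W u v w : ℝ → ℝ} {ε : ℝ} (hε : 0 < ε) (hrt : r ≤ t) (hts : t ≤ s)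
    (hv : ∀ x ∈ Set.Icc r t, u x = v x) (hw : ∀ x ∈ Set.Icc t s, u x = w x) :
    adjacentSum (bond W u c ε) r t s c ε =
      crossSum W v w ε (ε * (c + (lastIdx t c ε + 1 : ℤ))) (ε * (c + (firstIdx t c ε - 1 : ℤ)))
        (firstIdx t c ε - 1 + 1 - firstIdx r c ε).toNat
        (lastIdx s c ε + 1 - (lastIdx t c ε + 1)).toNat := by
  have i₁ := firstIdx_mono (c := c) hε hrt
  have i₂ := lastIdx_mono (c := c) hε hts
  have i₃ := firstIdx_le_lastIdx_add_one t c ε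
  have i₄ := lastIdx_le_firstIdx t c ε
  have e₁ : atoms r t c ε \ atoms t s c ε =
      Finset.Icc (firstIdx r c ε) (firstIdx t c ε - 1) := by
    ext k
    simp only [atoms, Finset.mem_sdiff, Finset.mem_Icc]
    omega
  have e₂ : atoms t s c ε \ atoms r t c ε =
      Finset.Icc (lastIdx t c ε + 1) (lastIdx s c ε) := by
    ext k
    simp only [atoms, Finset.mem_sdiff, Finset.mem_Icc]
    omega
  have hb : ∀ i ∈ atoms r t c ε \ atoms t s c ε, ∀ j ∈ atoms t s c ε \ atoms r t c ε,
      bond W u c ε i j = W ((w (ε * (c + j)) - v (ε * (c + i))) / ε) := fun i hi j hj => by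
    rw [Finset.mem_sdiff] at hi hj
    rw [bond, hv _ ((mem_atoms hε i).1 hi.1), hw _ ((mem_atoms hε j).1 hj.1)]
  rw [adjacentSum, Finset.sum_congr rfl fun i hi => Finset.sum_congr rfl fun j hj => hb i hi j hj,
    e₁, e₂, sum_Icc_eq_sum_range_sub, crossSum]
  refine Finset.sum_congr rfl fun i _ => ?_
  rw [sum_Icc_eq_sum_range_add]
  refine Finset.sum_congr rfl fun k _ => ?_
  congr 4 <;> push_cast <;> ring

end SharpInterfaces

namespace SharpInterfaces

/-! ### Smoothness of the boundary terms -/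

theorem locallyBelow_bondForm :
    LocallyBelow bondForm (fun d : ℕ => (d : ℝ) + 1) (Set.Ioi 0) := fun x hx => by
  have hx : 0 < x := hx
  refine ⟨x / 2, by positivity, x / 2, by positivity, fun y hy d => ?_⟩
  rw [Metric.mem_ball, Real.dist_eq, abs_lt] at hy
  rw [bondForm_apply, mul_comm]
  gcongr
  linarith [hy.1]

theorem norm_bondForm_le (d : ℕ) : ‖bondForm d‖ ≤ 1 * ((d : ℝ) + 1) := by
  rw [bondForm, norm_smul, Real.norm_of_nonneg (by positivity), mul_comm]
  gcongr
  exact ContinuousLinearMap.norm_id_le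

theorem locallyBelow_crossForm {a b : ℝ} (ha : 0 ≤ a) (hb : 0 ≤ b) (hab : 1 ≤ b + a) :
    LocallyBelow (crossForm a b) crossLength {v : ℝ × ℝ | 0 < v.1 ∧ 0 < v.2} := fun x hx => by
  have h1 : 0 < x.1 := hx.1
  have h2 : 0 < x.2 := hx.2
  have hmin : 0 < min x.1 x.2 / 2 := by positivity
  refine ⟨min x.1 x.2 / 2, hmin, min x.1 x.2 / 2, hmin, fun y hy p => ?_⟩
  rw [Metric.mem_ball, Prod.dist_eq, max_lt_iff, Real.dist_eq, Real.dist_eq, abs_lt, abs_lt] at hy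
  have m₁ := min_le_left x.1 x.2
  have m₂ := min_le_right x.1 x.2
  have y₁ : min x.1 x.2 / 2 ≤ y.1 := by linarith [hy.1.1]
  have y₂ : min x.1 x.2 / 2 ≤ y.2 := by linarith [hy.2.1]
  have p₁ : (0 : ℝ) ≤ p.1 := Nat.cast_nonneg _
  have p₂ : (0 : ℝ) ≤ p.2 := Nat.cast_nonneg _
  rw [crossForm_apply]
  calc _ ≤ min x.1 x.2 / 2 * (b + a + p.1 + p.2) := by unfold crossLength; gcongr
    _ = (b + p.1) * (min x.1 x.2 / 2) + (a + p.2) * (min x.1 x.2 / 2) := by ring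
    _ ≤ _ := by gcongr

theorem norm_crossForm_le {a b : ℝ} (ha : 0 ≤ a) (hb : 0 ≤ b) (p : ℕ × ℕ) :
    ‖crossForm a b p‖ ≤ (1 + a + b) * crossLength p := by
  have p₁ : (0 : ℝ) ≤ p.1 := Nat.cast_nonneg _
  have p₂ : (0 : ℝ) ≤ p.2 := Nat.cast_nonneg _
  refine (norm_add_le _ _).trans ?_
  rw [norm_smul, norm_smul, Real.norm_of_nonneg (by positivity),
    Real.norm_of_nonneg (by positivity)]
  calc _ ≤ (b + p.1) * 1 + (a + p.2) * 1 := by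
        gcongr
        · exact ContinuousLinearMap.norm_fst_le ..
        · exact ContinuousLinearMap.norm_snd_le ..
    _ ≤ _ := by unfold crossLength; nlinarith

variable {W : ℝ → ℝ} {α : ℝ}

/-- Growth `j^(2 + i)` of the coefficients is allowed: against the decay `j^(-α - i)` of the `i`-th
derivative it leaves `j^(2 - α)`. For double series one power less is available, as in
`contDiffOn_crossSeries`. -/
theorem contDiffOn_bondSeries (hα : 3 < α) (hW : ContDiffOn ℝ ∞ W {0}ᶜ) (hd : Decays W α) (i : ℕ)
    {f : ℕ → ℝ} (C : ℝ) (hf : ∀ d : ℕ, |f d| ≤ C * ((d : ℝ) + 1) ^ (2 + i)) :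
    ContDiffOn ℝ ∞ (latticeSum W i bondForm f) (Set.Ioi 0) := by
  refine contDiffOn_latticeSum (by linarith) hW hd isOpen_Ioi PieceModel.one_le_cast
    norm_bondForm_le locallyBelow_bondForm i f ?_
  refine Summable.of_nonneg_of_le (fun d => by positivity) (fun d => ?_)
    ((summable_rpow_of_lt (s := 2 - α) (by linarith)).mul_left C)
  have hj : (0 : ℝ) < (d : ℝ) + 1 := by positivity
  have e : ((d : ℝ) + 1) ^ (2 + i) * ((d : ℝ) + 1) ^ (-α - i) = ((d : ℝ) + 1) ^ (2 - α) := by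
    rw [← Real.rpow_natCast, ← Real.rpow_add hj]
    congr 1
    push_cast
    ring
  rw [Real.norm_eq_abs]
  calc _ ≤ (C * ((d : ℝ) + 1) ^ (2 + i)) * ((d : ℝ) + 1) ^ (-α - i) := by gcongr; exact hf d
    _ = _ := by rw [mul_assoc, e]

theorem contDiffOn_crossSeries (hα : 3 < α) (hW : ContDiffOn ℝ ∞ W {0}ᶜ) (hd : Decays W α)
    {a b : ℝ} (ha : 0 ≤ a) (hb : 0 ≤ b) (hab : 1 ≤ b + a) (i : ℕ) {f : ℕ × ℕ → ℝ} (C : ℝ)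
    (hf : ∀ p, |f p| ≤ C * crossLength p ^ (1 + i)) :
    ContDiffOn ℝ ∞ (latticeSum W i (crossForm a b) f) {v : ℝ × ℝ | 0 < v.1 ∧ 0 < v.2} := by
  refine contDiffOn_latticeSum (by linarith) hW hd
    ((isOpen_lt continuous_const continuous_fst).inter (isOpen_lt continuous_const continuous_snd))
    one_le_crossLength (norm_crossForm_le ha hb) (locallyBelow_crossForm ha hb hab) i f ?_
  refine Summable.of_nonneg_of_le (fun p => ?_) (fun p => ?_)
    ((summable_pair_rpow (s := 1 - α) (by linarith)).mul_left C)
  · have := one_le_crossLength p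
    positivity
  · have hj : 0 < crossLength p := by linarith [one_le_crossLength p]
    have e : crossLength p ^ (1 + i) * crossLength p ^ (-α - i) = crossLength p ^ (1 - α) := by
      rw [← Real.rpow_natCast, ← Real.rpow_add hj]
      congr 1
      push_cast
      ring
    rw [Real.norm_eq_abs]
    calc _ ≤ (C * crossLength p ^ (1 + i)) * crossLength p ^ (-α - i) := by gcongr; exact hf p
      _ = C * crossLength p ^ (1 - α) := by rw [mul_assoc, e]

theorem abs_add_half_le (a : ℝ) (d : ℕ) : |a + (d : ℝ) / 2| ≤ (|a| + 1) * ((d : ℝ) + 1) := by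
  have hd0 : (0 : ℝ) ≤ d := Nat.cast_nonneg d
  have : |a + (d : ℝ) / 2| ≤ |a| + d / 2 := by
    simpa [abs_of_nonneg (by positivity : 0 ≤ (d : ℝ) / 2)] using abs_add_le a ((d : ℝ) / 2)
  nlinarith [mul_nonneg (abs_nonneg a) hd0]

theorem contDiffOn_edgeEnergy (hα : 3 < α) (hW : ContDiffOn ℝ ∞ W {0}ᶜ) (hd : Decays W α) (a : ℝ) :
    ContDiffOn ℝ ∞ (edgeEnergy W a) (Set.Ioi 0) := by
  refine (contDiffOn_bondSeries hα hW hd 0 (|a| + 1) fun d => ?_).neg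
  refine (abs_add_half_le a d).trans ?_
  gcongr
  simpa using le_self_pow₀ (PieceModel.one_le_cast d) two_ne_zero

theorem contDiffOn_edgeCorrection (hα : 3 < α) (hW : ContDiffOn ℝ ∞ W {0}ᶜ) (hd : Decays W α)
    (a₁ a₂ : ℝ) :
    ContDiffOn ℝ ∞ (fun q : ℝ × ℝ => edgeCorrection W a₁ a₂ q.1 q.2) {q | 0 < q.1} := by
  have h₀ := contDiffOn_bondSeries hα hW hd 0 (f := fun _ : ℕ => (1 : ℝ)) 1 fun d => by
    rw [abs_one, one_mul]
    exact one_le_pow₀ (PieceModel.one_le_cast d)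
  have h₁ := contDiffOn_bondSeries hα hW hd 1 (f := fun d : ℕ =>
    (a₁ + (d : ℝ) / 2) ^ 2 / 2 * ((d : ℝ) + 1) + (((d : ℝ) + 1) ^ 3 - ((d : ℝ) + 1)) / 24)
    ((|a₁| + 1) ^ 2 + 1) fun d => by
    have hj := PieceModel.one_le_cast d
    have h1 := abs_add_half_le a₁ d
    have h2 : (a₁ + (d : ℝ) / 2) ^ 2 ≤ ((|a₁| + 1) * ((d : ℝ) + 1)) ^ 2 := by
      rw [← sq_abs]; exact pow_le_pow_left₀ (abs_nonneg _) h1 2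
    set j : ℝ := (d : ℝ) + 1
    have hj0 : 0 < j := by linarith
    have h3 : j ≤ j ^ 3 := le_self_pow₀ hj three_ne_zero
    have hnn : 0 ≤ (j ^ 3 - j) / 24 := by linarith
    rw [abs_of_nonneg (by positivity)]
    have h5 : (a₁ + (d : ℝ) / 2) ^ 2 / 2 * j ≤ ((|a₁| + 1) * j) ^ 2 / 2 * j := by gcongr
    have h6 : 0 ≤ (|a₁| + 1) ^ 2 * j ^ 3 := by positivity
    have h7 : ((|a₁| + 1) * j) ^ 2 / 2 * j = (|a₁| + 1) ^ 2 * j ^ 3 / 2 := by ring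
    norm_num
    linarith
  have m : Set.MapsTo (fun q : ℝ × ℝ => q.1) {q | 0 < q.1} (Set.Ioi 0) := fun q hq => hq
  exact ((contDiffOn_const.mul (h₀.comp contDiffOn_fst m)).add
    (contDiffOn_snd.mul (h₁.comp contDiffOn_fst m))).neg

theorem contDiffOn_crossEnergy (hα : 3 < α) (hW : ContDiffOn ℝ ∞ W {0}ᶜ) (hd : Decays W α)
    {a b : ℝ} (ha : 0 ≤ a) (hb : 0 ≤ b) (hab : 1 ≤ b + a) :
    ContDiffOn ℝ ∞ (crossEnergy W a b) {v : ℝ × ℝ | 0 < v.1 ∧ 0 < v.2} :=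
  contDiffOn_crossSeries hα hW hd ha hb hab 0 1 fun p => by
    rw [abs_one, one_mul]
    exact one_le_pow₀ (one_le_crossLength p)

theorem abs_add_sq_half_le {z : ℝ} (hz : 0 ≤ z) {k : ℕ} {p : ℕ × ℕ} (hk : (k : ℝ) ≤ crossLength p) :
    |(z + k) ^ 2 / 2| ≤ (z + 1) ^ 2 * crossLength p ^ 2 := by
  have hj := one_le_crossLength p
  have hk0 : (0 : ℝ) ≤ k := Nat.cast_nonneg _
  rw [abs_of_nonneg (by positivity), ← mul_pow]
  have : z + k ≤ (z + 1) * crossLength p := by nlinarith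
  have h2 : (z + k) ^ 2 ≤ ((z + 1) * crossLength p) ^ 2 := by gcongr
  have : 0 ≤ (z + k) ^ 2 := by positivity
  linarith

theorem cast_le_crossLength (p : ℕ × ℕ) :
    (p.1 : ℝ) ≤ crossLength p ∧ (p.2 : ℝ) ≤ crossLength p := by
  have h1 : (0 : ℝ) ≤ p.1 := Nat.cast_nonneg _
  have h2 : (0 : ℝ) ≤ p.2 := Nat.cast_nonneg _
  unfold crossLength
  constructor <;> linarith

theorem contDiffOn_crossCorrection (hα : 3 < α) (hW : ContDiffOn ℝ ∞ W {0}ᶜ) (hd : Decays W α)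
    {a b : ℝ} (ha : 0 ≤ a) (hb : 0 ≤ b) (hab : 1 ≤ b + a) (a₂ b₂ : ℝ) :
    ContDiffOn ℝ ∞ (fun q : (ℝ × ℝ) × (ℝ × ℝ) =>
      crossCorrection W a a₂ b b₂ (q.1.1, q.2.1) (q.1.2, q.2.2)) {q | 0 < q.1.1 ∧ 0 < q.2.1} := by
  have h₀ := contDiffOn_crossSeries hα hW hd ha hb hab 1 (f := fun _ => (1 : ℝ)) 1 fun p => by
    rw [abs_one, one_mul]
    exact one_le_pow₀ (one_le_crossLength p)
  have h₁ := contDiffOn_crossSeries hα hW hd ha hb hab 1 (f := fun p => (a + (p.2 : ℝ)) ^ 2 / 2) _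
    fun p => abs_add_sq_half_le ha (cast_le_crossLength p).2
  have h₂ := contDiffOn_crossSeries hα hW hd ha hb hab 1 (f := fun p => (b + (p.1 : ℝ)) ^ 2 / 2) _
    fun p => abs_add_sq_half_le hb (cast_le_crossLength p).1
  have m : Set.MapsTo (fun q : (ℝ × ℝ) × (ℝ × ℝ) => (q.1.1, q.2.1)) {q | 0 < q.1.1 ∧ 0 < q.2.1}
    {v : ℝ × ℝ | 0 < v.1 ∧ 0 < v.2} := fun q hq => hq
  have hp : ContDiffOn ℝ ∞ (fun q : (ℝ × ℝ) × (ℝ × ℝ) => (q.1.1, q.2.1))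
      {q | 0 < q.1.1 ∧ 0 < q.2.1} := by fun_prop
  have g₀ := h₀.comp hp m
  have g₁ := h₁.comp hp m
  have g₂ := h₂.comp hp m
  have c₀ : ContDiffOn ℝ ∞ (fun q : (ℝ × ℝ) × (ℝ × ℝ) => a₂ * q.2.1 + b₂ * q.1.1)
    {q | 0 < q.1.1 ∧ 0 < q.2.1} := by fun_prop
  have c₁ : ContDiffOn ℝ ∞ (fun q : (ℝ × ℝ) × (ℝ × ℝ) => q.2.2)
    {q | 0 < q.1.1 ∧ 0 < q.2.1} := by fun_prop
  have c₂ : ContDiffOn ℝ ∞ (fun q : (ℝ × ℝ) × (ℝ × ℝ) => q.1.2)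
    {q | 0 < q.1.1 ∧ 0 < q.2.1} := by fun_prop
  exact ((c₀.mul g₀).add (c₁.mul g₁)).sub (c₂.mul g₂)

/-! ### Sums of terms localized at the ends and at the interfaces -/

variable {n : ℕ} {X : Type}

/-- A sum of functions of the data at the ends of the pieces and on the two sides of each
interface. -/
noncomputable def localSum (φ ψ : Fin (n + 1) → X → ℝ) (χ : Fin n → X → X → ℝ)
    (v : Fin (n + 1) → X × X) : ℝ :=
  ∑ p, (φ p (v p).1 + ψ p (v p).2) + ∑ i : Fin n, χ i (v i.castSucc).2 (v i.succ).1

/-- Every left end but the first and every right end but the last lies on an interface, so their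
terms join the one of that interface. -/
theorem noInteraction_localSum (D : Set (Fin (n + 1) → X × X)) (φ ψ : Fin (n + 1) → X → ℝ)
    (χ : Fin n → X → X → ℝ) : NoInteraction D (localSum φ ψ χ) := by
  refine ⟨φ 0, ψ (Fin.last n), fun i x y => ψ i.castSucc x + φ i.succ y + χ i x y, fun v _ => ?_⟩
  rw [localSum, Finset.sum_add_distrib, Fin.sum_univ_succ, Fin.sum_univ_castSucc (fun p => ψ p (v p).2),
    Finset.sum_add_distrib, Finset.sum_add_distrib]
  ring

theorem NoInteraction.const_mul {D : Set (Fin (n + 1) → X × X)} {F : (Fin (n + 1) → X × X) → ℝ}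
    (h : NoInteraction D F) (k : ℝ) : NoInteraction D fun v => k * F v := by
  obtain ⟨φ, ψ, g, hF⟩ := h
  refine ⟨fun x => k * φ x, fun x => k * ψ x, fun i x y => k * g i x y, fun v hv => ?_⟩
  simp only [hF v hv, mul_add, Finset.mul_sum]

theorem NoInteraction.add {D : Set (Fin (n + 1) → X × X)} {F G : (Fin (n + 1) → X × X) → ℝ}
    (hF : NoInteraction D F) (hG : NoInteraction D G) : NoInteraction D fun v => F v + G v := by
  obtain ⟨φ, ψ, g, hF⟩ := hF
  obtain ⟨φ', ψ', g', hG⟩ := hG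
  refine ⟨fun x => φ x + φ' x, fun x => ψ x + ψ' x, fun i x y => g i x y + g' i x y,
    fun v hv => ?_⟩
  simp only [hF v hv, hG v hv, Finset.sum_add_distrib]
  ring

theorem NoInteraction.comp_map {Y : Type} {D : Set (Fin (n + 1) → X × X)}
    {D' : Set (Fin (n + 1) → Y × Y)} {F : (Fin (n + 1) → X × X) → ℝ} (hF : NoInteraction D F)
    (f : Y → X) (hf : ∀ v ∈ D', (fun p => (f (v p).1, f (v p).2)) ∈ D) :
    NoInteraction D' fun v => F fun p => (f (v p).1, f (v p).2) := by
  obtain ⟨φ, ψ, g, hF⟩ := hF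
  exact ⟨fun y => φ (f y), fun y => ψ (f y), fun i y z => g i (f y) (f z), fun v hv => hF _ (hf v hv)⟩

theorem contDiffOn_localSum [NormedAddCommGroup X] [NormedSpace ℝ X] {U : Set X}
    {D : Set (Fin (n + 1) → X × X)} (hD : ∀ v ∈ D, ∀ p, (v p).1 ∈ U ∧ (v p).2 ∈ U)
    {φ ψ : Fin (n + 1) → X → ℝ} {χ : Fin n → X → X → ℝ} (hφ : ∀ p, ContDiffOn ℝ ∞ (φ p) U)
    (hψ : ∀ p, ContDiffOn ℝ ∞ (ψ p) U)
    (hχ : ∀ i, ContDiffOn ℝ ∞ (fun q : X × X => χ i q.1 q.2) (U ×ˢ U)) :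
    ContDiffOn ℝ ∞ (localSum φ ψ χ) D := by
  have h₁ : ∀ p, ContDiffOn ℝ ∞ (fun v : Fin (n + 1) → X × X => (v p).1) D := fun p => by fun_prop
  have h₂ : ∀ p, ContDiffOn ℝ ∞ (fun v : Fin (n + 1) → X × X => (v p).2) D := fun p => by fun_prop
  refine (ContDiffOn.sum fun p _ => ?_).add (ContDiffOn.sum fun i _ => ?_)
  · exact ((hφ p).comp (h₁ p) fun v hv => (hD v hv p).1).add
      ((hψ p).comp (h₂ p) fun v hv => (hD v hv p).2)
  · exact (hχ i).comp ((h₂ i.castSucc).prodMk (h₁ i.succ)) fun v hv =>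
      ⟨(hD v hv _).2, (hD v hv _).1⟩

end SharpInterfaces

namespace SharpInterfaces

/-! ### The chain of all pieces -/

variable {n : ℕ}

/-- Extensions of the potential and of the displacement of every piece, with common bounds. -/
structure ChainModel (W u : ℝ → ℝ) (t : Fin (n + 2) → ℝ) (W₀ W₁ W₂ : ℝ → ℝ)
    (v₀ v₁ v₂ v₃ : Fin (n + 1) → ℝ → ℝ) (δ K M α : ℝ) : Prop where
  mono : StrictMono t
  agrees : PieceModel.Agrees W W₀ W₁ W₂ δ
  piece : ∀ p, PieceModel W₀ W₁ W₂ (v₀ p) (v₁ p) (v₂ p) (v₃ p) (t p.castSucc) (t p.succ) δ K M α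
  ext : ∀ p, ∃ δ', DisplacementExtension u (v₀ p) (v₁ p) (v₂ p) (v₃ p) (t p.castSucc) (t p.succ) δ'

/-- The smallest `δ` and the largest `M` among the finitely many pieces serve all of them; the
potential is extended only after this `δ` is known, so one extension is shared. -/
theorem exists_chainModel {W u : ℝ → ℝ} {α : ℝ} (hα : 0 ≤ α) (hW : ContDiffOn ℝ ∞ W {0}ᶜ)
    (hd : Decays W α) {t : Fin (n + 2) → ℝ} (ht : StrictMono t)
    (hmono : MonotoneOn u (Set.Icc (t 0) (t (Fin.last (n + 1)))))
    (hu : ∀ p : Fin (n + 1), IsSmoothDiffeoOn u (Set.Icc (t p.castSucc) (t p.succ))) :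
    ∃ W₀ W₁ W₂ v₀ v₁ v₂ v₃ δ K M, ChainModel W u t W₀ W₁ W₂ v₀ v₁ v₂ v₃ δ K M α := by
  have hlt : ∀ p : Fin (n + 1), t p.castSucc < t p.succ := fun p => ht Fin.castSucc_lt_succ
  have hsub : ∀ p : Fin (n + 1), Set.Icc (t p.castSucc) (t p.succ) ⊆
      Set.Icc (t 0) (t (Fin.last (n + 1))) := fun p =>
    Set.Icc_subset_Icc (ht.monotone (Fin.zero_le _)) (ht.monotone (Fin.le_last _))
  choose v₀ v₁ v₂ v₃ δ hext using fun p =>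
    exists_displacementExtension (hlt p) (hu p) (hmono.mono (hsub p))
  choose M hM hbound using fun p => (hext p).exists_bound
  obtain ⟨p₀, hp₀⟩ := Finite.exists_min δ
  obtain ⟨p₁, hp₁⟩ := Finite.exists_max M
  obtain ⟨W₀, W₁, W₂, K, hK, hW₀, hW₁, hW₂, hagree, d₀, d₁, d₂⟩ :=
    exists_potentialExtension hα hW hd (hext p₀).δ_pos
  refine ⟨W₀, W₁, W₂, v₀, v₁, v₂, v₃, δ p₀, K, M p₁, ht, hagree, fun p => ?_,
    fun p => ⟨δ p, hext p⟩⟩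
  exact {
    hW₀ := hW₀
    hW₁ := hW₁
    hW₂ := hW₂
    hu₀ := (hext p).hu₀
    hu₁ := (hext p).hu₁
    hu₂ := (hext p).hu₂
    hu₃ := (hext p).hu₃
    lt := hlt p
    δ_pos := (hext p₀).δ_pos
    K_pos := hK
    M_pos := hM p₁
    lower := fun x hx => (hp₀ p).trans ((hext p).lower x hx)
    upper₁ := fun x hx => (hbound p x hx).1.trans (hp₁ p)
    upper₂ := fun x hx => (hbound p x hx).2.1.trans (hp₁ p)
    upper₃ := fun x hx => (hbound p x hx).2.2.trans (hp₁ p)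
    decay₀ := d₀
    decay₁ := d₁
    decay₂ := d₂ }

/-- The nodes as a sequence, constant from the last one on. -/
def node (t : Fin (n + 2) → ℝ) (k : ℕ) : ℝ := t ⟨min k (n + 1), by omega⟩

theorem node_val (t : Fin (n + 2) → ℝ) (i : Fin (n + 2)) : node t i = t i := by
  rw [node]
  congr 1
  ext
  simp only
  omega

theorem node_castSucc (t : Fin (n + 2) → ℝ) (p : Fin (n + 1)) : node t p = t p.castSucc :=
  node_val t p.castSucc

theorem node_succ (t : Fin (n + 2) → ℝ) (p : Fin (n + 1)) : node t (p + 1) = t p.succ :=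
  node_val t p.succ

theorem node_zero (t : Fin (n + 2) → ℝ) : node t 0 = t 0 := node_val t 0

theorem node_last (t : Fin (n + 2) → ℝ) : node t (n + 1) = t (Fin.last (n + 1)) :=
  node_val t (Fin.last (n + 1))

namespace ChainModel

variable {W u W₀ W₁ W₂ : ℝ → ℝ} {t : Fin (n + 2) → ℝ} {v₀ v₁ v₂ v₃ : Fin (n + 1) → ℝ → ℝ}
  {δ K M α : ℝ}

theorem eq₀ (S : ChainModel W u t W₀ W₁ W₂ v₀ v₁ v₂ v₃ δ K M α) (p : Fin (n + 1)) :
    ∀ x ∈ Set.Icc (t p.castSucc) (t p.succ), u x = v₀ p x := fun x hx => by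
  obtain ⟨δ', h⟩ := S.ext p
  exact (h.eq₀ x hx).symm

theorem deriv_eq (S : ChainModel W u t W₀ W₁ W₂ v₀ v₁ v₂ v₃ δ K M α) (p : Fin (n + 1)) {x : ℝ}
    (hx : x ∈ Set.Ioo (t p.castSucc) (t p.succ)) :
    deriv u x = v₁ p x ∧ iteratedDeriv 2 u x = v₂ p x := by
  obtain ⟨δ', h⟩ := S.ext p
  exact h.deriv_eq hx

theorem left_mem (S : ChainModel W u t W₀ W₁ W₂ v₀ v₁ v₂ v₃ δ K M α) (p : Fin (n + 1)) :
    t p.castSucc ∈ Set.Icc (t p.castSucc) (t p.succ) := ⟨le_rfl, (S.piece p).lt.le⟩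

theorem right_mem (S : ChainModel W u t W₀ W₁ W₂ v₀ v₁ v₂ v₃ δ K M α) (p : Fin (n + 1)) :
    t p.succ ∈ Set.Icc (t p.castSucc) (t p.succ) := ⟨(S.piece p).lt.le, le_rfl⟩

theorem jets_eq (S : ChainModel W u t W₀ W₁ W₂ v₀ v₁ v₂ v₃ δ K M α) (p : Fin (n + 1)) :
    jets t u p = ((v₁ p (t p.castSucc), v₂ p (t p.castSucc)),
      (v₁ p (t p.succ), v₂ p (t p.succ))) := by
  obtain ⟨δ', h⟩ := S.ext p
  rw [jets, SharpInterfaces.piece, h.eq₁ _ (S.left_mem p), h.eq₁ _ (S.right_mem p), h.eq₂ _ (S.left_mem p),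
    h.eq₂ _ (S.right_mem p)]

theorem slopes_eq (S : ChainModel W u t W₀ W₁ W₂ v₀ v₁ v₂ v₃ δ K M α) (p : Fin (n + 1)) :
    slopes t u p = (v₁ p (t p.castSucc), v₁ p (t p.succ)) := by
  obtain ⟨δ', h⟩ := S.ext p
  rw [slopes, SharpInterfaces.piece, h.eq₁ _ (S.left_mem p), h.eq₁ _ (S.right_mem p)]

theorem δ_pos (S : ChainModel W u t W₀ W₁ W₂ v₀ v₁ v₂ v₃ δ K M α) : 0 < δ := (S.piece 0).δ_pos

theorem K_pos (S : ChainModel W u t W₀ W₁ W₂ v₀ v₁ v₂ v₃ δ K M α) : 0 < K := (S.piece 0).K_pos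

theorem node_le (S : ChainModel W u t W₀ W₁ W₂ v₀ v₁ v₂ v₃ δ K M α) (p : ℕ) :
    node t p ≤ node t (p + 1) := by
  unfold node
  apply S.mono.monotone
  rw [Fin.mk_le_mk]
  omega

/-- The function `u x - δ x` is monotone on each piece, and monotonicity glues at the common nodes;
no derivative at a node is needed. -/
theorem increment_ge (S : ChainModel W u t W₀ W₁ W₂ v₀ v₁ v₂ v₃ δ K M α) {x y : ℝ}
    (hx : t 0 ≤ x) (hxy : x ≤ y) (hy : y ≤ t (Fin.last (n + 1))) : δ * (y - x) ≤ u y - u x := by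
  have hp : ∀ p : Fin (n + 1), MonotoneOn (fun z => u z - δ * z)
      (Set.Icc (t p.castSucc) (t p.succ)) := fun p y hy z hz hyz => by
    have := (S.piece p).increment_ge hy.1 hyz hz.2
    simp only
    rw [S.eq₀ p y hy, S.eq₀ p z hz]
    linarith
  have hnode : ∀ k ≤ n + 1, node t 0 ≤ node t k ∧
      MonotoneOn (fun z => u z - δ * z) (Set.Icc (node t 0) (node t k)) := by
    intro k
    induction k with
    | zero => intro _; simp
    | succ k ih =>
      intro hk
      obtain ⟨h0, ih⟩ := ih (by omega)
      have hle := S.node_le k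
      refine ⟨h0.trans hle, ?_⟩
      have hk' := hp ⟨k, by omega⟩
      rw [← node_castSucc t ⟨k, by omega⟩, ← node_succ t ⟨k, by omega⟩] at hk'
      rw [← Set.Icc_union_Icc_eq_Icc h0 hle]
      exact ih.union_right hk' (isGreatest_Icc h0) (isLeast_Icc hle)
  have := (hnode (n + 1) le_rfl).2
  rw [node_zero, node_last] at this
  have := this ⟨hx, hxy.trans hy⟩ ⟨hx.trans hxy, hy⟩ hxy
  simp only at this
  linarith

theorem le_strain (S : ChainModel W u t W₀ W₁ W₂ v₀ v₁ v₂ v₃ δ K M α) {c ε l : ℝ} (hε : 0 < ε)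
    (hl : 0 ≤ l) {i j : ℤ} (hi : i ∈ atoms (t 0) (t (Fin.last (n + 1))) c ε)
    (hj : j ∈ atoms (t 0) (t (Fin.last (n + 1))) c ε) (hij : l ≤ ε * (c + j) - ε * (c + i)) :
    δ * (l / ε) ≤ (u (ε * (c + j)) - u (ε * (c + i))) / ε := by
  rw [mem_atoms hε] at hi hj
  have h := S.increment_ge hi.1 (by linarith) hj.2
  have := S.δ_pos
  rw [← mul_div_assoc]
  gcongr
  exact (mul_le_mul_of_nonneg_left hij this.le).trans h

/-- Distinct atoms are at least `ε` apart, so their strain is at least `δ`, where `W₀` agrees with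
`W`. -/
theorem bond_eq (S : ChainModel W u t W₀ W₁ W₂ v₀ v₁ v₂ v₃ δ K M α) {c ε : ℝ} (hε : 0 < ε)
    {i j : ℤ} (hi : i ∈ atoms (t 0) (t (Fin.last (n + 1))) c ε)
    (hj : j ∈ atoms (t 0) (t (Fin.last (n + 1))) c ε) (hij : i < j) :
    bond W u c ε i j = bond W₀ u c ε i j := by
  have h1 : (i : ℝ) + 1 ≤ j := by exact_mod_cast hij
  have h := S.le_strain hε hε.le hi hj (by nlinarith)
  rw [div_self hε.ne', mul_one] at h
  rw [bond, bond, (S.agrees _ h).1]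

theorem abs_bond_le (S : ChainModel W u t W₀ W₁ W₂ v₀ v₁ v₂ v₃ δ K M α) {c ε l : ℝ} (hε : 0 < ε)
    (hl : ε ≤ l) {i j : ℤ} (hi : i ∈ atoms (t 0) (t (Fin.last (n + 1))) c ε)
    (hj : j ∈ atoms (t 0) (t (Fin.last (n + 1))) c ε) (hij : l ≤ ε * (c + j) - ε * (c + i)) :
    |bond W u c ε i j| ≤ K * l ^ (-α) * ε ^ α := by
  have h := S.le_strain hε (hε.le.trans hl) hi hj hij
  have hl' : 1 ≤ l / ε := (one_le_div hε).2 hl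
  have hδ := S.δ_pos
  have hge : δ ≤ (u (ε * (c + j)) - u (ε * (c + i))) / ε := le_trans (by nlinarith) h
  rw [bond, ← (S.agrees _ hge).1]
  refine ((S.piece 0).decay₀ _ hl' _ h).trans (le_of_eq ?_)
  rw [Real.div_rpow (hε.le.trans hl) hε.le, Real.rpow_neg hε.le, div_inv_eq_mul, mul_assoc]

theorem atoms_subset_chain (S : ChainModel W u t W₀ W₁ W₂ v₀ v₁ v₂ v₃ δ K M α) {c ε : ℝ}
    (hε : 0 < ε) (p : Fin (n + 1)) :
    atoms (t p.castSucc) (t p.succ) c ε ⊆ atoms (t 0) (t (Fin.last (n + 1))) c ε :=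
  atoms_subset hε (S.mono.monotone (Fin.zero_le _)) (S.mono.monotone (Fin.le_last _))

theorem exists_length (S : ChainModel W u t W₀ W₁ W₂ v₀ v₁ v₂ v₃ δ K M α) :
    ∃ l > 0, ∀ p : Fin (n + 1), l ≤ t p.succ - t p.castSucc := by
  obtain ⟨p, hp⟩ := Finite.exists_min fun p : Fin (n + 1) => t p.succ - t p.castSucc
  exact ⟨_, sub_pos.2 (S.piece p).lt, hp⟩

/-! ### Densities -/

theorem continuousOn_series {f : ℕ → ℝ → ℝ} {b : ℕ → ℝ} {s : Set ℝ} (hf : ∀ d, Continuous (f d))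
    (hb : Summable b) (hfb : ∀ d, ∀ z ∈ s, |f d z| ≤ b d) :
    ContinuousOn (fun z => ∑' d, f d z) s :=
  continuousOn_tsum (fun d => (hf d).continuousOn) hb hfb

theorem cauchyBorn_eq (S : ChainModel W u t W₀ W₁ W₂ v₀ v₁ v₂ v₃ δ K M α) (p : Fin (n + 1)) {x : ℝ}
    (hx : x ∈ Set.Ioo (t p.castSucc) (t p.succ)) (d : ℕ) :
    W (deriv u x * (d + 1)) = W₀ (((d : ℝ) + 1) * v₁ p x) := by
  rw [(S.deriv_eq p hx).1, mul_comm, (S.agrees _ ((S.piece p).le_mul_slope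
    (PieceModel.one_le_cast d) (Set.Ioo_subset_Icc_self hx))).1]

theorem gradientDensity_eq (S : ChainModel W u t W₀ W₁ W₂ v₀ v₁ v₂ v₃ δ K M α) (p : Fin (n + 1))
    {x : ℝ} (hx : x ∈ Set.Ioo (t p.castSucc) (t p.succ)) (d : ℕ) :
    iteratedDeriv 2 W (deriv u x * (d + 1)) * iteratedDeriv 2 u x ^ 2 * ((d : ℝ) + 1) ^ 4 =
      W₂ (((d : ℝ) + 1) * v₁ p x) * v₂ p x ^ 2 * ((d : ℝ) + 1) ^ 4 := by
  rw [(S.deriv_eq p hx).1, (S.deriv_eq p hx).2, mul_comm (v₁ p x),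
    (S.agrees _ ((S.piece p).le_mul_slope
    (PieceModel.one_le_cast d) (Set.Ioo_subset_Icc_self hx))).2.2]

theorem summable_densities (S : ChainModel W u t W₀ W₁ W₂ v₀ v₁ v₂ v₃ δ K M α) (hα : 3 < α)
    (p : Fin (n + 1)) {x : ℝ} (hx : x ∈ Set.Ioo (t p.castSucc) (t p.succ)) :
    Summable (fun j : ℕ => W (deriv u x * (j + 1))) ∧
      Summable (fun j : ℕ => iteratedDeriv 2 W (deriv u x * (j + 1)) *
        iteratedDeriv 2 u x ^ 2 * ((j : ℝ) + 1) ^ 4) := by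
  have hx' := Set.Ioo_subset_Icc_self hx
  constructor
  · simp_rw [S.cauchyBorn_eq p hx]
    exact Summable.of_norm_bounded ((summable_rpow_of_lt (s := -α) (by linarith)).mul_left K)
      fun d => (S.piece p).abs_energyDensity_le (PieceModel.one_le_cast d) hx'
  · simp_rw [S.gradientDensity_eq p hx]
    exact PieceModel.summable_of_le_sq hα _
      fun d => (S.piece p).abs_gradient_le (PieceModel.one_le_cast d) hx'

/-- The densities use `deriv u`, which need not be the one-sided derivative at a node; the nodes are
a null set. -/
theorem ae_eq_of_eqOn_Ioo {f g : ℝ → ℝ} {r s : ℝ} (hrs : r ≤ s)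
    (h : ∀ x ∈ Set.Ioo r s, f x = g x) :
    f =ᵐ[MeasureTheory.volume.restrict (Set.uIoc r s)] g := by
  rw [Set.uIoc_of_le hrs, ← MeasureTheory.restrict_Ioo_eq_restrict_Ioc]
  exact (MeasureTheory.ae_restrict_iff' measurableSet_Ioo).2 (.of_forall h)

theorem integral_eq_of_eqOn_Ioo {f g : ℝ → ℝ} {r s : ℝ} (hrs : r ≤ s)
    (h : ∀ x ∈ Set.Ioo r s, f x = g x) : ∫ x in r..s, f x = ∫ x in r..s, g x :=
  intervalIntegral.integral_congr_ae_restrict (ae_eq_of_eqOn_Ioo hrs h)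

theorem integral_cauchyBorn (S : ChainModel W u t W₀ W₁ W₂ v₀ v₁ v₂ v₃ δ K M α) (p : Fin (n + 1)) :
    ∫ x in (t p.castSucc)..(t p.succ), cauchyBorn W u x =
      ∫ x in (t p.castSucc)..(t p.succ), ∑' d : ℕ, W₀ (((d : ℝ) + 1) * v₁ p x) :=
  integral_eq_of_eqOn_Ioo (S.piece p).lt.le fun _ hx => tsum_congr (S.cauchyBorn_eq p hx)

theorem integral_gradientDensity (S : ChainModel W u t W₀ W₁ W₂ v₀ v₁ v₂ v₃ δ K M α)
    (p : Fin (n + 1)) : ∫ x in (t p.castSucc)..(t p.succ), gradientDensity W u x =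
      ∫ x in (t p.castSucc)..(t p.succ),
        ∑' d : ℕ, W₂ (((d : ℝ) + 1) * v₁ p x) * v₂ p x ^ 2 * ((d : ℝ) + 1) ^ 4 :=
  integral_eq_of_eqOn_Ioo (S.piece p).lt.le fun _ hx => tsum_congr (S.gradientDensity_eq p hx)

theorem intervalIntegrable_cauchyBorn_piece (S : ChainModel W u t W₀ W₁ W₂ v₀ v₁ v₂ v₃ δ K M α)
    (hα : 3 < α) (p : Fin (n + 1)) :
    IntervalIntegrable (cauchyBorn W u) MeasureTheory.volume (t p.castSucc) (t p.succ) := by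
  have hc : ContinuousOn (fun x => ∑' d : ℕ, W₀ (((d : ℝ) + 1) * v₁ p x))
      (Set.Icc (t p.castSucc) (t p.succ)) :=
    continuousOn_series (fun d => (S.piece p).continuous_energyDensity _)
      ((summable_rpow_of_lt (s := -α) (by linarith)).mul_left K)
      fun d z hz => (S.piece p).abs_energyDensity_le (PieceModel.one_le_cast d) hz
  refine (hc.intervalIntegrable_of_Icc (S.piece p).lt.le).congr_ae ?_
  exact (ae_eq_of_eqOn_Ioo (S.piece p).lt.le fun _ hx => tsum_congr (S.cauchyBorn_eq p hx)).symm

theorem intervalIntegrable_gradientDensity_piece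
    (S : ChainModel W u t W₀ W₁ W₂ v₀ v₁ v₂ v₃ δ K M α) (hα : 3 < α) (p : Fin (n + 1)) :
    IntervalIntegrable (gradientDensity W u) MeasureTheory.volume (t p.castSucc) (t p.succ) := by
  have hc : ContinuousOn (fun x => ∑' d : ℕ, W₂ (((d : ℝ) + 1) * v₁ p x) * v₂ p x ^ 2 *
      ((d : ℝ) + 1) ^ 4) (Set.Icc (t p.castSucc) (t p.succ)) :=
    continuousOn_series (fun d => (S.piece p).continuous_gradient _)
      ((summable_rpow_of_lt (s := 2 - α) (by linarith)).mul_left (K * M ^ 2))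
      fun d z hz => by
        rw [← PieceModel.sq_mul_rpow (PieceModel.one_le_cast d)]
        exact (S.piece p).abs_gradient_le (PieceModel.one_le_cast d) hz
  refine (hc.intervalIntegrable_of_Icc (S.piece p).lt.le).congr_ae ?_
  exact (ae_eq_of_eqOn_Ioo (S.piece p).lt.le fun _ hx => tsum_congr (S.gradientDensity_eq p hx)).symm

end ChainModel

theorem intervalIntegrable_of_pieces {f : ℝ → ℝ} {t : Fin (n + 2) → ℝ}
    (h : ∀ p : Fin (n + 1), IntervalIntegrable f MeasureTheory.volume (t p.castSucc) (t p.succ)) :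
    IntervalIntegrable f MeasureTheory.volume (t 0) (t (Fin.last (n + 1))) := by
  rw [← node_zero t, ← node_last t]
  refine IntervalIntegrable.trans_iterate fun k hk => ?_
  have := h ⟨k, hk⟩
  rwa [← node_castSucc t ⟨k, hk⟩, ← node_succ t ⟨k, hk⟩] at this

theorem integral_eq_sum_pieces {f : ℝ → ℝ} {t : Fin (n + 2) → ℝ}
    (h : ∀ p : Fin (n + 1), IntervalIntegrable f MeasureTheory.volume (t p.castSucc) (t p.succ)) :
    ∫ x in (t 0)..(t (Fin.last (n + 1))), f x =
      ∑ p : Fin (n + 1), ∫ x in (t p.castSucc)..(t p.succ), f x := by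
  rw [← node_zero t, ← node_last t, ← intervalIntegral.sum_integral_adjacent_intervals fun k hk => ?_,
    Finset.sum_range]
  · simp_rw [node_castSucc, node_succ]
  · have := h ⟨k, hk⟩
    rwa [← node_castSucc t ⟨k, hk⟩, ← node_succ t ⟨k, hk⟩] at this

end SharpInterfaces

namespace SharpInterfaces

variable {n : ℕ}

/-! ### The universal boundary terms -/

/-- The interaction terms of order zero in the lattice spacing of the pair sum. -/
noncomputable def slopeTerm (W : ℝ → ℝ) (a₁ b₁ : Fin (n + 1) → ℝ) : (Fin (n + 1) → ℝ × ℝ) → ℝ :=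
  localSum (fun p => edgeEnergy W (a₁ p)) (fun p => edgeEnergy W (b₁ p))
    fun i x y => crossEnergy W (1 - b₁ i.castSucc) (1 - a₁ i.succ) (x, y)

/-- The interaction terms of order one in the lattice spacing of the pair sum. -/
noncomputable def jetTerm (W : ℝ → ℝ) (a₁ a₂ b₁ b₂ : Fin (n + 1) → ℝ) :
    (Fin (n + 1) → (ℝ × ℝ) × (ℝ × ℝ)) → ℝ :=
  localSum (fun p x => edgeCorrection W (a₁ p) (a₂ p) x.1 x.2)
    (fun p x => edgeCorrection W (b₁ p) (b₂ p) x.1 (-x.2))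
    fun i x y => crossCorrection W (1 - b₁ i.castSucc) (-b₂ i.castSucc) (1 - a₁ i.succ)
      (-a₂ i.succ) (x.1, y.1) (x.2, y.2)

/-- At every interface, the extreme atoms of the adjacent pieces are the ones of a lattice. -/
def Admissible (a₁ b₁ : Fin (n + 1) → ℝ) : Prop :=
  ∀ i : Fin n, 0 ≤ 1 - b₁ i.castSucc ∧ 0 ≤ 1 - a₁ i.succ ∧
    1 ≤ (1 - a₁ i.succ) + (1 - b₁ i.castSucc)

theorem contDiffOn_slopeTerm {W : ℝ → ℝ} {α : ℝ} (hα : 3 < α) (hW : ContDiffOn ℝ ∞ W {0}ᶜ)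
    (hd : Decays W α) {a₁ b₁ : Fin (n + 1) → ℝ} (h : Admissible a₁ b₁) :
    ContDiffOn ℝ ∞ (slopeTerm W a₁ b₁) (slopeDomain n) :=
  contDiffOn_localSum (U := Set.Ioi 0) (D := slopeDomain n) (fun _ hv p => hv p)
    (fun _ => contDiffOn_edgeEnergy hα hW hd _) (fun _ => contDiffOn_edgeEnergy hα hW hd _)
    fun i => contDiffOn_crossEnergy hα hW hd (h i).1 (h i).2.1 (h i).2.2

theorem contDiffOn_jetTerm {W : ℝ → ℝ} {α : ℝ} (hα : 3 < α) (hW : ContDiffOn ℝ ∞ W {0}ᶜ)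
    (hd : Decays W α) {a₁ b₁ : Fin (n + 1) → ℝ} (a₂ b₂ : Fin (n + 1) → ℝ) (h : Admissible a₁ b₁) :
    ContDiffOn ℝ ∞ (jetTerm W a₁ a₂ b₁ b₂) (jetDomain n) := by
  refine contDiffOn_localSum (U := {q : ℝ × ℝ | 0 < q.1}) (D := jetDomain n)
    (fun _ hv p => hv p)
    (fun _ => contDiffOn_edgeCorrection hα hW hd _ _) (fun p => ?_)
    fun i => contDiffOn_crossCorrection hα hW hd (h i).1 (h i).2.1 (h i).2.2 _ _
  exact (contDiffOn_edgeCorrection hα hW hd (b₁ p) (b₂ p)).comp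
    (f := fun x : ℝ × ℝ => (x.1, -x.2)) (by fun_prop) fun x hx => hx

/-! ### Numbers of atoms -/

theorem card_atoms_eq (r s c ε : ℝ) :
    (atoms r s c ε).card = (lastIdx s c ε + 1 - firstIdx r c ε).toNat := by
  rw [atoms, Int.card_Icc]

theorem card_atoms_cast {r s c ε : ℝ} (hε : 0 < ε) (h : r ≤ s) :
    ((atoms r s c ε).card : ℝ) = ((lastIdx s c ε - firstIdx r c ε + 1 : ℤ) : ℝ) := by
  rw [card_atoms_eq, count_cast hε h]
  push_cast
  ring

theorem LatticeExpansion.tendsto_card {r s c : ℝ} {ε : ℕ → ℝ} {a₁ a₂ b₁ b₂ c₁ c₂ : ℝ}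
    (h : LatticeExpansion r s c ε a₁ a₂ b₁ b₂ c₁ c₂) (hε : ∀ m, 0 < ε m)
    (hlim : Tendsto ε atTop (𝓝 0)) (hrs : r ≤ s) :
    Tendsto (fun m => ((atoms r s c (ε m)).card : ℝ) * ε m) atTop (𝓝 (s - r)) := by
  simp_rw [card_atoms_eq]
  exact (h.atomSeq hε hlim hrs).tendsto_count

/-- The first order coefficient of the number of atoms is determined by the extreme atoms. -/
theorem LatticeExpansion.count_coefficient {r s c : ℝ} {ε : ℕ → ℝ} {a₁ a₂ b₁ b₂ c₁ c₂ : ℝ}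
    (h : LatticeExpansion r s c ε a₁ a₂ b₁ b₂ c₁ c₂) (hε : ∀ m, 0 < ε m)
    (hlim : Tendsto ε atTop (𝓝 0)) (hrs : r < s) : c₁ = (a₁ + b₁ - 1) / (s - r) ^ 2 := by
  have hL : s - r ≠ 0 := (sub_pos.2 hrs).ne'
  have hN := h.tendsto_card hε hlim hrs.le
  have h₁ := (tendsto_of_isLittleO_expansion hε hlim h.left).1
  have h₂ := (tendsto_of_isLittleO_expansion hε hlim h.right).1
  have hc : Tendsto (fun m => (1 / (((lastIdx s c (ε m) - firstIdx r c (ε m) + 1 : ℤ) : ℝ) * ε m)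
      - 1 / (s - r)) / ε m) atTop (𝓝 c₁) :=
    (tendsto_of_isLittleO_expansion (a₂ := c₂) hε hlim (X := fun m =>
      1 / (((lastIdx s c (ε m) - firstIdx r c (ε m) + 1 : ℤ) : ℝ) * ε m) - 1 / (s - r))
      (h.count.congr_left fun m => by ring)).1
  refine tendsto_nhds_unique hc ?_
  -- `N` atoms span `N - 1` spacings, so `s - r - N ε` is the sum of the two end distances minus
  -- `ε`. Division by `N ε (s - r)` gives `1 / (N ε) - 1 / (s - r)`.
  have := ((h₁.add h₂).sub_const 1).div (hN.mul_const (s - r)) (mul_ne_zero hL hL)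
  rw [← sq] at this
  refine this.congr' ?_
  filter_upwards [hN.eventually_ne hL] with m hm
  have hε0 := (hε m).ne'
  simp only [Pi.div_apply]
  rw [card_atoms_cast (hε m) hrs.le] at hm ⊢
  have hm' := left_ne_zero_of_mul hm
  field_simp
  push_cast
  ring

theorem LatticeExpansion.left_unique {r s s' c : ℝ} {ε : ℕ → ℝ}
    {a₁ a₂ b₁ b₂ c₁ c₂ a₁' a₂' b₁' b₂' c₁' c₂' : ℝ}
    (h : LatticeExpansion r s c ε a₁ a₂ b₁ b₂ c₁ c₂)
    (h' : LatticeExpansion r s' c ε a₁' a₂' b₁' b₂' c₁' c₂') (hε : ∀ m, 0 < ε m)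
    (hlim : Tendsto ε atTop (𝓝 0)) : a₁ = a₁' :=
  tendsto_nhds_unique (tendsto_of_isLittleO_expansion hε hlim h.left).1
    (tendsto_of_isLittleO_expansion hε hlim h'.left).1

theorem LatticeExpansion.right_unique {r r' s c : ℝ} {ε : ℕ → ℝ}
    {a₁ a₂ b₁ b₂ c₁ c₂ a₁' a₂' b₁' b₂' c₁' c₂' : ℝ}
    (h : LatticeExpansion r s c ε a₁ a₂ b₁ b₂ c₁ c₂)
    (h' : LatticeExpansion r' s c ε a₁' a₂' b₁' b₂' c₁' c₂') (hε : ∀ m, 0 < ε m)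
    (hlim : Tendsto ε atTop (𝓝 0)) : b₁ = b₁' :=
  tendsto_nhds_unique (tendsto_of_isLittleO_expansion hε hlim h.right).1
    (tendsto_of_isLittleO_expansion hε hlim h'.right).1

theorem tendsto_rpow_nhds_zero {ε : ℕ → ℝ} {β : ℝ} (hβ : 0 < β) (hlim : Tendsto ε atTop (𝓝 0)) :
    Tendsto (fun m => ε m ^ β) atTop (𝓝 0) := by
  have := hlim.rpow_const (p := β) (Or.inr hβ.le)
  rwa [Real.zero_rpow hβ.ne'] at this

theorem isLittleO_rpow_sq {ε : ℕ → ℝ} {β : ℝ} (hβ : 2 < β) (hε : ∀ m, 0 < ε m)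
    (hlim : Tendsto ε atTop (𝓝 0)) : (fun m => ε m ^ β) =o[atTop] fun m => ε m ^ 2 := by
  refine (isLittleO_iff_tendsto fun m h => absurd h (pow_ne_zero 2 (hε m).ne')).2
    ((tendsto_rpow_nhds_zero (sub_pos.2 hβ) hlim).congr fun m => ?_)
  rw [Real.rpow_sub (hε m), Real.rpow_two]

/-- The product of the expansions of a sum and of the inverse number of its terms. -/
theorem isLittleO_mul_expansion {ε P N : ℕ → ℝ} {L I B₀ B₁ C₁ C₂ : ℝ} (hε : ∀ m, 0 < ε m)
    (hlim : Tendsto ε atTop (𝓝 0))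
    (hP : Tendsto (fun m => (P m - I / ε m - B₀) / ε m) atTop (𝓝 B₁))
    (hN : (fun m => 1 / (N m * ε m) - (1 / L + C₁ * ε m + C₂ * ε m ^ 2)) =o[atTop]
      fun m => ε m ^ 2) :
    (fun m => 1 / N m * P m - (1 / L * I + ε m * (C₁ * I + B₀ / L)
      + ε m ^ 2 * (C₂ * I + C₁ * B₀ + B₁ / L))) =o[atTop] fun m => ε m ^ 2 := by
  refine (isLittleO_iff_tendsto fun m h => absurd h (pow_ne_zero 2 (hε m).ne')).2 ?_
  have hρ := hN.tendsto_div_nhds_zero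
  -- With `P / N = (1 / (N ε)) (ε P)`, the error over `ε²` has three parts: the remainder of the
  -- count times `ε P`, the remainder of `P` over `L`, and the products of order three or more.
  have h := ((hρ.mul (((hlim.const_mul B₀).const_add I).add
    ((hlim.pow 2).mul hP))).add (((hP.sub_const B₁).const_mul (1 / L)))).add
    ((hlim.const_mul (C₂ * B₀)).add (hP.mul ((hlim.const_mul C₁).add ((hlim.pow 2).const_mul C₂))))
  have e : 0 * (I + B₀ * 0 + 0 ^ 2 * B₁) + 1 / L * (B₁ - B₁)
    + (C₂ * B₀ * 0 + B₁ * (C₁ * 0 + C₂ * 0 ^ 2)) = (0 : ℝ) := by ring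
  rw [e] at h
  refine h.congr fun m => ?_
  have h0 := (hε m).ne'
  have e₁ : 1 / N m = (1 / (N m * ε m)) * ε m := by
    rw [one_div, one_div, mul_inv, mul_assoc, inv_mul_cancel₀ h0, mul_one]
  rw [e₁]
  generalize 1 / (N m * ε m) = q
  rw [eq_div_iff (pow_ne_zero 2 h0)]
  field_simp
  ring

namespace ChainModel

variable {W u W₀ W₁ W₂ : ℝ → ℝ} {t : Fin (n + 2) → ℝ} {v₀ v₁ v₂ v₃ : Fin (n + 1) → ℝ → ℝ}
  {δ K M α c : ℝ} {ε : ℕ → ℝ} {a₁ a₂ b₁ b₂ c₁ c₂ : Fin (n + 1) → ℝ}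

theorem pairSum_piece_eq (S : ChainModel W u t W₀ W₁ W₂ v₀ v₁ v₂ v₃ δ K M α) {e : ℝ} (he : 0 < e)
    (p : Fin (n + 1)) :
    pairSum (bond W u c e) (atoms (t p.castSucc) (t p.succ) c e) =
      ∑' d, bondSum W₀ (v₀ p) e (e * (c + firstIdx (t p.castSucc) c e))
        (lastIdx (t p.succ) c e + 1 - firstIdx (t p.castSucc) c e).toNat d := by
  rw [← pairSum_eq_tsum_bondSum he (S.eq₀ p)]
  refine Finset.sum_congr rfl fun i hi => Finset.sum_congr rfl fun j hj => ?_
  rw [Finset.mem_filter] at hj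
  exact S.bond_eq he (S.atoms_subset_chain he p hi) (S.atoms_subset_chain he p hj.1) hj.2

theorem adjacentSum_eq (S : ChainModel W u t W₀ W₁ W₂ v₀ v₁ v₂ v₃ δ K M α) {e : ℝ} (he : 0 < e)
    (i : Fin n) :
    adjacentSum (bond W u c e) (t i.castSucc.castSucc) (t i.castSucc.succ) (t i.succ.succ) c e =
      adjacentSum (bond W₀ u c e) (t i.castSucc.castSucc) (t i.castSucc.succ) (t i.succ.succ)
        c e := by
  refine Finset.sum_congr rfl fun k hk => Finset.sum_congr rfl fun j hj => ?_
  rw [Finset.mem_sdiff] at hk hj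
  refine S.bond_eq he (S.atoms_subset_chain he _ hk.1) (S.atoms_subset_chain he i.succ hj.1) ?_
  refine lt_of_le_of_ne (le_of_mem_atoms he hk.1 hj.1) ?_
  rintro rfl
  exact hj.2 hk.1

theorem tendsto_pairSum_piece (S : ChainModel W u t W₀ W₁ W₂ v₀ v₁ v₂ v₃ δ K M α) (hα : 3 < α)
    (hε : ∀ m, 0 < ε m) (hlim : Tendsto ε atTop (𝓝 0)) (p : Fin (n + 1))
    (h : LatticeExpansion (t p.castSucc) (t p.succ) c ε
      (a₁ p) (a₂ p) (b₁ p) (b₂ p) (c₁ p) (c₂ p)) :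
    Tendsto (fun m => (pairSum (bond W u c (ε m)) (atoms (t p.castSucc) (t p.succ) c (ε m))
      - (∫ x in (t p.castSucc)..(t p.succ), cauchyBorn W u x) / ε m
      - (edgeEnergy W (a₁ p) (slopes t u p).1 + edgeEnergy W (b₁ p) (slopes t u p).2)) / ε m) atTop
      (𝓝 (-(1 / 24) * (∫ x in (t p.castSucc)..(t p.succ), gradientDensity W u x)
        + (edgeCorrection W (a₁ p) (a₂ p) (jets t u p).1.1 (jets t u p).1.2
        + edgeCorrection W (b₁ p) (b₂ p) (jets t u p).2.1 (-(jets t u p).2.2)))) := by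
  have := (S.piece p).tendsto_pieceEnergy S.agrees (h.atomSeq hε hlim (S.piece p).lt.le) hα
  rw [S.integral_cauchyBorn, S.integral_gradientDensity, S.slopes_eq, S.jets_eq]
  exact this.congr fun m => by rw [S.pairSum_piece_eq (hε m)]

theorem interfaceSeq (S : ChainModel W u t W₀ W₁ W₂ v₀ v₁ v₂ v₃ δ K M α)
    (hε : ∀ m, 0 < ε m) (hlim : Tendsto ε atTop (𝓝 0))
    (h : ∀ p : Fin (n + 1), LatticeExpansion (t p.castSucc) (t p.succ) c ε
      (a₁ p) (a₂ p) (b₁ p) (b₂ p) (c₁ p) (c₂ p)) (i : Fin n) :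
    InterfaceSeq (t i.castSucc.castSucc) (t i.castSucc.succ) (t i.succ.succ) ε
      (fun m => ε m * (c + (lastIdx (t i.castSucc.succ) c (ε m) + 1 : ℤ)))
      (fun m => ε m * (c + (firstIdx (t i.castSucc.succ) c (ε m) - 1 : ℤ)))
      (fun m => (firstIdx (t i.castSucc.succ) c (ε m) - 1 + 1
        - firstIdx (t i.castSucc.castSucc) c (ε m)).toNat)
      (fun m => (lastIdx (t i.succ.succ) c (ε m) + 1
        - (lastIdx (t i.castSucc.succ) c (ε m) + 1)).toNat)
      (1 - b₁ i.castSucc) (-b₂ i.castSucc) (1 - a₁ i.succ) (-a₂ i.succ) :=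
  (h i.castSucc).interfaceSeq (h i.succ) hε hlim (S.piece i.castSucc).lt (S.piece i.succ).lt

theorem admissible (S : ChainModel W u t W₀ W₁ W₂ v₀ v₁ v₂ v₃ δ K M α)
    (hε : ∀ m, 0 < ε m) (hlim : Tendsto ε atTop (𝓝 0))
    (h : ∀ p : Fin (n + 1), LatticeExpansion (t p.castSucc) (t p.succ) c ε
      (a₁ p) (a₂ p) (b₁ p) (b₂ p) (c₁ p) (c₂ p)) : Admissible a₁ b₁ := fun i =>
  have I := S.interfaceSeq hε hlim h i
  ⟨I.nonneg_right, I.nonneg_left, I.one_le⟩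

theorem tendsto_adjacentSum (S : ChainModel W u t W₀ W₁ W₂ v₀ v₁ v₂ v₃ δ K M α) (hα : 3 < α)
    (hε : ∀ m, 0 < ε m) (hlim : Tendsto ε atTop (𝓝 0))
    (h : ∀ p : Fin (n + 1), LatticeExpansion (t p.castSucc) (t p.succ) c ε
      (a₁ p) (a₂ p) (b₁ p) (b₂ p) (c₁ p) (c₂ p)) (i : Fin n) :
    Tendsto (fun m => (adjacentSum (bond W u c (ε m)) (t i.castSucc.castSucc) (t i.castSucc.succ)
        (t i.succ.succ) c (ε m)
      - crossEnergy W (1 - b₁ i.castSucc) (1 - a₁ i.succ)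
        ((slopes t u i.castSucc).2, (slopes t u i.succ).1)) / ε m) atTop
      (𝓝 (crossCorrection W (1 - b₁ i.castSucc) (-b₂ i.castSucc) (1 - a₁ i.succ) (-a₂ i.succ)
        ((jets t u i.castSucc).2.1, (jets t u i.succ).1.1)
        ((jets t u i.castSucc).2.2, (jets t u i.succ).1.2))) := by
  have htt : v₀ i.castSucc (t i.castSucc.succ) = v₀ i.succ (t i.castSucc.succ) := by
    exact (S.eq₀ i.castSucc _ (S.right_mem _)).symm.trans (S.eq₀ i.succ _ (S.left_mem i.succ))
  have := (S.interfaceSeq hε hlim h i).tendsto_crossSum (S.piece i.castSucc) (S.piece i.succ)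
    hα S.agrees htt
  rw [S.slopes_eq, S.slopes_eq, S.jets_eq, S.jets_eq]
  refine this.congr fun m => ?_
  rw [S.adjacentSum_eq (hε m), adjacentSum_eq_crossSum (hε m) (S.piece i.castSucc).lt.le
    (S.piece i.succ).lt.le (S.eq₀ i.castSucc) (S.eq₀ i.succ)]
  rfl

/-- The expansion of the sum over all pairs of atoms. -/
theorem tendsto_pairSum (S : ChainModel W u t W₀ W₁ W₂ v₀ v₁ v₂ v₃ δ K M α) (hα : 3 < α)
    (hε : ∀ m, 0 < ε m) (hlim : Tendsto ε atTop (𝓝 0))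
    (h : ∀ p : Fin (n + 1), LatticeExpansion (t p.castSucc) (t p.succ) c ε
      (a₁ p) (a₂ p) (b₁ p) (b₂ p) (c₁ p) (c₂ p))
    (hN : Tendsto (fun m => ((atoms (t 0) (t (Fin.last (n + 1))) c (ε m)).card : ℝ) * ε m) atTop
      (𝓝 (t (Fin.last (n + 1)) - t 0))) :
    Tendsto (fun m => (pairSum (bond W u c (ε m)) (atoms (t 0) (t (Fin.last (n + 1))) c (ε m))
      - (∫ x in (t 0)..(t (Fin.last (n + 1))), cauchyBorn W u x) / ε m
      - slopeTerm W a₁ b₁ (slopes t u)) / ε m) atTop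
      (𝓝 (-(1 / 24) * (∫ x in (t 0)..(t (Fin.last (n + 1))), gradientDensity W u x)
        + jetTerm W a₁ a₂ b₁ b₂ (jets t u))) := by
  obtain ⟨l, hl, hlen⟩ := S.exists_length
  have hK := S.K_pos
  -- The bonds longer than a piece sum to at most `n N² K l^(-α) ε^α`. Divided by `ε` this is a
  -- constant times `(N ε)² ε^(α - 3)`, which tends to `0`.
  have hfar : Tendsto (fun m =>
      (pairSum (bond W u c (ε m)) (atoms (t 0) (t (Fin.last (n + 1))) c (ε m))
      - ∑ p : Fin (n + 1), pairSum (bond W u c (ε m)) (atoms (t p.castSucc) (t p.succ) c (ε m))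
      - ∑ i : Fin n, adjacentSum (bond W u c (ε m)) (t i.castSucc.castSucc) (t i.castSucc.succ)
        (t i.succ.succ) c (ε m)) / ε m) atTop (𝓝 0) := by
    have hb := ((hN.pow 2).mul (tendsto_rpow_nhds_zero (sub_pos.2 hα) hlim)).const_mul
      (n * (K * l ^ (-α)))
    rw [mul_zero, mul_zero] at hb
    refine squeeze_zero_norm' ?_ hb
    filter_upwards [hlim.eventually (ge_mem_nhds hl)] with m hm
    have he := hε m
    have key := abs_pairSum_sub_le (f := bond W u c (ε m)) (T := node t) (n := n) (c := c) (l := l)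
      (w := K * l ^ (-α) * ε m ^ α) (U := atoms (t 0) (t (Fin.last (n + 1))) c (ε m)) he
      (fun p _ => S.node_le p)
      (fun p hp => by
        rw [node_castSucc t ⟨p, hp⟩, node_succ t ⟨p, hp⟩]
        exact hlen _)
      (by positivity)
      (fun p hp => by
        rw [node_castSucc t ⟨p, by omega⟩, node_succ t ⟨p, by omega⟩]
        exact S.atoms_subset_chain he _)
      (fun i hi j hj hij => S.abs_bond_le he hm hi hj hij)
    rw [Finset.sum_range, Finset.sum_range, node_zero, node_last] at key
    have e₁ : ∀ p : Fin (n + 1), node t p = t p.castSucc := node_castSucc t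
    have e₂ : ∀ p : Fin (n + 1), node t (p + 1) = t p.succ := node_succ t
    have e₃ : ∀ i : Fin n, node t i = t i.castSucc.castSucc := fun i => node_castSucc t i.castSucc
    have e₄ : ∀ i : Fin n, node t (i + 1) = t i.castSucc.succ := fun i => node_succ t i.castSucc
    have e₅ : ∀ i : Fin n, node t (i + 2) = t i.succ.succ := fun i => node_succ t i.succ
    simp_rw [e₁, e₂, e₃, e₄, e₅] at key
    rw [Real.norm_eq_abs, abs_div, abs_of_pos he, div_le_iff₀ he]
    refine key.trans (le_of_eq ?_)
    rw [Real.rpow_sub he, show (3 : ℝ) = ((3 : ℕ) : ℝ) by norm_num, Real.rpow_natCast]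
    have h0 := he.ne'
    field_simp
  have hpieces := tendsto_finsetSum Finset.univ fun (p : Fin (n + 1)) _ =>
    S.tendsto_pairSum_piece hα hε hlim p (h p)
  have hcross := tendsto_finsetSum Finset.univ fun (i : Fin n) _ =>
    S.tendsto_adjacentSum hα hε hlim h i
  have hsum := (hpieces.add hcross).add hfar
  rw [add_zero, Finset.sum_add_distrib, ← Finset.mul_sum,
    ← integral_eq_sum_pieces (S.intervalIntegrable_gradientDensity_piece hα), add_assoc] at hsum
  refine hsum.congr fun m => ?_
  rw [integral_eq_sum_pieces (S.intervalIntegrable_cauchyBorn_piece hα), slopeTerm, localSum,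
    ← Finset.sum_div, ← Finset.sum_div, ← add_div, ← add_div, Finset.sum_sub_distrib,
    Finset.sum_sub_distrib, Finset.sum_sub_distrib, Finset.sum_div]
  congr 1
  ring

end ChainModel

end SharpInterfaces

namespace SharpInterfaces

variable {n : ℕ}

/-! ### Pairs of non-adjacent pieces -/

/-- A whole piece lies between the atoms of non-adjacent pieces, so each bond is at most `K l^(-α)
ε^α`. For each of at most `(n + 1)²` pairs of pieces there are at most `N²` bonds; after division by
`N` there remains `(N ε) ε^(α - 1)`, with `N ε` bounded. -/
theorem ChainModel.isBigO_nonadjacentEnergy {W u W₀ W₁ W₂ : ℝ → ℝ} {t : Fin (n + 2) → ℝ}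
    {v₀ v₁ v₂ v₃ : Fin (n + 1) → ℝ → ℝ} {δ K M α c : ℝ} {ε : ℕ → ℝ}
    (S : ChainModel W u t W₀ W₁ W₂ v₀ v₁ v₂ v₃ δ K M α)
    (hε : ∀ m, 0 < ε m) (hlim : Tendsto ε atTop (𝓝 0))
    (hN : Tendsto (fun m => ((atoms (t 0) (t (Fin.last (n + 1))) c (ε m)).card : ℝ) * ε m) atTop
      (𝓝 (t (Fin.last (n + 1)) - t 0))) :
    (fun m => nonadjacentEnergy W u t c (ε m)) =O[atTop] fun m => ε m ^ (α - 1) := by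
  obtain ⟨l, hl, hlen⟩ := S.exists_length
  have hK := S.K_pos
  refine IsBigO.of_bound (((n : ℝ) + 1) ^ 2 * ((t (Fin.last (n + 1)) - t 0 + 1) * (K * l ^ (-α)))) ?_
  filter_upwards [hlim.eventually (ge_mem_nhds hl), hN.eventually (ge_mem_nhds (lt_add_one _))]
    with m hm hNm
  have he := hε m
  have hpow := Real.rpow_pos_of_pos he α
  set U := atoms (t 0) (t (Fin.last (n + 1))) c (ε m)
  set w := K * l ^ (-α) * ε m ^ α with hw
  have hw0 : 0 ≤ w := by positivity
  have hpq : ∀ p q : Fin (n + 1), p.val + 2 ≤ q.val →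
      |∑ i ∈ atoms (t p.castSucc) (t p.succ) c (ε m), ∑ j ∈ atoms (t q.castSucc) (t q.succ) c (ε m),
        W ((u (ε m * (c + j)) - u (ε m * (c + i))) / ε m)| ≤ (U.card : ℝ) ^ 2 * w := by
    intro p q h
    refine abs_sum_sum_le (f := bond W u c (ε m)) (S.atoms_subset_chain he p)
      (S.atoms_subset_chain he q) hw0 fun i hi j hj => ?_
    refine S.abs_bond_le he hm (S.atoms_subset_chain he p hi) (S.atoms_subset_chain he q hj) ?_
    rw [mem_atoms he] at hi hj
    have h1 := hlen ⟨p + 1, by omega⟩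
    have h2 : t p.succ = t (Fin.castSucc ⟨p + 1, by omega⟩) := rfl
    have h3 : t (Fin.succ ⟨p + 1, by omega⟩) ≤ t q.castSucc := S.mono.monotone (by
      rw [Fin.le_def]
      change p.val + 1 + 1 ≤ q.val
      exact h)
    linarith [hi.2, hj.1]
  have hsum : |∑ p : Fin (n + 1), ∑ q : Fin (n + 1) with p.val + 2 ≤ q.val,
      ∑ i ∈ atoms (t p.castSucc) (t p.succ) c (ε m), ∑ j ∈ atoms (t q.castSucc) (t q.succ) c (ε m),
        W ((u (ε m * (c + j)) - u (ε m * (c + i))) / ε m)| ≤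
      ((n : ℝ) + 1) ^ 2 * ((U.card : ℝ) ^ 2 * w) := by
    calc _ ≤ ∑ p : Fin (n + 1), ∑ q : Fin (n + 1) with p.val + 2 ≤ q.val, (U.card : ℝ) ^ 2 * w :=
          (Finset.abs_sum_le_sum_abs _ _).trans (Finset.sum_le_sum fun p _ =>
            (Finset.abs_sum_le_sum_abs _ _).trans (Finset.sum_le_sum fun q hq =>
              hpq p q (Finset.mem_filter.1 hq).2))
      _ ≤ ∑ _p : Fin (n + 1), ∑ _q : Fin (n + 1), (U.card : ℝ) ^ 2 * w :=
          Finset.sum_le_sum fun p _ => Finset.sum_le_sum_of_subset_of_nonneg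
            (Finset.filter_subset _ _) fun _ _ _ => by positivity
      _ = _ := by
          simp only [Finset.sum_const, Finset.card_univ, Fintype.card_fin, nsmul_eq_mul]
          push_cast
          ring
  rw [nonadjacentEnergy, Real.norm_eq_abs, Real.norm_eq_abs, abs_mul,
    abs_of_nonneg (by positivity : 0 ≤ 1 / (U.card : ℝ)),
    abs_of_pos (Real.rpow_pos_of_pos he (α - 1))]
  have e : ε m ^ α = ε m ^ (α - 1) * ε m := by
    rw [Real.rpow_sub_one he.ne', div_mul_cancel₀ _ he.ne']
  calc _ ≤ 1 / (U.card : ℝ) * (((n : ℝ) + 1) ^ 2 * ((U.card : ℝ) ^ 2 * w)) := by gcongr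
    _ = ((n : ℝ) + 1) ^ 2 * (((U.card : ℝ) * ε m) * (K * l ^ (-α))) * ε m ^ (α - 1) := by
        rw [hw, e]
        rcases eq_or_ne (U.card : ℝ) 0 with h0 | h0
        · simp [h0]
        · field_simp
    _ ≤ _ := by
        have := Real.rpow_pos_of_pos he (α - 1)
        gcongr

end SharpInterfaces

/-! ### The universal functions and the expansion of the energy. -/

theorem proposition6p1 :
    -- universal functions giving `d_p` and `e_p`
    ∃ (d : ℝ → ℝ → ℝ → ℝ → ℝ) (e : ℝ → ℝ → ℝ → ℝ → ℝ → ℝ → ℝ),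
    ∀ (W : ℝ → ℝ) (α : ℝ), 3 < α → ContDiffOn ℝ ∞ W {0}ᶜ → (∀ x : ℝ, x ≠ 0 → W x = W (-x)) →
      SharpInterfaces.Decays W α →
    -- `F₁`, `F₂` depend on `W`, the coefficients of the pieces and the lengths of the pieces only
    ∀ (n : ℕ) (len a₁ a₂ b₁ b₂ c₁ c₂ : Fin (n + 1) → ℝ),
    ∃ (F₁ : (Fin (n + 1) → ℝ × ℝ) → ℝ) (F₂ : (Fin (n + 1) → (ℝ × ℝ) × (ℝ × ℝ)) → ℝ),
      ContDiffOn ℝ ∞ F₁ (SharpInterfaces.slopeDomain n) ∧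
      ContDiffOn ℝ ∞ F₂ (SharpInterfaces.jetDomain n) ∧
      SharpInterfaces.NoInteraction (SharpInterfaces.slopeDomain n) F₁ ∧
      SharpInterfaces.NoInteraction (SharpInterfaces.jetDomain n) F₂ ∧
      ∀ (t : Fin (n + 2) → ℝ) (a b c : ℝ) (u : ℝ → ℝ) (ε : ℕ → ℝ) (A₁ A₂ B₁ B₂ C₁ C₂ : ℝ),
        StrictMono t → (∀ p : Fin (n + 1), t p.succ - t p.castSucc = len p) →
        a = t 0 → b = t (Fin.last (n + 1)) →
        ContinuousOn u (Set.Icc a b) → MonotoneOn u (Set.Icc a b) →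
        (∀ p : Fin (n + 1), SharpInterfaces.IsSmoothDiffeoOn u (Set.Icc (t p.castSucc) (t p.succ))) →
        (∀ m, 0 < ε m) → Tendsto ε atTop (𝓝 0) →
        SharpInterfaces.LatticeExpansion a b c ε A₁ A₂ B₁ B₂ C₁ C₂ →
        (∀ p : Fin (n + 1), SharpInterfaces.LatticeExpansion (t p.castSucc) (t p.succ) c ε
          (a₁ p) (a₂ p) (b₁ p) (b₂ p) (c₁ p) (c₂ p)) →
        -- the series and integrals in the coefficients converge
        (∀ p : Fin (n + 1), ∀ x ∈ Set.Ioo (t p.castSucc) (t p.succ),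
          Summable (fun j : ℕ => W (deriv u x * (j + 1))) ∧
          Summable (fun j : ℕ => iteratedDeriv 2 W (deriv u x * (j + 1)) *
            iteratedDeriv 2 u x ^ 2 * ((j : ℝ) + 1) ^ 4)) ∧
        IntervalIntegrable (SharpInterfaces.cauchyBorn W u) MeasureTheory.volume a b ∧
        IntervalIntegrable (SharpInterfaces.gradientDensity W u) MeasureTheory.volume a b ∧
        -- the expansion of the energy
        (let E₀ : ℝ := 1 / (b - a) * ∫ x in a..b, SharpInterfaces.cauchyBorn W u x
         let E₁ : ℝ :=
          (∑ p : Fin (n + 1), d C₁ (c₁ p) (t p.succ - t p.castSucc) (b - a) *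
              (∫ x in (t p.castSucc)..(t p.succ), SharpInterfaces.cauchyBorn W u x))
            + F₁ (SharpInterfaces.slopes t u)
         let E₂ : ℝ :=
          -(1 / (24 * (b - a))) * (∫ x in a..b, SharpInterfaces.gradientDensity W u x)
            + (∑ p : Fin (n + 1), e C₁ (c₁ p) C₂ (c₂ p) (t p.succ - t p.castSucc) (b - a) *
              (∫ x in (t p.castSucc)..(t p.succ), SharpInterfaces.cauchyBorn W u x))
            + F₂ (SharpInterfaces.jets t u)
         (fun m => SharpInterfaces.energy W u a b c (ε m) - (E₀ + ε m * E₁ + ε m ^ 2 * E₂))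
          =o[atTop] fun m => ε m ^ 2) ∧
        -- the non-adjacent pieces do not interact up to second order
        (fun m => SharpInterfaces.nonadjacentEnergy W u t c (ε m))
          =O[atTop] (fun m => ε m ^ (α - 1)) ∧
        (fun m => ε m ^ (α - 1)) =o[atTop] (fun m => ε m ^ 2) := by
  -- The coefficients of the global count multiply the integral over all of `[a, b]`, so `d_p` and
  -- `e_p` are the same for every piece.
  refine ⟨fun C₁ _ _ _ => C₁, fun _ _ C₂ _ _ _ => C₂, ?_⟩
  intro W α hα hW heven hd n len a₁ a₂ b₁ b₂ c₁ c₂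
  -- `F₁` and `F₂` are chosen before any sequence is given. Coefficients that are not admissible
  -- come from no lattice; for them zero will do, the remaining claim being vacuous.
  by_cases hadm : SharpInterfaces.Admissible a₁ b₁
  swap
  · refine ⟨fun _ => 0, fun _ => 0, contDiffOn_const, contDiffOn_const,
      ⟨0, 0, 0, by simp⟩, ⟨0, 0, 0, by simp⟩, ?_⟩
    intro t a b c u ε A₁ A₂ B₁ B₂ C₁ C₂ ht _ ha hb _ hmono hu hε hlim _ h
    subst ha hb
    obtain ⟨W₀, W₁, W₂, v₀, v₁, v₂, v₃, δ, K, M, S⟩ :=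
      SharpInterfaces.exists_chainModel (by linarith) hW hd ht hmono hu
    exact absurd (S.admissible hε hlim h) hadm
  have s₁ := SharpInterfaces.contDiffOn_slopeTerm hα hW hd hadm
  have s₂ := SharpInterfaces.contDiffOn_jetTerm hα hW hd a₂ b₂ hadm
  have s₃ : ContDiffOn ℝ ∞ (fun v : Fin (n + 1) → (ℝ × ℝ) × (ℝ × ℝ) =>
      SharpInterfaces.slopeTerm W a₁ b₁ fun p => ((v p).1.1, (v p).2.1))
      (SharpInterfaces.jetDomain n) :=
    s₁.comp (f := fun (v : Fin (n + 1) → (ℝ × ℝ) × (ℝ × ℝ)) p => ((v p).1.1, (v p).2.1))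
      (by fun_prop) fun v hv => hv
  have i₁ := SharpInterfaces.noInteraction_localSum (SharpInterfaces.slopeDomain n)
    (fun p => SharpInterfaces.edgeEnergy W (a₁ p)) (fun p => SharpInterfaces.edgeEnergy W (b₁ p))
    fun i x y => SharpInterfaces.crossEnergy W (1 - b₁ i.castSucc) (1 - a₁ i.succ) (x, y)
  have i₂ : SharpInterfaces.NoInteraction (SharpInterfaces.jetDomain n)
      (SharpInterfaces.jetTerm W a₁ a₂ b₁ b₂) := SharpInterfaces.noInteraction_localSum _ _ _ _
  -- The product of expansions yields `C₁` times the slope term in `E²`, but `F₂` may not depend on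
  -- `C₁`. It is replaced by its value in terms of the extreme coefficients of the first and last
  -- pieces and the total length, from `count_coefficient`.
  refine ⟨fun v => 1 / (∑ p, len p) * SharpInterfaces.slopeTerm W a₁ b₁ v,
    fun v => (a₁ 0 + b₁ (Fin.last n) - 1) / (∑ p, len p) ^ 2 *
      SharpInterfaces.slopeTerm W a₁ b₁ (fun p => ((v p).1.1, (v p).2.1)) +
      1 / (∑ p, len p) * SharpInterfaces.jetTerm W a₁ a₂ b₁ b₂ v,
    contDiffOn_const.mul s₁, (contDiffOn_const.mul s₃).add (contDiffOn_const.mul s₂), i₁.const_mul _,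
    ((i₁.comp_map Prod.fst fun v hv => hv).const_mul _).add (i₂.const_mul _), ?_⟩
  intro t a b c u ε A₁ A₂ B₁ B₂ C₁ C₂ ht hlen ha hb _ hmono hu hε hlim hab h
  subst ha hb
  obtain ⟨W₀, W₁, W₂, v₀, v₁, v₂, v₃, δ, K, M, S⟩ :=
    SharpInterfaces.exists_chainModel (by linarith) hW hd ht hmono hu
  have hlt : t 0 < t (Fin.last (n + 1)) := ht (Fin.last_pos)
  have hN := hab.tendsto_card hε hlim hlt.le
  have hL : ∑ p, len p = t (Fin.last (n + 1)) - t 0 := by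
    have := SharpInterfaces.integral_eq_sum_pieces (t := t) (f := fun _ => (1 : ℝ))
      fun _ => intervalIntegrable_const
    simp only [intervalIntegral.integral_const, smul_eq_mul, mul_one] at this
    rw [this]
    exact Finset.sum_congr rfl fun p _ => (hlen p).symm
  have hC : (a₁ 0 + b₁ (Fin.last n) - 1) / (∑ p, len p) ^ 2 = C₁ := by
    rw [hL, hab.count_coefficient hε hlim hlt, (h 0).left_unique hab hε hlim,
      (h (Fin.last n)).right_unique hab hε hlim]
  refine ⟨fun p x hx => S.summable_densities hα p hx,
    SharpInterfaces.intervalIntegrable_of_pieces (S.intervalIntegrable_cauchyBorn_piece hα),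
    SharpInterfaces.intervalIntegrable_of_pieces (S.intervalIntegrable_gradientDensity_piece hα),
    ?_, S.isBigO_nonadjacentEnergy hε hlim hN,
    SharpInterfaces.isLittleO_rpow_sq (by linarith) hε hlim⟩
  have key := SharpInterfaces.isLittleO_mul_expansion hε hlim
    (S.tendsto_pairSum hα hε hlim h hN) hab.count
  have hs : (fun p => ((SharpInterfaces.jets t u p).1.1, (SharpInterfaces.jets t u p).2.1)) =
      SharpInterfaces.slopes t u := rfl
  refine key.congr_left fun m => ?_
  simp only
  rw [SharpInterfaces.energy_eq_pairSum heven, SharpInterfaces.card_atoms_cast (hε m) hlt.le, hC,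
    hL, hs, ← Finset.mul_sum, ← Finset.mul_sum,
    ← SharpInterfaces.integral_eq_sum_pieces (S.intervalIntegrable_cauchyBorn_piece hα)]
  have : t (Fin.last (n + 1)) - t 0 ≠ 0 := (sub_pos.2 hlt).ne'
  field_simp
  ring
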